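/- **Setting.** Let $Q,B$ be real $d\times d$ matrices with $Q$ symmetric nonnegative definite, and let $\Pi$ be a Lévy measure on $\mathbb R^d$, i.e. $\Pi(\{0\})=0$ and $\int(1\wedge|y|^2)\,\Pi(dy)<\infty$. Put $Q_t=\int_0^t e^{sB}Qe^{sB^*}ds$ for $0\le t\le\infty$, $\Phi(\xi)=\int\big(e^{i\langle\xi,y\rangle}-1-i\langle\xi,y\rangle 1_{\{|y|\le1\}}\big)\Pi(dy)$, $\Phi_t(\xi)=\int_0^t\Phi(e^{sB^*}\xi)\,ds$ for $0\le t\le\infty$, and $\Psi_t(\xi)=-\frac12\langle Q_t\xi,\xi\rangle+\Phi_t(\xi)$. Assume that $\det Q_t>0$ for all $0<t<\infty$, that all eigenvalues of $B$ have negative real part, and that $\int_{|y|\ge1}\log|y|\,\Pi(dy)<\infty$. Let $P=(P_t)_{t\ge0}$ be the Lévy-OU semigroup of $(Q,B,\Pi)$, $P_tf(x)=\int f(y)\,P_t(x,dy)$, where $P_t(x,\cdot)$ is the probability measure with characteristic function $\xi\mapsto\exp\big(\Psi_t(\xi)+i\langle e^{tB^*}\xi,x\rangle\big)$. This is a well-defined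 Feller semigroup (the measures exist, form a Markov transition function, preserve $C_0(\mathbb R^d)$, and $P_tf\to f$ pointwise as $t\downarrow0$ for $f\in C_0(\mathbb R^d)$), and for $u\in C_c^\infty(\mathbb R^d)$ one has, pointwise, $\lim_{t\downarrow0}(P_tu-u)/t=Au$ with $$Au(x)=\tfrac12\mathrm{tr}(Q\nabla^2u(x))+\langle Bx,\nabla u(x)\rangle+\int\big[u(x+y)-u(x)-\langle\nabla u(x),y\rangle1_{\{|y|\le1\}}\big]\Pi(dy).$$ It has a unique invariant distribution $\mu$. **Proposition.** (1) Let $\widetilde Q$ be a symmetric nonnegative definite matrix with $\det\widetilde Q_t>0$ for all $0<t<\infty$ and $Q_\infty-\widetilde Q_\infty$ nonnegative definite, where $\widetilde Q_t=\int_0^te^{sB}\widetilde Qe^{sB^*}ds$. Let $\widetilde P$ be the diffusion OU semigroup of $(\widetilde Q,B,0)$ (again a Feller semigroup, with generator $\frac12\mathrm{tr}(\widetilde Q\nabla^2)+\langle Bx,\nabla\rangle$ on $C_c^\infty(\mathbb R^d)$ in the above sense), and $\widetilde\mu$ its unique invariant distribution. There is a (unique) probability measure $h_\Lambda$ with $$\int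 e^{i\langle\xi,x\rangle}h_\Lambda(dx)=\exp\big(-\tfrac12\langle(Q_\infty-\widetilde Q_\infty)\xi,\xi\rangle+\Phi_\infty(\xi)\big)\qquad(\xi\in\mathbb R^d),$$ and it is infinitely divisible. For every $1\le p\le\infty$, the Markov operator $\Lambda f(x)=\int f(x+y)\,h_\Lambda(dy)$ is a bounded operator $L^p(\mu)\to L^p(\widetilde\mu)$, $P_t$ and $\widetilde P_t$ are bounded operators on $L^p(\mu)$ and $L^p(\widetilde\mu)$ (all given by their integral formulas, which converge absolutely almost everywhere), and $$\widetilde P_t\Lambda=\Lambda P_t\quad\text{on }L^p(\mu),\qquad t\ge0.$$ (2) Let $e^{tL}f(x)=f(e^{tB}x)$ be the semigroup of $L=\langle Bx,\nabla\rangle$ (the case $\widetilde Q=0$), and $\Lambda_1f(x)=\int f(x+y)\,\mu(dy)$. Then $e^{tL}$, $\Lambda_1$ and $P_t$ are bounded operators on $L^\infty(\mu)$ and $$e^{tL}\Lambda_1=\Lambda_1P_t\quad\text{on }L^\infty(\mu),\qquad t\ge0.$$ (3) If moreover $\int_{|y|>1}|y|^n\,\Pi(dy)<\infty$ for all $n\ge1$,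 then for every complex polynomial $f$ on $\mathbb R^d$ and all $t\ge0$ the integrals defining $P_tf(x)$, $\Lambda_1f(x)$ and $\Lambda_1P_tf(x)$ converge absolutely for every $x\in\mathbb R^d$, and $e^{tL}\Lambda_1f(x)=\Lambda_1P_tf(x)$ for every $x\in\mathbb R^d$. -/

import Mathlib

open MeasureTheory Filter Topology
open scoped ENNReal

noncomputable section

namespace LevyOU

/-- The Euclidean space `ℝ^d`. -/
abbrev Vec (d : ℕ) : Type := EuclideanSpace ℝ (Fin d)

/-- The linear map `x ↦ A x` of `ℝ^d` given by a real `d × d` matrix. -/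
def mulVecL {d : ℕ} (A : Matrix (Fin d) (Fin d) ℝ) : Vec d →L[ℝ] Vec d :=
  Matrix.toEuclideanCLM (n := Fin d) (𝕜 := ℝ) A

/-- The linear flow `e^{tB}`. -/
def flow {d : ℕ} (B : Matrix (Fin d) (Fin d) ℝ) (t : ℝ) : Vec d →L[ℝ] Vec d :=
  mulVecL (NormedSpace.exp (t • B))

/-- Lévy measures on `ℝ^d`: no mass at `0` and `∫ (1 ∧ |y|²) ν(dy) < ∞`. -/
structure IsLevyMeasure {d : ℕ} (ν : Measure (Vec d)) : Prop where
  zero : ν {0} = 0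
  lintegral_lt_top : ∫⁻ y, ENNReal.ofReal (min 1 (‖y‖ ^ 2)) ∂ν < ∞

/-- The integrand `e^{sB} Q e^{sB*}` of the covariance matrices. -/
def covIntegrand {d : ℕ} (Q B : Matrix (Fin d) (Fin d) ℝ) (s : ℝ) : Matrix (Fin d) (Fin d) ℝ :=
  NormedSpace.exp (s • B) * Q * NormedSpace.exp (s • B.transpose)

/-- `Q_t = ∫_0^t e^{sB} Q e^{sB*} ds` (entrywise integral). -/
def cov {d : ℕ} (Q B : Matrix (Fin d) (Fin d) ℝ) (t : ℝ) : Matrix (Fin d) (Fin d) ℝ :=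
  Matrix.of fun i j => ∫ s in (0 : ℝ)..t, covIntegrand Q B s i j

/-- `Q_∞ = ∫_0^∞ e^{sB} Q e^{sB*} ds` (entrywise integral). -/
def covInfty {d : ℕ} (Q B : Matrix (Fin d) (Fin d) ℝ) : Matrix (Fin d) (Fin d) ℝ :=
  Matrix.of fun i j => ∫ s in Set.Ioi (0 : ℝ), covIntegrand Q B s i j

/-- The jump part of the Lévy–Khintchine exponent,
`Φ(ξ) = ∫ (e^{i⟨ξ,y⟩} - 1 - i⟨ξ,y⟩ 1_{|y| ≤ 1}) ν(dy)`. -/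
def jumpExponent {d : ℕ} (ν : Measure (Vec d)) (ξ : Vec d) : ℂ :=
  ∫ y, (Complex.exp ((inner ℝ ξ y : ℝ) * Complex.I) - 1
    - (Metric.closedBall (0 : Vec d) 1).indicator
        (fun z => ((inner ℝ ξ z : ℝ) : ℂ) * Complex.I) y) ∂ν

/-- `Φ_t(ξ) = ∫_0^t Φ(e^{sB*} ξ) ds`. -/
def jumpExponentAt {d : ℕ} (B : Matrix (Fin d) (Fin d) ℝ) (ν : Measure (Vec d))
    (t : ℝ) (ξ : Vec d) : ℂ :=
  ∫ s in (0 : ℝ)..t, jumpExponent ν (flow B.transpose s ξ)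

/-- `Φ_∞(ξ) = ∫_0^∞ Φ(e^{sB*} ξ) ds`. -/
def jumpExponentInfty {d : ℕ} (B : Matrix (Fin d) (Fin d) ℝ) (ν : Measure (Vec d))
    (ξ : Vec d) : ℂ :=
  ∫ s in Set.Ioi (0 : ℝ), jumpExponent ν (flow B.transpose s ξ)

/-- `Ψ_t(ξ) = -½ ⟨Q_t ξ, ξ⟩ + Φ_t(ξ)`. -/
def exponentAt {d : ℕ} (Q B : Matrix (Fin d) (Fin d) ℝ) (ν : Measure (Vec d))
    (t : ℝ) (ξ : Vec d) : ℂ :=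
  ((-(1 / 2) * inner ℝ (mulVecL (cov Q B t) ξ) ξ : ℝ) : ℂ) + jumpExponentAt B ν t ξ

open Classical in
/-- The probability measure with characteristic function `φ` (it is unique if it exists; the value
is `0`, which is not a probability measure, if there is none). -/
def measureOfCharFun {d : ℕ} (φ : Vec d → ℂ) : Measure (Vec d) :=
  if h : ∃ m : Measure (Vec d), IsProbabilityMeasure m ∧ ∀ ξ, charFun m ξ = φ ξ
  then h.choose else 0

/-- The transition function `P_t(x, dy)` of the Lévy–Ornstein–Uhlenbeck process with triple
`(Q, B, ν)`: the probability measure with characteristic function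
`ξ ↦ exp(Ψ_t(ξ) + i⟨e^{tB*} ξ, x⟩)`, which is the law at time `t` of the solution of
`dX = B X dt + dL`, `X_0 = x`. -/
def ouTransition {d : ℕ} (Q B : Matrix (Fin d) (Fin d) ℝ) (ν : Measure (Vec d))
    (t : ℝ) (x : Vec d) : Measure (Vec d) :=
  measureOfCharFun fun ξ =>
    Complex.exp (exponentAt Q B ν t ξ + (inner ℝ (flow B.transpose t ξ) x : ℝ) * Complex.I)

/-- The generator of the triple `(Q, B, ν)`:
`A u(x) = ½ tr(Q ∇²u(x)) + ⟨Bx, ∇u(x)⟩ + ∫ (u(x+y) - u(x) - ⟨∇u(x), y⟩ 1_{|y| ≤ 1}) ν(dy)`. -/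
def ouGenerator {d : ℕ} (Q B : Matrix (Fin d) (Fin d) ℝ) (ν : Measure (Vec d))
    (u : Vec d → ℂ) (x : Vec d) : ℂ :=
  (1 / 2) * (∑ i, ∑ j, (Q i j : ℂ) *
      iteratedFDeriv ℝ 2 u x ![EuclideanSpace.single i 1, EuclideanSpace.single j 1])
    + fderiv ℝ u x (mulVecL B x)
    + ∫ y, (u (x + y) - u x
        - (Metric.closedBall (0 : Vec d) 1).indicator (fun z => fderiv ℝ u x z) y) ∂ν

/-- The operator `f ↦ (x ↦ ∫ f(y) K(x, dy))` of a family of measures `K(x, ·)`. -/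
def kernelOp {d : ℕ} (K : Vec d → Measure (Vec d)) (f : Vec d → ℂ) (x : Vec d) : ℂ :=
  ∫ y, f y ∂(K x)

/-- The convolution kernel of a measure `h`; its operator is `Λ f(x) = ∫ f(x + y) h(dy)`. -/
def convKernel {d : ℕ} (h : Measure (Vec d)) (x : Vec d) : Measure (Vec d) :=
  h.map fun y => x + y

/-- The transition function of the drift semigroup `e^{tL}`, `L = ⟨Bx, ∇⟩`, that is,
`e^{tL} f(x) = f(e^{tB} x)`. -/
def driftKernel {d : ℕ} (B : Matrix (Fin d) (Fin d) ℝ) (t : ℝ) (x : Vec d) : Measure (Vec d) :=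
  Measure.dirac (flow B t x)

/-- `P = (P_t)_{t ≥ 0}` is a Markov transition semigroup which is Feller (it acts on `C_0(ℝ^d)`,
continuously in time) and whose generator is given by `A` on `C_c^∞(ℝ^d)`. For the last two
properties pointwise limits are used, as is usual for Feller semigroups. -/
structure IsFellerWithGenerator {d : ℕ} (P : ℝ → Vec d → Measure (Vec d))
    (A : (Vec d → ℂ) → Vec d → ℂ) : Prop where
  isProbabilityMeasure : ∀ t : ℝ, 0 ≤ t → ∀ x, IsProbabilityMeasure (P t x)
  measurable : ∀ t : ℝ, 0 ≤ t → Measurable (P t)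
  zero : ∀ x, P 0 x = Measure.dirac x
  add : ∀ s t : ℝ, 0 ≤ s → 0 ≤ t → ∀ x (S : Set (Vec d)), MeasurableSet S →
    P (s + t) x S = ∫⁻ y, P t y S ∂(P s x)
  feller : ∀ t : ℝ, 0 ≤ t → ∀ f : Vec d → ℂ, Continuous f → Tendsto f (cocompact _) (𝓝 0) →
    Continuous (kernelOp (P t) f) ∧ Tendsto (kernelOp (P t) f) (cocompact _) (𝓝 0)
  tendsto_zero : ∀ f : Vec d → ℂ, Continuous f → Tendsto f (cocompact _) (𝓝 0) →
    ∀ x, Tendsto (fun t => kernelOp (P t) f x) (𝓝[>] 0) (𝓝 (f x))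
  generator : ∀ f : Vec d → ℂ, ContDiff ℝ ((⊤ : ℕ∞) : WithTop ℕ∞) f → HasCompactSupport f →
    ∀ x, Tendsto (fun t : ℝ => (t : ℂ)⁻¹ * (kernelOp (P t) f x - f x)) (𝓝[>] 0) (𝓝 (A f x))

/-- `m` is an invariant distribution of the transition semigroup `P`. -/
structure IsInvariantDistribution {d : ℕ} (P : ℝ → Vec d → Measure (Vec d))
    (m : Measure (Vec d)) : Prop where
  isProbabilityMeasure : IsProbabilityMeasure m
  invariant : ∀ t : ℝ, 0 ≤ t → ∀ S : Set (Vec d), MeasurableSet S → ∫⁻ x, P t x S ∂m = m S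

/-- `m` is infinitely divisible: for every `n ≥ 1` it is the law of a sum of `n` independent
identically distributed random vectors. -/
def IsInfinitelyDivisible {d : ℕ} (m : Measure (Vec d)) : Prop :=
  ∀ n : ℕ, 1 ≤ n → ∃ r : Measure (Vec d), IsProbabilityMeasure r ∧
    (Measure.pi fun _ : Fin n => r).map (fun y => ∑ i, y i) = m

/-- The bounded operator `T : L^p(m) → L^p(m')` is the operator of the kernel `K` on `L^p(m)`: for
every function `f` in `L^p(m)`, the integral `∫ f(y) K(x, dy)` converges absolutely and equals
`T f (x)`, for `m'`-almost every `x`. -/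
def IsKernelOpOnLp {d : ℕ} {p : ℝ≥0∞} [Fact (1 ≤ p)] {m m' : Measure (Vec d)}
    (T : Lp ℂ p m →L[ℂ] Lp ℂ p m') (K : Vec d → Measure (Vec d)) : Prop :=
  ∀ (f : Vec d → ℂ) (hf : MemLp f p m),
    (∀ᵐ x ∂m', Integrable f (K x)) ∧ T (hf.toLp f) =ᵐ[m'] kernelOp K f

/-- The complex function on `ℝ^d` given by a polynomial in `d` variables. -/
def polyFun {d : ℕ} (q : MvPolynomial (Fin d) ℂ) (x : Vec d) : ℂ :=
  MvPolynomial.eval (fun i => (x i : ℂ)) q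

end LevyOU

end

open LevyOU

/-!
All kernels in the statement are of the form `x ↦` law of `A x + Y`, with a linear map `A` and a
random vector `Y` independent of `x` (`shiftKernel`). Two such kernels compose to a third one, with
the linear maps composed and the noise laws convolved, so an intertwining relation is an identity
between two convolutions, which is checked on characteristic functions. For `P'_t Λ = Λ P_t` the
linear map on both sides is `e^{tB}`, and the identity of the noises follows from
`Ψ_∞ = Ψ_t + Ψ_∞ ∘ e^{tB*}` (`exponentInfty_eq_add`), applied to both triples. With `μ` in place of
`h_Λ` and no noise in the drift semigroup, the same identity says that `μ` is invariant.

The measures involved exist because their exponents belong to the class `IsLevyExponent` of exponents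
of convolution semigroups. It contains Gaussian, drift and compound Poisson exponents and is closed
under sums, linear changes of variable, pointwise limits (by Lévy's continuity theorem) and hence
time integrals. The logarithmic moment and the exponential decay of `e^{sB}` make the time integral
up to infinity converge (`exists_integrableOn_bound_levyExponent_flow`). The exponent of `h_Λ` is the
sum of a Gaussian one, where `Q_∞ - Q'_∞ ≥ 0` enters, and `Φ_∞`. The generator is computed on the
Fourier side, where the difference quotients are dominated by `C (1 + |ξ|²)`.

A Markov kernel that transports `m'` to `m` is a contraction `L^p(m) → L^p(m')`, by Jensen's
inequality; on `L^∞` it is enough that it transports `m'` to a measure absolutely continuous with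
respect to `m` (`LpCompatible`). The convolution `μ' ∗ h_Λ = μ` and invariance give the first
condition. The kernels of `e^{tL}` and `Λ₁` satisfy only the second one, since `μ` is equivalent to
Lebesgue measure: `Q_∞` is positive definite, so `μ` has an isotropic Gaussian convolution factor
(`equivalent_volume_of_charFun`).

For polynomials one needs all moments of `μ`. If the Lévy measure has all moments away from the
origin, `Ψ_∞` is smooth along lines, and a finite measure on the line with a smooth characteristic
function has all moments (`lintegral_pow_lt_top_of_contDiff_charFun`). The noise of `P_t` inherits
the moments, being a convolution factor of `μ`.
-/

/-! ### The linear flow -/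

section Flow

variable {d : ℕ}

theorem continuous_mulVecL : Continuous (mulVecL : Matrix (Fin d) (Fin d) ℝ → Vec d →L[ℝ] Vec d) :=
  LinearMap.continuous_of_finiteDimensional
    (Matrix.toEuclideanCLM (n := Fin d) (𝕜 := ℝ)).toAlgEquiv.toLinearMap

theorem mulVecL_apply (A : Matrix (Fin d) (Fin d) ℝ) (x : Vec d) (i : Fin d) :
    mulVecL A x i = ∑ j, A i j * x j := rfl

theorem inner_mulVecL (A : Matrix (Fin d) (Fin d) ℝ) (x y : Vec d) :
    inner ℝ (mulVecL A x) y = ∑ i, ∑ j, A i j * (x j * y i) := by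
  rw [PiLp.inner_apply]
  refine Finset.sum_congr rfl fun i _ => ?_
  rw [mulVecL_apply]
  simp only [RCLike.inner_apply, conj_trivial, Finset.mul_sum]
  exact Finset.sum_congr rfl fun j _ => by ring

theorem inner_mulVecL_eq_dotProduct (A : Matrix (Fin d) (Fin d) ℝ) (ξ η : Vec d) :
    inner ℝ (mulVecL A ξ) η = η.ofLp ⬝ᵥ A.mulVec ξ.ofLp := by
  rw [real_inner_comm]
  exact Matrix.inner_toEuclideanCLM A η ξ

theorem inner_mulVecL_transpose (A : Matrix (Fin d) (Fin d) ℝ) (x y : Vec d) :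
    inner ℝ (mulVecL A.transpose x) y = inner ℝ x (mulVecL A y) := by
  rw [← real_inner_comm, real_inner_comm (mulVecL A y), inner_mulVecL, real_inner_comm,
    inner_mulVecL, Finset.sum_comm]
  refine Finset.sum_congr rfl fun i _ => Finset.sum_congr rfl fun j _ => ?_
  rw [Matrix.transpose_apply]; ring

theorem flow_eq_exp (B : Matrix (Fin d) (Fin d) ℝ) (t : ℝ) :
    flow B t = NormedSpace.exp (t • mulVecL B) := by
  let _ : NormedRing (Matrix (Fin d) (Fin d) ℝ) := Matrix.linftyOpNormedRing
  let _ : NormedAlgebra ℝ (Matrix (Fin d) (Fin d) ℝ) := Matrix.linftyOpNormedAlgebra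
  let _ : NormedAlgebra ℚ (Matrix (Fin d) (Fin d) ℝ) := NormedAlgebra.restrictScalars ℚ ℝ _
  have h := NormedSpace.map_exp (Matrix.toEuclideanCLM (n := Fin d) (𝕜 := ℝ))
    continuous_mulVecL (t • B)
  rw [map_smul] at h
  exact h

theorem flow_zero (B : Matrix (Fin d) (Fin d) ℝ) : flow B 0 = ContinuousLinearMap.id ℝ _ := by
  rw [flow_eq_exp]
  exact (congrArg _ (zero_smul ℝ (mulVecL B))).trans NormedSpace.exp_zero

theorem flow_add (B : Matrix (Fin d) (Fin d) ℝ) (s t : ℝ) :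
    flow B (s + t) = (flow B s).comp (flow B t) := by
  rw [flow, add_smul, Matrix.exp_add_of_commute _ _ (((Commute.refl B).smul_left s).smul_right t)]
  exact map_mul Matrix.toEuclideanCLM _ _

theorem flow_add_apply (B : Matrix (Fin d) (Fin d) ℝ) (s t : ℝ) (x : Vec d) :
    flow B (s + t) x = flow B s (flow B t x) := by
  rw [flow_add]; rfl

theorem hasDerivAt_flow (B : Matrix (Fin d) (Fin d) ℝ) (t : ℝ) :
    HasDerivAt (flow B) ((flow B t).comp (mulVecL B)) t := by
  have h := hasDerivAt_exp_smul_const (𝕂 := ℝ) (mulVecL B) t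
  rw [funext (flow_eq_exp B)]
  exact h

theorem continuous_flow (B : Matrix (Fin d) (Fin d) ℝ) : Continuous (flow B) :=
  continuous_iff_continuousAt.2 fun t => (hasDerivAt_flow B t).continuousAt

theorem continuous_flow_apply (B : Matrix (Fin d) (Fin d) ℝ) (x : Vec d) :
    Continuous fun t => flow B t x :=
  (continuous_flow B).clm_apply continuous_const

theorem flow_neg_apply (B : Matrix (Fin d) (Fin d) ℝ) (t : ℝ) (x : Vec d) :
    flow B (-t) (flow B t x) = x := by
  rw [← flow_add_apply, neg_add_cancel, flow_zero]; rfl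

theorem flow_transpose (B : Matrix (Fin d) (Fin d) ℝ) (t : ℝ) :
    flow B.transpose t = mulVecL (NormedSpace.exp (t • B)).transpose := by
  rw [flow, ← Matrix.transpose_smul, Matrix.exp_transpose]

theorem inner_flow_transpose (B : Matrix (Fin d) (Fin d) ℝ) (t : ℝ) (x y : Vec d) :
    inner ℝ (flow B.transpose t x) y = inner ℝ x (flow B t y) := by
  rw [flow_transpose, inner_mulVecL_transpose]; rfl

/-- The flow as a homeomorphism, with inverse the flow at time `-t`. -/
noncomputable def flowHomeomorph (B : Matrix (Fin d) (Fin d) ℝ) (t : ℝ) : Vec d ≃ₜ Vec d where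
  toFun := flow B t
  invFun := flow B (-t)
  left_inv := flow_neg_apply B t
  right_inv x := by simpa using flow_neg_apply B (-t) x
  continuous_toFun := (flow B t).continuous
  continuous_invFun := (flow B (-t)).continuous

theorem norm_flow_transpose_le (B : Matrix (Fin d) (Fin d) ℝ) (t : ℝ) :
    ‖flow B.transpose t‖ ≤ ‖flow B t‖ := by
  refine ContinuousLinearMap.opNorm_le_bound _ (norm_nonneg _) fun x => ?_
  rcases eq_or_ne (flow B.transpose t x) 0 with h | h
  · rw [h, norm_zero]; positivity
  · have h1 : ‖flow B.transpose t x‖ * ‖flow B.transpose t x‖ ≤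
        (‖flow B t‖ * ‖x‖) * ‖flow B.transpose t x‖ := by
      calc _ = inner ℝ (flow B.transpose t x) (flow B.transpose t x) :=
            (real_inner_self_eq_norm_mul_norm _).symm
        _ = inner ℝ x (flow B t (flow B.transpose t x)) := inner_flow_transpose _ _ _ _
        _ ≤ ‖x‖ * ‖flow B t (flow B.transpose t x)‖ := real_inner_le_norm _ _
        _ ≤ ‖x‖ * (‖flow B t‖ * ‖flow B.transpose t x‖) := by
            gcongr; exact ContinuousLinearMap.le_opNorm _ _
        _ = _ := by ring
    exact le_of_mul_le_mul_right h1 (norm_pos_iff.2 h)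

/-- If all eigenvalues of `T` have negative real part then `e^{tT} v → 0`: on a generalized
eigenspace `e^{tT} v` is `e^{tz}` times a polynomial in `t`. -/
theorem tendsto_exp_smul_apply_zero {V : Type*} [NormedAddCommGroup V] [NormedSpace ℂ V]
    [FiniteDimensional ℂ V] (T : V →L[ℂ] V)
    (hT : ∀ z, Module.End.HasEigenvalue (T : Module.End ℂ V) z → z.re < 0) (v : V) :
    Tendsto (fun t : ℝ => NormedSpace.exp ((t : ℂ) • T) v) atTop (𝓝 0) := by
  have : CompleteSpace V := FiniteDimensional.complete ℂ V
  have hv : v ∈ ⨆ z, Module.End.maxGenEigenspace (T : Module.End ℂ V) z := by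
    rw [Module.End.iSup_maxGenEigenspace_eq_top]; trivial
  induction hv using Submodule.iSup_induction' with
  | zero => simp
  | add x y _ _ hx hy => simpa using hx.add hy
  | mem z x hx =>
    obtain ⟨k, hk⟩ := (Module.End.mem_maxGenEigenspace _ _ _).1 hx
    rcases eq_or_ne x 0 with rfl | hx0
    · simp
    have hz : z.re < 0 := by
      apply hT
      refine Module.End.hasEigenvalue_of_hasGenEigenvalue (k := k) ?_
      intro h
      apply hx0
      rw [← Submodule.mem_bot ℂ, ← h]
      exact (Module.End.mem_genEigenspace_nat).2 hk
    -- on the generalized eigenspace of `z`, `T` is `z` plus the locally nilpotent `N`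
    set N : V →L[ℂ] V := T - z • 1 with hN
    have hNk : (N ^ k) x = 0 := by
      have : ((N ^ k : V →L[ℂ] V) : V →ₗ[ℂ] V) = ((T : Module.End ℂ V) - z • 1) ^ k := by
        rw [ContinuousLinearMap.toLinearMap_pow]; rfl
      have h2 := congrArg (fun f : V →ₗ[ℂ] V => f x) this
      exact h2.trans hk
    let _ : NormedAlgebra ℚ (V →L[ℂ] V) := NormedAlgebra.restrictScalars ℚ ℂ _
    have hexp (t : ℝ) : NormedSpace.exp ((t : ℂ) • T) x =
        ∑ j ∈ Finset.range k, (Complex.exp (t * z) * (t : ℂ) ^ j) •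
          (((j.factorial : ℂ)⁻¹) • (N ^ j) x) := by
      have h1 : (t : ℂ) • T = (t * z : ℂ) • (1 : V →L[ℂ] V) + (t : ℂ) • N := by
        rw [hN, smul_sub, smul_smul]; abel
      have hc : Commute ((t * z : ℂ) • (1 : V →L[ℂ] V)) ((t : ℂ) • N) :=
        (Commute.one_left _).smul_left _
      have h2 : NormedSpace.exp ((t * z : ℂ) • (1 : V →L[ℂ] V)) =
          Complex.exp (t * z) • (1 : V →L[ℂ] V) := by
        rw [← Algebra.algebraMap_eq_smul_one, ← Algebra.algebraMap_eq_smul_one,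
          ← NormedSpace.algebraMap_exp_comm, Complex.exp_eq_exp_ℂ]
      rw [h1, NormedSpace.exp_add_of_commute hc, h2, smul_mul_assoc, one_mul,
        smul_apply]
      have h3 := NormedSpace.exp_series_hasSum_exp' (𝕂 := ℂ) ((t : ℂ) • N)
      have h4 := (ContinuousLinearMap.apply ℂ V x).hasSum h3
      have h5 := hasSum_sum_of_ne_finset_zero (L := SummationFilter.unconditional ℕ) (s := Finset.range k)
        (f := fun n : ℕ => (ContinuousLinearMap.apply ℂ V x)
          (((n.factorial : ℂ)⁻¹) • ((t : ℂ) • N) ^ n)) (by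
          intro j hj
          rw [Finset.mem_range, not_lt] at hj
          have : (N ^ j) x = 0 := by
            rw [← Nat.sub_add_cancel hj, pow_add]
            show (N ^ (j - k)) ((N ^ k) x) = 0
            rw [hNk, map_zero]
          simp [smul_pow, this])
      have h6 := h4.unique h5
      have h7 : (ContinuousLinearMap.apply ℂ V x) (NormedSpace.exp ((t : ℂ) • N)) =
        (NormedSpace.exp ((t : ℂ) • N)) x := rfl
      rw [← h7, h6, Finset.smul_sum]
      refine Finset.sum_congr rfl fun j _ => ?_
      simp only [smul_pow, ContinuousLinearMap.apply_apply, smul_apply,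
        smul_smul]
      congr 1; ring
    simp_rw [hexp]
    rw [← Finset.sum_const_zero (s := Finset.range k)]
    refine tendsto_finsetSum _ fun j _ => ?_
    rw [← zero_smul ℂ (((j.factorial : ℂ)⁻¹) • (N ^ j) x)]
    refine Tendsto.smul_const ?_ _
    rw [tendsto_zero_iff_norm_tendsto_zero]
    have h9 : Tendsto (fun t : ℝ => t ^ j * Real.exp (- (-z.re) * t)) atTop (𝓝 0) := by
      have := tendsto_rpow_mul_exp_neg_mul_atTop_nhds_zero j (-z.re) (by linarith)
      simpa using this
    refine h9.congr' ?_
    filter_upwards [eventually_ge_atTop 0] with t ht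
    rw [norm_mul, norm_pow, Complex.norm_exp, Complex.norm_real, Real.norm_of_nonneg ht]
    simp [mul_comm]

/-- The flow decays if all eigenvalues of `B` have negative real part, by passing to the
complexification of `B`. -/
theorem tendsto_flow_atTop_zero (B : Matrix (Fin d) (Fin d) ℝ)
    (hB : ∀ z ∈ spectrum ℂ (B.map (algebraMap ℝ ℂ)), z.re < 0) :
    Tendsto (flow B) atTop (𝓝 0) := by
  set BC : Matrix (Fin d) (Fin d) ℂ := B.map (algebraMap ℝ ℂ) with hBC
  let φ := Matrix.toEuclideanCLM (n := Fin d) (𝕜 := ℂ)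
  have hφ : Continuous φ := LinearMap.continuous_of_finiteDimensional
    (Matrix.toEuclideanCLM (n := Fin d) (𝕜 := ℂ)).toAlgEquiv.toLinearMap
  have hspec : ∀ z, Module.End.HasEigenvalue (φ BC : Module.End ℂ (EuclideanSpace ℂ (Fin d))) z →
      z.re < 0 := by
    intro z hz
    apply hB
    rw [← AlgEquiv.spectrum_eq φ]
    rw [spectrum.mem_iff]
    intro hu
    obtain ⟨v, hv⟩ := hz.exists_hasEigenvector
    have hv1 : φ BC v = z • v := hv.apply_eq_smul
    apply hv.2
    obtain ⟨u, hu⟩ := hu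
    have h0 : (u : EuclideanSpace ℂ (Fin d) →L[ℂ] EuclideanSpace ℂ (Fin d)) v = 0 := by
      rw [hu, sub_apply, hv1, Algebra.algebraMap_eq_smul_one]
      simp
    have h1 : (↑u⁻¹ * ↑u : EuclideanSpace ℂ (Fin d) →L[ℂ] EuclideanSpace ℂ (Fin d)) v = v := by
      simp
    rw [← h1, mul_apply_eq_comp, h0, map_zero]
  have key : ∀ i j, Tendsto (fun t : ℝ => NormedSpace.exp (t • B) i j) atTop (𝓝 0) := by
    intro i j
    have h1 := tendsto_exp_smul_apply_zero (φ BC) hspec (EuclideanSpace.single j 1)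
    have h2 : Tendsto (fun t : ℝ =>
        (NormedSpace.exp ((t : ℂ) • φ BC) (EuclideanSpace.single j 1)) i) atTop (𝓝 0) := by
      exact ((EuclideanSpace.proj (𝕜 := ℂ) i).continuous.tendsto 0).comp h1
    have h3 (t : ℝ) : (NormedSpace.exp ((t : ℂ) • φ BC) (EuclideanSpace.single j 1)) i =
        ((NormedSpace.exp (t • B) i j : ℝ) : ℂ) := by
      have e1 : φ (NormedSpace.exp ((t : ℂ) • BC)) = NormedSpace.exp ((t : ℂ) • φ BC) := by
        let _ : NormedRing (Matrix (Fin d) (Fin d) ℂ) := Matrix.linftyOpNormedRing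
        let _ : NormedAlgebra ℂ (Matrix (Fin d) (Fin d) ℂ) := Matrix.linftyOpNormedAlgebra
        let _ : NormedAlgebra ℚ (Matrix (Fin d) (Fin d) ℂ) := NormedAlgebra.restrictScalars ℚ ℂ _
        have h := NormedSpace.map_exp φ hφ ((t : ℂ) • BC)
        rw [map_smul] at h
        exact h
      have e2 : NormedSpace.exp ((t : ℂ) • BC) =
          (NormedSpace.exp (t • B)).map (algebraMap ℝ ℂ) := by
        let _ : NormedRing (Matrix (Fin d) (Fin d) ℝ) := Matrix.linftyOpNormedRing
        let _ : NormedRing (Matrix (Fin d) (Fin d) ℂ) := Matrix.linftyOpNormedRing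
        let _ : NormedAlgebra ℂ (Matrix (Fin d) (Fin d) ℂ) := Matrix.linftyOpNormedAlgebra
        let _ : NormedAlgebra ℚ (Matrix (Fin d) (Fin d) ℂ) := NormedAlgebra.restrictScalars ℚ ℂ _
        let _ : NormedAlgebra ℝ (Matrix (Fin d) (Fin d) ℝ) := Matrix.linftyOpNormedAlgebra
        let _ : NormedAlgebra ℚ (Matrix (Fin d) (Fin d) ℝ) := NormedAlgebra.restrictScalars ℚ ℝ _
        have hc : Continuous ((algebraMap ℝ ℂ).mapMatrix (m := Fin d)) :=
          continuous_id.matrix_map Complex.continuous_ofReal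
        have h := NormedSpace.map_exp ((algebraMap ℝ ℂ).mapMatrix (m := Fin d)) hc (t • B)
        refine Eq.trans ?_ h.symm
        congr 1
        ext a b
        simp [hBC]
      rw [← e1, e2]
      have : ∀ M : Matrix (Fin d) (Fin d) ℂ, φ M (EuclideanSpace.single j 1) i = M i j := by
        intro M
        show (M.mulVec (Pi.single j 1)) i = _
        simp
      rw [this]; rfl
    simp_rw [h3] at h2
    have := (Complex.continuous_re.tendsto 0).comp h2
    simpa [Function.comp_def] using this
  have h4 : Tendsto (fun t : ℝ => NormedSpace.exp (t • B)) atTop (𝓝 0) :=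
    tendsto_pi_nhds.2 fun i => tendsto_pi_nhds.2 fun j => key i j
  have h5 := (continuous_mulVecL.tendsto 0).comp h4
  have h6 : mulVecL (0 : Matrix (Fin d) (Fin d) ℝ) = 0 := map_zero _
  rw [h6] at h5
  exact h5

theorem exists_flow_norm_le (B : Matrix (Fin d) (Fin d) ℝ) (T : ℝ) :
    ∃ M, 0 < M ∧ ∀ t ∈ Set.Icc 0 T, ‖flow B t‖ ≤ M := by
  obtain ⟨M, hM⟩ := isCompact_Icc.exists_bound_of_continuousOn
    (s := Set.Icc (0 : ℝ) T) (continuous_flow B).continuousOn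
  exact ⟨max M 1, by positivity, fun t ht => (hM t ht).trans (le_max_left _ _)⟩

/-- The decay of the flow is exponential, because `e^{(s+t)B} = e^{sB} e^{tB}` and some `e^{TB}` has
norm less than `1/2`. -/
theorem exists_flow_decay (B : Matrix (Fin d) (Fin d) ℝ)
    (hB : ∀ z ∈ spectrum ℂ (B.map (algebraMap ℝ ℂ)), z.re < 0) :
    ∃ C c : ℝ, 0 < C ∧ 0 < c ∧ ∀ t : ℝ, 0 ≤ t → ‖flow B t‖ ≤ C * Real.exp (-(c * t)) := by
  have h0 := (tendsto_flow_atTop_zero B hB).norm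
  rw [norm_zero] at h0
  obtain ⟨T, hT, hT0⟩ := ((h0.eventually (gt_mem_nhds (show (0 : ℝ) < 1 / 2 by norm_num))).and
    (eventually_gt_atTop 0)).exists
  obtain ⟨M, hM0, hM⟩ := exists_flow_norm_le B T
  -- `‖e^{tB}‖ ≤ M 2^{-⌊t/T⌋} ≤ 2 M 2^{-t/T}`
  refine ⟨2 * M, Real.log 2 / T, by positivity, div_pos (Real.log_pos (by norm_num)) hT0, ?_⟩
  have hn : ∀ (n : ℕ) (r : ℝ), r ∈ Set.Icc 0 T → ‖flow B (n * T + r)‖ ≤ M * (1 / 2) ^ n := by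
    intro n
    induction n with
    | zero => intro r hr; simpa using hM r hr
    | succ n ih =>
      intro r hr
      have : ((n + 1 : ℕ) : ℝ) * T + r = T + (n * T + r) := by push_cast; ring
      rw [this, flow_add]
      refine (ContinuousLinearMap.opNorm_comp_le _ _).trans ?_
      calc _ ≤ (1 / 2) * (M * (1 / 2) ^ n) :=
            mul_le_mul hT.le (ih r hr) (norm_nonneg _) (by norm_num)
        _ = _ := by ring
  intro t ht
  set n := ⌊t / T⌋₊
  have h1 : (n : ℝ) ≤ t / T := Nat.floor_le (by positivity)
  have h2 : t / T < n + 1 := Nat.lt_floor_add_one _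
  rw [le_div_iff₀ hT0] at h1
  rw [div_lt_iff₀ hT0] at h2
  have h3 := hn n (t - n * T) ⟨by linarith, by linarith⟩
  rw [add_sub_cancel] at h3
  refine h3.trans ?_
  have h4 : ((1 / 2 : ℝ)) ^ n = Real.exp (-(Real.log 2 * n)) := by
    rw [one_div, inv_pow, Real.exp_neg, Real.exp_mul, Real.exp_log (by norm_num), Real.rpow_natCast]
  have h5 : (2 : ℝ) * Real.exp (-(Real.log 2 / T * t)) =
      Real.exp (Real.log 2 + -(Real.log 2 / T * t)) := by
    rw [Real.exp_add, Real.exp_log (by norm_num)]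
  rw [h4, mul_comm 2 M, mul_assoc, h5]
  gcongr
  have h6 : Real.log 2 / T * t = Real.log 2 * (t / T) := by ring
  have h7 : t / T ≤ n + 1 := (div_le_iff₀ hT0).2 h2.le
  have h8 := Real.log_pos (show (1 : ℝ) < 2 by norm_num)
  rw [h6]
  nlinarith

end Flow

/-! ### Exponents of infinitely divisible laws -/

section LevyExponent

variable {d : ℕ}

/-- **Lévy's continuity theorem**, existence part: a pointwise limit of characteristic functions
which is continuous at the origin is a characteristic function. -/
theorem exists_charFun_eq_of_tendsto {E : Type*} [NormedAddCommGroup E] [InnerProductSpace ℝ E]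
    [FiniteDimensional ℝ E] [MeasurableSpace E] [BorelSpace E] {f : E → ℂ} (hf : ContinuousAt f 0)
    (μ : ℕ → Measure E) [hμ : ∀ n, IsProbabilityMeasure (μ n)]
    (h : ∀ ξ, Tendsto (fun n => charFun (μ n) ξ) atTop (𝓝 (f ξ))) :
    ∃ m : Measure E, IsProbabilityMeasure m ∧ ∀ ξ, charFun m ξ = f ξ := by
  let P : ℕ → ProbabilityMeasure E := fun n => ⟨μ n, hμ n⟩
  have ht := isTightMeasureSet_of_tendsto_charFun hf h
  have hc : IsCompact (closure (Set.range P)) := by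
    refine isCompact_closure_of_isTightMeasureSet ?_
    convert! ht using 1
    ext m
    constructor
    · rintro ⟨_, ⟨n, rfl⟩, rfl⟩
      exact ⟨n, rfl⟩
    · rintro ⟨n, rfl⟩
      exact ⟨_, ⟨n, rfl⟩, rfl⟩
  -- any limit point of the tight sequence has the required characteristic function
  obtain ⟨m, -, hm⟩ := hc.ultrafilter_le_nhds ((hyperfilter ℕ).map P) (by
    rw [le_principal_iff]
    exact Filter.mem_of_superset (Filter.range_mem_map) subset_closure)
  have hm' : Tendsto P (hyperfilter ℕ) (𝓝 m) := hm
  rw [ProbabilityMeasure.tendsto_iff_forall_integral_rclike_tendsto ℂ] at hm'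
  refine ⟨m, inferInstance, fun ξ => ?_⟩
  have h1 := hm' (BoundedContinuousFunction.innerProbChar ξ)
  simp_rw [← charFun_eq_integral_innerProbChar] at h1
  exact tendsto_nhds_unique h1 ((h ξ).mono_left Nat.hyperfilter_le_atTop)

/-- `ψ` is the exponent of a convolution semigroup of probability measures: `ψ` is continuous and
`e^{cψ}` is a characteristic function for all `c ≥ 0`. -/
def IsLevyExponent (ψ : Vec d → ℂ) : Prop :=
  Continuous ψ ∧ ∀ c : ℝ, 0 ≤ c → ∃ m : Measure (Vec d), IsProbabilityMeasure m ∧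
    ∀ ξ, charFun m ξ = Complex.exp (c * ψ ξ)

namespace IsLevyExponent

variable {ψ φ : Vec d → ℂ}

theorem exists_charFun (h : IsLevyExponent ψ) : ∃ m : Measure (Vec d), IsProbabilityMeasure m ∧
    ∀ ξ, charFun m ξ = Complex.exp (ψ ξ) := by
  simpa using h.2 1 zero_le_one

theorem add (hψ : IsLevyExponent ψ) (hφ : IsLevyExponent φ) :
    IsLevyExponent fun ξ => ψ ξ + φ ξ := by
  refine ⟨hψ.1.add hφ.1, fun c hc => ?_⟩
  obtain ⟨m, hm, h⟩ := hψ.2 c hc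
  obtain ⟨m', hm', h'⟩ := hφ.2 c hc
  refine ⟨m.conv m', inferInstance, fun ξ => ?_⟩
  rw [charFun_conv, h, h', ← Complex.exp_add]
  ring_nf

theorem smul (hψ : IsLevyExponent ψ) {a : ℝ} (ha : 0 ≤ a) : IsLevyExponent fun ξ => a * ψ ξ := by
  refine ⟨continuous_const.mul hψ.1, fun c hc => ?_⟩
  obtain ⟨m, hm, h⟩ := hψ.2 (c * a) (by positivity)
  exact ⟨m, hm, fun ξ => by rw [h]; push_cast; ring_nf⟩

/-- The class of these exponents is closed under pointwise limits with a continuous limit, by Lévy's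
continuity theorem. -/
theorem of_tendsto {ψn : ℕ → Vec d → ℂ} (h : ∀ n, IsLevyExponent (ψn n)) (hψ : Continuous ψ)
    (hlim : ∀ ξ, Tendsto (fun n => ψn n ξ) atTop (𝓝 (ψ ξ))) : IsLevyExponent ψ := by
  refine ⟨hψ, fun c hc => ?_⟩
  choose m hm hmc using fun n => (h n).2 c hc
  refine exists_charFun_eq_of_tendsto (f := fun ξ => Complex.exp (c * ψ ξ))
    (by fun_prop) m fun ξ => ?_
  simp_rw [hmc]
  exact (Complex.continuous_exp.tendsto _).comp ((hlim ξ).const_mul _)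

theorem zero : IsLevyExponent fun _ : Vec d => (0 : ℂ) :=
  ⟨continuous_const, fun c _ => ⟨Measure.dirac 0, inferInstance, fun ξ => by simp⟩⟩

theorem sum {ι : Type*} (s : Finset ι) {ψi : ι → Vec d → ℂ} (h : ∀ i ∈ s, IsLevyExponent (ψi i)) :
    IsLevyExponent fun ξ => ∑ i ∈ s, ψi i ξ := by
  classical
  induction s using Finset.induction_on with
  | empty => simpa using zero
  | insert a s ha ih =>
    simp_rw [Finset.sum_insert ha]
    exact (h a (by simp)).add (ih fun i hi => h i (by simp [hi]))

theorem comp_clm (hψ : IsLevyExponent ψ) (A : Vec d →L[ℝ] Vec d) :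
    IsLevyExponent fun ξ => ψ (A ξ) := by
  refine ⟨hψ.1.comp A.continuous, fun c hc => ?_⟩
  obtain ⟨m, hm, h⟩ := hψ.2 c hc
  refine ⟨m.map A.adjoint,
    Measure.isProbabilityMeasure_map A.adjoint.continuous.measurable.aemeasurable, fun ξ => ?_⟩
  rw [← h, charFun_apply, charFun_apply, integral_map (by fun_prop) (by fun_prop)]
  simp_rw [ContinuousLinearMap.adjoint_inner_left]

theorem drift (b : Vec d) : IsLevyExponent fun ξ => ((inner ℝ b ξ : ℝ) : ℂ) * Complex.I := by
  refine ⟨by fun_prop, fun c hc => ⟨Measure.dirac (c • b), inferInstance, fun ξ => ?_⟩⟩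
  rw [charFun_dirac, real_inner_smul_left]
  push_cast; ring_nf

theorem gaussian {S : Matrix (Fin d) (Fin d) ℝ} (hS : S.PosSemidef) :
    IsLevyExponent fun ξ => ((-(1 / 2) * inner ℝ (mulVecL S ξ) ξ : ℝ) : ℂ) := by
  refine ⟨by fun_prop, fun c hc => ⟨ProbabilityTheory.multivariateGaussian 0 (c • S),
    inferInstance, fun ξ => ?_⟩⟩
  rw [ProbabilityTheory.charFun_multivariateGaussian (hS.smul hc)]
  congr 1
  simp only [inner_mulVecL_eq_dotProduct]
  rw [Matrix.smul_mulVec, dotProduct_smul]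
  simp; ring

/-- The exponent of a compound Poisson law; the law is the limit of the `n`-fold convolution powers
of `(1 - |ν| / n) δ₀ + ν / n`. -/
theorem compoundPoisson (ν : Measure (Vec d)) [IsFiniteMeasure ν] :
    IsLevyExponent fun ξ => charFun ν ξ - ν.real Set.univ := by
  have key : ∀ ν : Measure (Vec d), IsFiniteMeasure ν → ∃ m : Measure (Vec d),
      IsProbabilityMeasure m ∧
        ∀ ξ, charFun m ξ = Complex.exp (charFun ν ξ - ν.real Set.univ) := by
    intro ν hν
    obtain ⟨N, hN⟩ := exists_nat_gt (ν.real Set.univ)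
    have hν0 : 0 ≤ ν.real Set.univ := measureReal_nonneg
    have hN0 : (0 : ℝ) < N := hν0.trans_lt hN
    have hpow : ∀ (m : Measure (Vec d)) (_ : IsProbabilityMeasure m) (n : ℕ),
        ∃ m' : Measure (Vec d), IsProbabilityMeasure m' ∧ ∀ ξ, charFun m' ξ = charFun m ξ ^ n := by
      intro m hm n
      induction n with
      | zero => exact ⟨Measure.dirac 0, inferInstance, fun ξ => by simp⟩
      | succ n ih =>
        obtain ⟨m', hm', h⟩ := ih
        exact ⟨m'.conv m, inferInstance, fun ξ => by rw [charFun_conv, h, pow_succ]⟩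
    -- the index is shifted by `N > |ν|`, so that `1 - |ν| / (n + N)` is nonnegative
    have hstep : ∀ n : ℕ, ∃ m : Measure (Vec d), IsProbabilityMeasure m ∧ ∀ ξ,
        charFun m ξ = 1 + (charFun ν ξ - ν.real Set.univ) / ((n + N : ℕ) : ℂ) := by
      intro n
      set k : ℝ := ((n + N : ℕ) : ℝ) with hk
      have hkN : (N : ℝ) ≤ k := by rw [hk]; push_cast; linarith [Nat.cast_nonneg (α := ℝ) n]
      have hk0 : 0 < k := hN0.trans_le hkN
      have hle : ν.real Set.univ / k ≤ 1 := by rw [div_le_one hk0]; linarith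
      have e1 : ENNReal.ofReal k⁻¹ * ν Set.univ = ENNReal.ofReal (ν.real Set.univ / k) := by
        rw [← ofReal_measureReal (μ := ν) (s := Set.univ), ← ENNReal.ofReal_mul (by positivity)]
        congr 1; field_simp
      refine ⟨ENNReal.ofReal (1 - ν.real Set.univ / k) • Measure.dirac 0 +
        ENNReal.ofReal k⁻¹ • ν, ⟨?_⟩, fun ξ => ?_⟩
      · simp only [Measure.coe_add, Measure.coe_smul, Pi.add_apply, Pi.smul_apply, smul_eq_mul,
          measure_univ, mul_one]
        rw [e1, ← ENNReal.ofReal_add (by linarith) (by positivity)]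
        simp
      · have hint : ∀ m : Measure (Vec d), IsFiniteMeasure m →
            Integrable (fun x => Complex.exp ((inner ℝ x ξ : ℝ) * Complex.I)) m := fun m _ =>
          (integrable_const (1 : ℝ)).mono' (by fun_prop)
            (ae_of_all _ fun x => by rw [Complex.norm_exp_ofReal_mul_I])
        rw [charFun_apply, integral_add_measure
          ((hint _ inferInstance).smul_measure ENNReal.ofReal_ne_top)
          ((hint _ inferInstance).smul_measure ENNReal.ofReal_ne_top), integral_smul_measure,
          integral_smul_measure, ← charFun_apply, ← charFun_apply,
          ENNReal.toReal_ofReal (by linarith), ENNReal.toReal_ofReal (by positivity)]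
        have : ((n + N : ℕ) : ℂ) = (k : ℂ) := by rw [hk]; push_cast; rfl
        have hkc : (k : ℂ) ≠ 0 := by exact_mod_cast hk0.ne'
        rw [this]
        simp
        field_simp
        ring
    choose m hm hmc using hstep
    choose m' hm' hmc' using fun n => hpow (m n) (hm n) (n + N)
    refine exists_charFun_eq_of_tendsto
      (f := fun ξ => Complex.exp (charFun ν ξ - ν.real Set.univ))
      (Continuous.continuousAt (by fun_prop)) m' fun ξ => ?_
    simp_rw [hmc', hmc]
    exact (Complex.tendsto_one_add_div_pow_exp _).comp (tendsto_add_atTop_nat N)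
  refine ⟨by fun_prop, fun c hc => ?_⟩
  have hfin : IsFiniteMeasure (ENNReal.ofReal c • ν) := Measure.smul_finite _ ENNReal.ofReal_ne_top
  obtain ⟨m, hm, h⟩ := key (ENNReal.ofReal c • ν) hfin
  refine ⟨m, hm, fun ξ => ?_⟩
  rw [h]
  congr 1
  rw [charFun_apply, integral_smul_measure, ← charFun_apply, measureReal_ennreal_smul_apply,
    ENNReal.toReal_ofReal hc]
  simp; ring

end IsLevyExponent

/-- Left Riemann sums of a continuous function converge to its integral. -/
theorem tendsto_riemannSum {f : ℝ → ℂ} (hf : Continuous f) {T : ℝ} (hT : 0 ≤ T) :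
    Tendsto (fun n : ℕ => ∑ k ∈ Finset.range (n + 1),
      ((T / (n + 1) : ℝ) : ℂ) * f (k * (T / (n + 1)))) atTop (𝓝 (∫ s in (0 : ℝ)..T, f s)) := by
  rw [Metric.tendsto_atTop]
  intro ε hε
  have huc := isCompact_Icc.uniformContinuousOn_of_continuous (s := Set.Icc 0 T) hf.continuousOn
  rw [Metric.uniformContinuousOn_iff] at huc
  obtain ⟨δ, hδ, h⟩ := huc (ε / (2 * (T + 1))) (by positivity)
  obtain ⟨N, hN⟩ := exists_nat_gt (T / δ)
  refine ⟨N, fun n hn => ?_⟩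
  set τ : ℝ := T / (n + 1) with hτ
  have hn1 : (0 : ℝ) < n + 1 := by positivity
  have hτ0 : 0 ≤ τ := by positivity
  have hτT : (n + 1) * τ = T := by rw [hτ]; field_simp
  have hτδ : τ < δ := by
    rw [hτ, div_lt_iff₀ hn1]
    rw [div_lt_iff₀ hδ] at hN
    have : (N : ℝ) ≤ n := by exact_mod_cast hn
    nlinarith
  have hsum := intervalIntegral.sum_integral_adjacent_intervals (f := f) (μ := volume)
    (a := fun k : ℕ => k * τ) (n := n + 1) fun k _ => hf.intervalIntegrable _ _
  simp only [Nat.cast_zero, zero_mul, Nat.cast_add, Nat.cast_one, hτT] at hsum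
  rw [dist_eq_norm, ← hsum, ← Finset.sum_sub_distrib]
  have hterm : ∀ k ∈ Finset.range (n + 1),
      ‖(τ : ℂ) * f (k * τ) - ∫ s in (k * τ : ℝ)..((k + 1) * τ), f s‖ ≤
        ε / (2 * (T + 1)) * τ := by
    intro k hk
    have hk' : (k : ℝ) + 1 ≤ n + 1 := by
      have := Finset.mem_range.1 hk
      exact_mod_cast this
    have e1 : (τ : ℂ) * f (k * τ) = ∫ s in (k * τ : ℝ)..((k + 1) * τ), f (k * τ) := by
      rw [intervalIntegral.integral_const]
      rw [show ((k : ℝ) + 1) * τ - k * τ = τ by ring]; simp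
    rw [e1, ← intervalIntegral.integral_sub (by simp) (hf.intervalIntegrable _ _)]
    have hb := intervalIntegral.norm_integral_le_of_norm_le_const (a := k * τ) (b := (k + 1) * τ)
      (C := ε / (2 * (T + 1))) (f := fun s => f (k * τ) - f s) (by
        intro s hs
        rw [Set.uIoc_of_le (by nlinarith)] at hs
        rw [← dist_eq_norm]
        have hkτ : 0 ≤ (k : ℝ) * τ := by positivity
        have hkT : ((k : ℝ) + 1) * τ ≤ T := by rw [← hτT]; gcongr
        refine (h _ ⟨hkτ, by linarith [hs.1, hs.2]⟩ s ⟨by linarith [hs.1], by linarith [hs.2]⟩ ?_).le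
        rw [Real.dist_eq, abs_lt]
        constructor <;> nlinarith [hs.1, hs.2])
    rwa [show ((k : ℝ) + 1) * τ - k * τ = τ by ring, abs_of_nonneg hτ0] at hb
  calc _ ≤ ∑ k ∈ Finset.range (n + 1), ε / (2 * (T + 1)) * τ := norm_sum_le_of_le _ hterm
    _ = ε / (2 * (T + 1)) * T := by
        rw [Finset.sum_const, Finset.card_range, nsmul_eq_mul]; push_cast; rw [← hτT]; ring
    _ < ε := by
        rw [div_mul_eq_mul_div, div_lt_iff₀ (by positivity)]
        nlinarith

namespace IsLevyExponent

/-- Time integrals are limits of Riemann sums, that is, of nonnegative combinations. -/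
theorem intervalIntegral {F : ℝ → Vec d → ℂ} (hF : Continuous (Function.uncurry F))
    (h : ∀ s, IsLevyExponent (F s)) {T : ℝ} (hT : 0 ≤ T) :
    IsLevyExponent fun ξ => ∫ s in (0 : ℝ)..T, F s ξ := by
  refine of_tendsto (ψn := fun n ξ => ∑ k ∈ Finset.range (n + 1),
      ((T / (n + 1) : ℝ) : ℂ) * F (k * (T / (n + 1))) ξ) (fun n => sum _ fun k _ =>
        (h _).smul (by positivity)) ?_ fun ξ => ?_
  · exact intervalIntegral.continuous_parametric_intervalIntegral_of_continuous'
      (f := fun ξ s => F s ξ) (hF.comp continuous_swap) _ _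
  · exact tendsto_riemannSum (f := fun s => F s ξ)
      (hF.comp (Continuous.prodMk_left ξ)) hT

theorem integral_Ioi {F : ℝ → Vec d → ℂ} (hF : Continuous (Function.uncurry F))
    (h : ∀ s, IsLevyExponent (F s)) (hint : ∀ ξ, IntegrableOn (fun s => F s ξ) (Set.Ioi 0))
    (hc : Continuous fun ξ => ∫ s in Set.Ioi (0 : ℝ), F s ξ) :
    IsLevyExponent fun ξ => ∫ s in Set.Ioi (0 : ℝ), F s ξ :=
  of_tendsto (ψn := fun n ξ => ∫ s in (0 : ℝ)..n, F s ξ)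
    (fun n => intervalIntegral hF h n.cast_nonneg) hc
    fun ξ => intervalIntegral_tendsto_integral_Ioi 0 (hint ξ) tendsto_natCast_atTop_atTop

/-- The `n`-th convolution root has the exponent `ψ / n`. -/
theorem isInfinitelyDivisible {ψ : Vec d → ℂ} (hψ : IsLevyExponent ψ) {m : Measure (Vec d)}
    [IsProbabilityMeasure m] (hm : ∀ ξ, charFun m ξ = Complex.exp (ψ ξ)) :
    IsInfinitelyDivisible m := by
  intro n hn
  obtain ⟨r, hr, h⟩ := hψ.2 (n : ℝ)⁻¹ (by positivity)
  refine ⟨r, hr, ?_⟩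
  have : IsProbabilityMeasure ((Measure.pi fun _ : Fin n => r).map (fun y => ∑ i, y i)) :=
    Measure.isProbabilityMeasure_map (by fun_prop)
  refine Measure.ext_of_charFun (funext fun ξ => ?_)
  rw [ProbabilityTheory.charFun_map_sum_pi_eq_prod, hm]
  rw [Finset.prod_const, Finset.card_univ, Fintype.card_fin, Pi.pow_apply, h, ← Complex.exp_nat_mul]
  congr 1
  have : (n : ℂ) ≠ 0 := by exact_mod_cast (by omega : n ≠ 0)
  push_cast
  field_simp

end IsLevyExponent

end LevyExponent

/-! ### The Lévy–Khintchine exponent -/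

section JumpExponent

variable {d : ℕ}

/-- The integrand `e^{i⟨ξ,y⟩} - 1 - i⟨ξ,y⟩ 1_{|y| ≤ 1}` of the jump exponent. -/
noncomputable def jumpIntegrand (ξ y : Vec d) : ℂ :=
  Complex.exp ((inner ℝ ξ y : ℝ) * Complex.I) - 1
    - (Metric.closedBall (0 : Vec d) 1).indicator
        (fun z => ((inner ℝ ξ z : ℝ) : ℂ) * Complex.I) y

theorem jumpIntegrand_of_le {ξ y : Vec d} (hy : ‖y‖ ≤ 1) :
    jumpIntegrand ξ y = Complex.exp ((inner ℝ ξ y : ℝ) * Complex.I) - 1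
      - (inner ℝ ξ y : ℝ) * Complex.I := by
  rw [jumpIntegrand, Set.indicator_of_mem (by simpa using hy)]

theorem jumpIntegrand_of_lt {ξ y : Vec d} (hy : 1 < ‖y‖) :
    jumpIntegrand ξ y = Complex.exp ((inner ℝ ξ y : ℝ) * Complex.I) - 1 := by
  rw [jumpIntegrand, Set.indicator_of_notMem (by simpa using hy), sub_zero]

theorem measurable_jumpIntegrand_comp {α : Type*} [MeasurableSpace α] {f g : α → Vec d}
    (hf : Measurable f) (hg : Measurable g) : Measurable fun a => jumpIntegrand (f a) (g a) := by
  have h1 : Measurable fun a => ((inner ℝ (f a) (g a) : ℝ) : ℂ) * Complex.I := by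
    fun_prop
  refine Measurable.sub (by fun_prop) ?_
  have : (fun a => (Metric.closedBall (0 : Vec d) 1).indicator
      (fun z => ((inner ℝ (f a) z : ℝ) : ℂ) * Complex.I) (g a)) =
      (g ⁻¹' (Metric.closedBall (0 : Vec d) 1)).indicator
        fun a => ((inner ℝ (f a) (g a) : ℝ) : ℂ) * Complex.I := by
    ext a; simp [Set.indicator]
  rw [this]
  exact h1.indicator (hg Metric.isClosed_closedBall.measurableSet)

theorem measurable_jumpIntegrand (ξ : Vec d) : Measurable (jumpIntegrand ξ) :=
  measurable_jumpIntegrand_comp measurable_const measurable_id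

theorem continuous_jumpIntegrand_left (y : Vec d) : Continuous fun ξ => jumpIntegrand ξ y := by
  rcases le_or_gt ‖y‖ 1 with hy | hy
  · simp_rw [jumpIntegrand_of_le hy]; fun_prop
  · simp_rw [jumpIntegrand_of_lt hy]; fun_prop

theorem norm_exp_mul_I_sub_one_le (a : ℝ) : ‖Complex.exp (a * Complex.I) - 1‖ ≤ |a| := by
  simpa [mul_comm] using Real.norm_exp_I_mul_ofReal_sub_one_le (x := a)

theorem norm_exp_mul_I_sub_one_le_two (a : ℝ) : ‖Complex.exp (a * Complex.I) - 1‖ ≤ 2 := by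
  refine (norm_sub_le _ _).trans ?_
  rw [Complex.norm_exp_ofReal_mul_I, norm_one]; norm_num

theorem norm_exp_mul_I_sub_one_sub_le (a : ℝ) :
    ‖Complex.exp (a * Complex.I) - 1 - a * Complex.I‖ ≤ 2 * a ^ 2 := by
  rcases le_or_gt |a| 1 with h | h
  · have := Complex.norm_exp_sub_one_sub_id_le (x := a * Complex.I) (by simpa using h)
    simp only [norm_mul, Complex.norm_real, Complex.norm_I, mul_one, Real.norm_eq_abs,
      sq_abs] at this
    nlinarith [sq_nonneg a]
  · refine (norm_sub_le _ _).trans ?_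
    have h1 := norm_exp_mul_I_sub_one_le a
    have h2 : ‖(a : ℂ) * Complex.I‖ = |a| := by simp
    rw [h2, ← sq_abs]
    nlinarith

theorem norm_jumpIntegrand_le_of_le {ξ y : Vec d} (hy : ‖y‖ ≤ 1) :
    ‖jumpIntegrand ξ y‖ ≤ 2 * ‖ξ‖ ^ 2 * ‖y‖ ^ 2 := by
  rw [jumpIntegrand_of_le hy]
  refine (norm_exp_mul_I_sub_one_sub_le _).trans ?_
  have h := abs_real_inner_le_norm ξ y
  rw [← sq_abs, mul_assoc, ← mul_pow]
  gcongr

theorem norm_jumpIntegrand_le_two {ξ y : Vec d} (hy : 1 < ‖y‖) : ‖jumpIntegrand ξ y‖ ≤ 2 := by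
  rw [jumpIntegrand_of_lt hy]
  exact norm_exp_mul_I_sub_one_le_two _

theorem norm_jumpIntegrand_le_mul {ξ y : Vec d} (hy : 1 < ‖y‖) :
    ‖jumpIntegrand ξ y‖ ≤ ‖ξ‖ * ‖y‖ := by
  rw [jumpIntegrand_of_lt hy]
  exact (norm_exp_mul_I_sub_one_le _).trans (abs_real_inner_le_norm ξ y)

theorem norm_jumpIntegrand_le (ξ y : Vec d) :
    ‖jumpIntegrand ξ y‖ ≤ 2 * (1 + ‖ξ‖ ^ 2) * min 1 (‖y‖ ^ 2) := by
  rcases le_or_gt ‖y‖ 1 with hy | hy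
  · rw [min_eq_right (pow_le_one₀ (norm_nonneg _) hy)]
    refine (norm_jumpIntegrand_le_of_le hy).trans ?_
    gcongr; linarith
  · rw [min_eq_left (one_le_pow₀ hy.le)]
    refine (norm_jumpIntegrand_le_two hy).trans ?_
    nlinarith [sq_nonneg ‖ξ‖]

theorem jumpExponent_eq (ν : Measure (Vec d)) (ξ : Vec d) :
    jumpExponent ν ξ = ∫ y, jumpIntegrand ξ y ∂ν := rfl

end JumpExponent

namespace LevyOU.IsLevyMeasure

variable {d : ℕ} {ν : Measure (Vec d)}

theorem integrable_min (hν : IsLevyMeasure ν) : Integrable (fun y => min 1 (‖y‖ ^ 2)) ν := by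
  refine ⟨by fun_prop, ?_⟩
  rw [hasFiniteIntegral_iff_ofReal (ae_of_all _ fun y => by positivity)]
  exact hν.lintegral_lt_top

theorem measure_lt_norm (hν : IsLevyMeasure ν) {r : ℝ} (hr : 0 < r) : ν {y | r < ‖y‖} < ∞ := by
  have h := hν.integrable_min.measure_ge_lt_top (ε := min 1 (r ^ 2)) (by positivity)
  refine (measure_mono fun y hy => ?_).trans_lt h
  have : r < ‖y‖ := hy
  show min 1 (r ^ 2) ≤ min 1 (‖y‖ ^ 2)
  gcongr

theorem iUnion_lt_norm :
    ⋃ n : ℕ, {y : Vec d | 1 / ((n : ℝ) + 1) < ‖y‖} = {0}ᶜ := by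
  ext y
  simp only [Set.mem_iUnion, Set.mem_compl_iff, Set.mem_singleton_iff]
  constructor
  · rintro ⟨n, hn⟩ rfl
    have h0 : 1 / ((n : ℝ) + 1) < ‖(0 : Vec d)‖ := hn
    rw [norm_zero] at h0
    have : (0 : ℝ) < 1 / ((n : ℝ) + 1) := by positivity
    linarith
  · intro hy
    exact exists_nat_one_div_lt (norm_pos_iff.2 hy)

theorem sigmaFinite (hν : IsLevyMeasure ν) : SigmaFinite ν := by
  refine ⟨⟨⟨fun n => {0} ∪ {y : Vec d | 1 / ((n : ℝ) + 1) < ‖y‖}, fun _ => trivial, fun n => ?_,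
    ?_⟩⟩⟩
  · refine (measure_union_le _ _).trans_lt ?_
    rw [hν.zero, zero_add]
    exact hν.measure_lt_norm (by positivity)
  · rw [← Set.union_iUnion, iUnion_lt_norm, Set.union_compl_self]

theorem integrable_jumpIntegrand (hν : IsLevyMeasure ν) (ξ : Vec d) :
    Integrable (jumpIntegrand ξ) ν :=
  (hν.integrable_min.const_mul (2 * (1 + ‖ξ‖ ^ 2))).mono'
    (measurable_jumpIntegrand ξ).aestronglyMeasurable (ae_of_all _ (norm_jumpIntegrand_le ξ))

theorem norm_jumpExponent_le (hν : IsLevyMeasure ν) (ξ : Vec d) :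
    ‖jumpExponent ν ξ‖ ≤ 2 * (1 + ‖ξ‖ ^ 2) * ∫ y, min 1 (‖y‖ ^ 2) ∂ν := by
  rw [jumpExponent_eq, ← integral_const_mul]
  exact norm_integral_le_of_norm_le (hν.integrable_min.const_mul _)
    (ae_of_all _ (norm_jumpIntegrand_le ξ))

theorem continuous_jumpExponent (hν : IsLevyMeasure ν) : Continuous (jumpExponent ν) := by
  rw [continuous_iff_continuousAt]
  intro ξ₀
  refine continuousAt_of_dominated (F := fun ξ y => jumpIntegrand ξ y)
    (bound := fun y => 2 * (1 + (‖ξ₀‖ + 1) ^ 2) * min 1 (‖y‖ ^ 2))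
    (Eventually.of_forall fun ξ => (measurable_jumpIntegrand ξ).aestronglyMeasurable) ?_
    (hν.integrable_min.const_mul _)
    (ae_of_all _ fun y => (continuous_jumpIntegrand_left y).continuousAt)
  filter_upwards [Metric.ball_mem_nhds ξ₀ one_pos] with ξ hξ
  refine ae_of_all _ fun y => (norm_jumpIntegrand_le ξ y).trans ?_
  have : ‖ξ‖ ≤ ‖ξ₀‖ + 1 := by
    have h1 := norm_le_norm_add_norm_sub' ξ ξ₀
    have h2 := mem_ball_iff_norm.1 hξ
    linarith
  gcongr

/-- Cutting off the jumps of size at most `1/(n+1)` leaves a compound Poisson exponent plus a drift;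
the jump exponent is the limit of these. -/
theorem isLevyExponent_jumpExponent (hν : IsLevyMeasure ν) : IsLevyExponent (jumpExponent ν) := by
  set s : ℕ → Set (Vec d) := fun n => {y : Vec d | 1 / ((n : ℝ) + 1) < ‖y‖} with hs
  have hsm : ∀ n, MeasurableSet (s n) := fun n =>
    (isOpen_lt continuous_const continuous_norm).measurableSet
  refine IsLevyExponent.of_tendsto (ψn := fun n ξ => ∫ y in s n, jumpIntegrand ξ y ∂ν)
    (fun n => ?_) hν.continuous_jumpExponent fun ξ => ?_
  · have hfin : IsFiniteMeasure (ν.restrict (s n)) :=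
      ⟨by rw [Measure.restrict_apply_univ]; exact hν.measure_lt_norm (by positivity)⟩
    set b : Vec d := ∫ y in s n, (Metric.closedBall (0 : Vec d) 1).indicator id y ∂ν
    have hb : Integrable ((Metric.closedBall (0 : Vec d) 1).indicator id) (ν.restrict (s n)) := by
      refine (integrable_const (1 : ℝ)).mono' ?_ (ae_of_all _ fun y => ?_)
      · exact (measurable_id.indicator
          Metric.isClosed_closedBall.measurableSet).aestronglyMeasurable
      · by_cases hy : y ∈ Metric.closedBall (0 : Vec d) 1
        · rw [Set.indicator_of_mem hy]; simpa using hy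
        · rw [Set.indicator_of_notMem hy]; simp
    convert! (IsLevyExponent.compoundPoisson (ν.restrict (s n))).add (IsLevyExponent.drift (-b))
      using 2 with ξ
    have hexp : Integrable (fun y => Complex.exp ((inner ℝ ξ y : ℝ) * Complex.I))
        (ν.restrict (s n)) := (integrable_const (1 : ℝ)).mono' (by fun_prop)
      (ae_of_all _ fun x => by rw [Complex.norm_exp_ofReal_mul_I])
    have hin : ∀ y, (Metric.closedBall (0 : Vec d) 1).indicator
        (fun z => ((inner ℝ ξ z : ℝ) : ℂ) * Complex.I) y =
        ((inner ℝ ξ ((Metric.closedBall (0 : Vec d) 1).indicator id y) : ℝ) : ℂ) * Complex.I := by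
      intro y
      by_cases hy : y ∈ Metric.closedBall (0 : Vec d) 1
      · simp only [Set.indicator_of_mem hy, id]
      · simp only [Set.indicator_of_notMem hy, inner_zero_right, Complex.ofReal_zero, zero_mul]
    have hbi := hb.const_inner (𝕜 := ℝ) ξ
    simp only [jumpIntegrand, hin]
    have hexp1 : Integrable (fun y => Complex.exp ((inner ℝ ξ y : ℝ) * Complex.I) - 1)
        (ν.restrict (s n)) := hexp.sub (integrable_const _)
    have hbi1 : Integrable (fun y => ((inner ℝ ξ ((Metric.closedBall (0 : Vec d) 1).indicator id y)
        : ℝ) : ℂ) * Complex.I) (ν.restrict (s n)) := hbi.ofReal.mul_const _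
    rw [integral_sub hexp1 hbi1,
      integral_sub hexp (integrable_const _), integral_mul_const, integral_complex_ofReal,
      integral_inner (𝕜 := ℝ) hb ξ, inner_neg_left, charFun_apply]
    simp_rw [real_inner_comm ξ]
    simp [sub_eq_add_neg, b]
  · have hmono : Monotone s := by
      intro m n hmn y hy
      have hy' : 1 / ((m : ℝ) + 1) < ‖y‖ := hy
      refine lt_of_le_of_lt ?_ hy'
      gcongr
    have h := tendsto_setIntegral_of_monotone hsm hmono
      (hν.integrable_jumpIntegrand ξ).integrableOn
    have hU : ⋃ n, s n = {0}ᶜ := iUnion_lt_norm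
    rw [hU, Measure.restrict_eq_self_of_ae_mem (by
      rw [ae_iff]
      simpa using hν.zero)] at h
    exact h

theorem zero_measure : IsLevyMeasure (0 : Measure (Vec d)) := ⟨by simp, by simp⟩

end LevyOU.IsLevyMeasure

/-! ### Exponents along the flow -/

section FlowExponent

variable {d : ℕ}

/-- The Lévy–Khintchine exponent `-½⟨Qξ,ξ⟩ + Φ(ξ)` of the driving Lévy process. -/
noncomputable def levyExponent (Q : Matrix (Fin d) (Fin d) ℝ) (ν : Measure (Vec d)) (ξ : Vec d) :
    ℂ :=
  ((-(1 / 2) * inner ℝ (mulVecL Q ξ) ξ : ℝ) : ℂ) + jumpExponent ν ξ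

variable {Q B : Matrix (Fin d) (Fin d) ℝ} {ν : Measure (Vec d)}

theorem isLevyExponent_levyExponent (hQ : Q.PosSemidef) (hν : IsLevyMeasure ν) :
    IsLevyExponent (levyExponent Q ν) :=
  (IsLevyExponent.gaussian hQ).add hν.isLevyExponent_jumpExponent

theorem norm_gaussianExponent_le (Q : Matrix (Fin d) (Fin d) ℝ) (ξ : Vec d) :
    ‖((-(1 / 2) * inner ℝ (mulVecL Q ξ) ξ : ℝ) : ℂ)‖ ≤ ‖mulVecL Q‖ * ‖ξ‖ ^ 2 := by
  rw [Complex.norm_real, norm_mul]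
  have h3 : ‖inner ℝ (mulVecL Q ξ) ξ‖ ≤ ‖mulVecL Q‖ * ‖ξ‖ ^ 2 := by
    refine (norm_inner_le_norm _ _).trans ?_
    rw [pow_two, ← mul_assoc]
    gcongr
    exact ContinuousLinearMap.le_opNorm _ _
  have h4 : ‖(-(1 / 2) : ℝ)‖ ≤ 1 := by norm_num
  calc _ ≤ 1 * (‖mulVecL Q‖ * ‖ξ‖ ^ 2) := mul_le_mul h4 h3 (norm_nonneg _) (by norm_num)
    _ = _ := one_mul _

theorem exists_norm_levyExponent_le (Q : Matrix (Fin d) (Fin d) ℝ) (hν : IsLevyMeasure ν) :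
    ∃ K : ℝ, 0 ≤ K ∧ ∀ ξ, ‖levyExponent Q ν ξ‖ ≤ K * (1 + ‖ξ‖ ^ 2) := by
  have hI : 0 ≤ ∫ y, min 1 (‖y‖ ^ 2) ∂ν := integral_nonneg fun y => by positivity
  refine ⟨‖mulVecL Q‖ + 2 * ∫ y, min 1 (‖y‖ ^ 2) ∂ν, by positivity, fun ξ => ?_⟩
  refine (norm_add_le _ _).trans ?_
  have h1 := hν.norm_jumpExponent_le ξ
  have h2 := norm_gaussianExponent_le Q ξ
  nlinarith [norm_nonneg (mulVecL Q)]

theorem continuous_covIntegrand (Q B : Matrix (Fin d) (Fin d) ℝ) : Continuous (covIntegrand Q B) := by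
  have h : ∀ A : Matrix (Fin d) (Fin d) ℝ, Continuous fun s : ℝ => NormedSpace.exp (s • A) := by
    intro A
    let _ : NormedRing (Matrix (Fin d) (Fin d) ℝ) := Matrix.linftyOpNormedRing
    let _ : NormedAlgebra ℝ (Matrix (Fin d) (Fin d) ℝ) := Matrix.linftyOpNormedAlgebra
    exact continuous_iff_continuousAt.2 fun t =>
      (hasDerivAt_exp_smul_const (𝕂 := ℝ) A t).continuousAt
  exact ((h B).matrix_mul continuous_const).matrix_mul (h B.transpose)

theorem continuous_covIntegrand_apply (Q B : Matrix (Fin d) (Fin d) ℝ) (i j : Fin d) :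
    Continuous fun s => covIntegrand Q B s i j :=
  (continuous_covIntegrand Q B).matrix_elem i j

/-- All covariance identities are stated through the quadratic form of `Q` along the adjoint flow. -/
theorem inner_covIntegrand (Q B : Matrix (Fin d) (Fin d) ℝ) (s : ℝ) (ξ η : Vec d) :
    inner ℝ (mulVecL (covIntegrand Q B s) ξ) η =
      inner ℝ (mulVecL Q (flow B.transpose s ξ)) (flow B.transpose s η) := by
  have h : mulVecL (covIntegrand Q B s) ξ = flow B s (mulVecL Q (flow B.transpose s ξ)) := by
    have h1 : mulVecL (covIntegrand Q B s) =
        mulVecL (NormedSpace.exp (s • B)) * mulVecL Q * flow B.transpose s := by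
      unfold covIntegrand mulVecL flow mulVecL
      rw [map_mul, map_mul]
    rw [h1]; rfl
  rw [h, real_inner_comm, ← inner_flow_transpose, real_inner_comm]

theorem inner_mulVecL_cov (Q B : Matrix (Fin d) (Fin d) ℝ) (t : ℝ) (ξ η : Vec d) :
    inner ℝ (mulVecL (cov Q B t) ξ) η =
      ∫ s in (0 : ℝ)..t, inner ℝ (mulVecL Q (flow B.transpose s ξ)) (flow B.transpose s η) := by
  simp_rw [← inner_covIntegrand, inner_mulVecL]
  rw [intervalIntegral.integral_finsetSum]
  · refine Finset.sum_congr rfl fun i _ => ?_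
    rw [intervalIntegral.integral_finsetSum]
    · refine Finset.sum_congr rfl fun j _ => ?_
      rw [intervalIntegral.integral_mul_const]; rfl
    · exact fun j _ => ((continuous_covIntegrand_apply Q B i j).mul_const _).intervalIntegrable _ _
  · exact fun i _ => (continuous_finsetSum _ fun j _ =>
      (continuous_covIntegrand_apply Q B i j).mul_const _).intervalIntegrable _ _

theorem continuous_levyExponent_flow (Q B : Matrix (Fin d) (Fin d) ℝ) (hν : IsLevyMeasure ν) :
    Continuous (Function.uncurry fun (s : ℝ) ξ => levyExponent Q ν (flow B s ξ)) := by
  have h1 : Continuous fun p : ℝ × Vec d => flow B p.1 p.2 :=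
    ((continuous_flow B).comp continuous_fst).clm_apply continuous_snd
  have h2 : Continuous (levyExponent Q ν) :=
    Continuous.add (by fun_prop) hν.continuous_jumpExponent
  exact h2.comp h1

/-- `Ψ_t` is the time integral of the exponent of the driving process along the adjoint flow. -/
theorem exponentAt_eq (Q B : Matrix (Fin d) (Fin d) ℝ) (hν : IsLevyMeasure ν) (t : ℝ) (ξ : Vec d) :
    exponentAt Q B ν t ξ = ∫ s in (0 : ℝ)..t, levyExponent Q ν (flow B.transpose s ξ) := by
  have hc := continuous_flow_apply B.transpose ξ
  simp only [levyExponent]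
  rw [intervalIntegral.integral_add, exponentAt, inner_mulVecL_cov, jumpExponentAt,
    intervalIntegral.integral_ofReal, intervalIntegral.integral_const_mul]
  · exact Continuous.intervalIntegrable (by fun_prop) _ _
  · exact (hν.continuous_jumpExponent.comp hc).intervalIntegrable _ _

theorem isLevyExponent_exponentAt (hQ : Q.PosSemidef) (hν : IsLevyMeasure ν) {t : ℝ}
    (ht : 0 ≤ t) : IsLevyExponent (exponentAt Q B ν t) := by
  rw [funext (exponentAt_eq Q B hν t)]
  exact IsLevyExponent.intervalIntegral (continuous_levyExponent_flow Q _ hν)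
    (fun s => (isLevyExponent_levyExponent hQ hν).comp_clm _) ht

/-- The cocycle identity behind the semigroup property. -/
theorem exponentAt_add (Q B : Matrix (Fin d) (Fin d) ℝ) (hν : IsLevyMeasure ν) (s t : ℝ)
    (ξ : Vec d) : exponentAt Q B ν (s + t) ξ =
      exponentAt Q B ν t ξ + exponentAt Q B ν s (flow B.transpose t ξ) := by
  have hc : Continuous fun r => levyExponent Q ν (flow B.transpose r ξ) :=
    (continuous_levyExponent_flow Q B.transpose hν).uncurry_right ξ
  simp_rw [exponentAt_eq Q B hν, ← flow_add_apply]
  rw [intervalIntegral.integral_comp_add_right (fun r => levyExponent Q ν (flow B.transpose r ξ)),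
    zero_add, intervalIntegral.integral_add_adjacent_intervals (hc.intervalIntegrable _ _)
      (hc.intervalIntegrable _ _)]

end FlowExponent

/-! ### Kernels of the form "linear map plus independent noise" -/

section ShiftKernel

variable {d : ℕ}

/-- The transition kernel of `x ↦ A x + Y` with noise `Y` of law `h`. All kernels of the theorem
are of this form. -/
noncomputable def shiftKernel (A : Vec d →L[ℝ] Vec d) (h : Measure (Vec d)) (x : Vec d) :
    Measure (Vec d) :=
  h.map fun y => A x + y

variable (A A' : Vec d →L[ℝ] Vec d) (h h' m : Measure (Vec d))

instance [IsProbabilityMeasure h] (x : Vec d) : IsProbabilityMeasure (shiftKernel A h x) :=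
  Measure.isProbabilityMeasure_map (by fun_prop)

theorem convKernel_eq_shiftKernel :
    convKernel h = shiftKernel (ContinuousLinearMap.id ℝ (Vec d)) h := rfl

theorem shiftKernel_dirac_zero (x : Vec d) : shiftKernel A (Measure.dirac 0) x =
    Measure.dirac (A x) := by
  rw [shiftKernel, Measure.map_dirac' (by fun_prop), add_zero]

theorem driftKernel_eq_shiftKernel (B : Matrix (Fin d) (Fin d) ℝ) (t : ℝ) :
    driftKernel B t = shiftKernel (flow B t) (Measure.dirac 0) := by
  ext1 x; rw [shiftKernel_dirac_zero]; rfl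

theorem shiftKernel_eq_conv [SFinite h] (x : Vec d) :
    shiftKernel A h x = (Measure.dirac (A x)).conv h :=
  (Measure.dirac_conv _ _).symm

theorem measurable_shiftKernel [SFinite h] : Measurable (shiftKernel A h) := by
  refine Measure.measurable_of_measurable_coe _ fun s hs => ?_
  have h1 : MeasurableSet {p : Vec d × Vec d | A p.1 + p.2 ∈ s} :=
    (show Measurable fun p : Vec d × Vec d => A p.1 + p.2 by fun_prop) hs
  have h2 := measurable_measure_prodMk_left (ν := h) h1
  convert! h2 using 2 with x
  rw [shiftKernel, Measure.map_apply (by fun_prop) hs]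
  rfl

theorem bind_shiftKernel [SFinite h] [SFinite m] :
    m.bind (shiftKernel A h) = (m.map A).conv h := by
  ext s hs
  rw [Measure.bind_apply hs (measurable_shiftKernel A h).aemeasurable, Measure.conv,
    Measure.map_apply (by fun_prop) hs, Measure.prod_apply (measurable_add hs),
    lintegral_map (measurable_measure_prodMk_left (measurable_add hs)) (by fun_prop)]
  refine lintegral_congr fun x => ?_
  rw [shiftKernel, Measure.map_apply (by fun_prop) hs]
  rfl

theorem shiftKernel_bind_shiftKernel [IsProbabilityMeasure h] [IsProbabilityMeasure h'] (x : Vec d) :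
    (shiftKernel A h x).bind (shiftKernel A' h') =
      shiftKernel (A'.comp A) ((h.map A').conv h') x := by
  have : IsProbabilityMeasure (h.map A') := Measure.isProbabilityMeasure_map (by fun_prop)
  rw [bind_shiftKernel, shiftKernel_eq_conv, shiftKernel_eq_conv,
    Measure.map_conv_continuousLinearMap, Measure.map_dirac' (by fun_prop), Measure.conv_assoc]
  rfl

theorem kernelOp_shiftKernel (f : Vec d → ℂ) (hf : Continuous f) (x : Vec d) :
    kernelOp (shiftKernel A h) f x = ∫ y, f (A x + y) ∂h := by
  rw [kernelOp, shiftKernel, integral_map (by fun_prop) hf.aestronglyMeasurable]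

theorem kernelOp_driftKernel (B : Matrix (Fin d) (Fin d) ℝ) (t : ℝ) (f : Vec d → ℂ) (x : Vec d) :
    kernelOp (driftKernel B t) f x = f (flow B t x) :=
  integral_dirac _ _

theorem charFun_map_flow (B : Matrix (Fin d) (Fin d) ℝ) (t : ℝ) (ξ : Vec d) :
    charFun (m.map (flow B t)) ξ = charFun m (flow B.transpose t ξ) := by
  rw [charFun_apply, charFun_apply, integral_map (by fun_prop) (by fun_prop)]
  refine integral_congr_ae (ae_of_all _ fun x => ?_)
  simp only
  rw [real_inner_comm, ← inner_flow_transpose, real_inner_comm]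

theorem charFun_shiftKernel (x ξ : Vec d) :
    charFun (shiftKernel A h x) ξ = charFun h ξ * Complex.exp ((inner ℝ (A x) ξ : ℝ) * Complex.I) :=
  charFun_map_const_add _ _

end ShiftKernel

/-! ### The Lévy–Ornstein–Uhlenbeck transition semigroup -/

section Semigroup

variable {d : ℕ}

theorem measureOfCharFun_spec {φ : Vec d → ℂ}
    (h : ∃ m : Measure (Vec d), IsProbabilityMeasure m ∧ ∀ ξ, charFun m ξ = φ ξ) :
    IsProbabilityMeasure (measureOfCharFun φ) ∧ ∀ ξ, charFun (measureOfCharFun φ) ξ = φ ξ := by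
  rw [measureOfCharFun, dif_pos h]
  exact h.choose_spec

/-- The law of `∫₀ᵗ e^{(t-s)B} dL_s`, whose characteristic function is `e^{Ψ_t}`. -/
noncomputable def ouNoise (Q B : Matrix (Fin d) (Fin d) ℝ) (ν : Measure (Vec d)) (t : ℝ) :
    Measure (Vec d) :=
  measureOfCharFun fun ξ => Complex.exp (exponentAt Q B ν t ξ)

variable {Q B : Matrix (Fin d) (Fin d) ℝ} {ν : Measure (Vec d)}

theorem isProbabilityMeasure_ouNoise (hQ : Q.PosSemidef) (hν : IsLevyMeasure ν) {t : ℝ}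
    (ht : 0 ≤ t) : IsProbabilityMeasure (ouNoise Q B ν t) :=
  (measureOfCharFun_spec (isLevyExponent_exponentAt hQ hν ht).exists_charFun).1

theorem charFun_ouNoise (hQ : Q.PosSemidef) (hν : IsLevyMeasure ν) {t : ℝ} (ht : 0 ≤ t)
    (ξ : Vec d) : charFun (ouNoise Q B ν t) ξ = Complex.exp (exponentAt Q B ν t ξ) :=
  (measureOfCharFun_spec (isLevyExponent_exponentAt hQ hν ht).exists_charFun).2 ξ

theorem ouTransition_eq_shiftKernel (hQ : Q.PosSemidef) (hν : IsLevyMeasure ν) {t : ℝ}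
    (ht : 0 ≤ t) : ouTransition Q B ν t = shiftKernel (flow B t) (ouNoise Q B ν t) := by
  ext1 x
  have := isProbabilityMeasure_ouNoise (B := B) hQ hν ht
  have hc (ξ : Vec d) : charFun (shiftKernel (flow B t) (ouNoise Q B ν t) x) ξ =
      Complex.exp (exponentAt Q B ν t ξ +
        (inner ℝ (flow B.transpose t ξ) x : ℝ) * Complex.I) := by
    rw [charFun_shiftKernel, charFun_ouNoise hQ hν ht, ← Complex.exp_add, inner_flow_transpose,
      real_inner_comm]
  have h := measureOfCharFun_spec ⟨_, inferInstance, hc⟩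
  have : IsProbabilityMeasure (ouTransition Q B ν t x) := h.1
  exact Measure.ext_of_charFun (funext fun ξ => (h.2 ξ).trans (hc ξ).symm)

theorem charFun_ouTransition (hQ : Q.PosSemidef) (hν : IsLevyMeasure ν) {t : ℝ}
    (ht : 0 ≤ t) (x ξ : Vec d) : charFun (ouTransition Q B ν t x) ξ =
      Complex.exp (exponentAt Q B ν t ξ + (inner ℝ ξ (flow B t x) : ℝ) * Complex.I) := by
  rw [ouTransition_eq_shiftKernel hQ hν ht, charFun_shiftKernel, charFun_ouNoise hQ hν ht,
    ← Complex.exp_add, real_inner_comm]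

theorem isProbabilityMeasure_ouTransition (hQ : Q.PosSemidef) (hν : IsLevyMeasure ν) {t : ℝ}
    (ht : 0 ≤ t) (x : Vec d) : IsProbabilityMeasure (ouTransition Q B ν t x) := by
  have := isProbabilityMeasure_ouNoise (B := B) hQ hν ht
  rw [ouTransition_eq_shiftKernel hQ hν ht]
  infer_instance

theorem exponentAt_zero (hν : IsLevyMeasure ν) (ξ : Vec d) : exponentAt Q B ν 0 ξ = 0 := by
  rw [exponentAt_eq Q B hν, intervalIntegral.integral_same]

theorem ouNoise_zero (hQ : Q.PosSemidef) (hν : IsLevyMeasure ν) :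
    ouNoise Q B ν 0 = Measure.dirac 0 := by
  have := isProbabilityMeasure_ouNoise (B := B) hQ hν le_rfl
  refine Measure.ext_of_charFun (funext fun ξ => ?_)
  rw [charFun_ouNoise hQ hν le_rfl, exponentAt_zero hν]
  simp

theorem ouNoise_add (hQ : Q.PosSemidef) (hν : IsLevyMeasure ν) {s t : ℝ} (hs : 0 ≤ s)
    (ht : 0 ≤ t) :
    ouNoise Q B ν (s + t) = ((ouNoise Q B ν s).map (flow B t)).conv (ouNoise Q B ν t) := by
  have := isProbabilityMeasure_ouNoise (B := B) hQ hν hs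
  have := isProbabilityMeasure_ouNoise (B := B) hQ hν ht
  have := isProbabilityMeasure_ouNoise (B := B) hQ hν (add_nonneg hs ht)
  have : IsProbabilityMeasure ((ouNoise Q B ν s).map (flow B t)) :=
    Measure.isProbabilityMeasure_map (by fun_prop)
  refine Measure.ext_of_charFun (funext fun ξ => ?_)
  rw [charFun_conv, charFun_map_flow, charFun_ouNoise hQ hν hs, charFun_ouNoise hQ hν ht,
    charFun_ouNoise hQ hν (add_nonneg hs ht), exponentAt_add Q B hν, Complex.exp_add, mul_comm]

theorem measurable_ouTransition (hQ : Q.PosSemidef) (hν : IsLevyMeasure ν) {t : ℝ}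
    (ht : 0 ≤ t) : Measurable (ouTransition Q B ν t) := by
  have := isProbabilityMeasure_ouNoise (B := B) hQ hν ht
  rw [ouTransition_eq_shiftKernel hQ hν ht]
  exact measurable_shiftKernel _ _

theorem ouTransition_zero (hQ : Q.PosSemidef) (hν : IsLevyMeasure ν) (x : Vec d) :
    ouTransition Q B ν 0 x = Measure.dirac x := by
  rw [ouTransition_eq_shiftKernel hQ hν le_rfl, ouNoise_zero hQ hν, shiftKernel_dirac_zero,
    flow_zero]
  rfl

theorem ouTransition_bind (hQ : Q.PosSemidef) (hν : IsLevyMeasure ν) {s t : ℝ} (hs : 0 ≤ s)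
    (ht : 0 ≤ t) (x : Vec d) :
    (ouTransition Q B ν s x).bind (ouTransition Q B ν t) = ouTransition Q B ν (s + t) x := by
  have := isProbabilityMeasure_ouNoise (B := B) hQ hν hs
  have := isProbabilityMeasure_ouNoise (B := B) hQ hν ht
  rw [ouTransition_eq_shiftKernel hQ hν hs, ouTransition_eq_shiftKernel hQ hν ht,
    ouTransition_eq_shiftKernel hQ hν (add_nonneg hs ht), shiftKernel_bind_shiftKernel,
    ouNoise_add hQ hν hs ht, add_comm s t, flow_add]

/-- A continuous function vanishing at infinity as a bounded continuous function. -/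
noncomputable def bcfOfTendstoZero (f : Vec d → ℂ) (hf : Continuous f)
    (h0 : Tendsto f (cocompact _) (𝓝 0)) : BoundedContinuousFunction (Vec d) ℂ :=
  ZeroAtInftyContinuousMap.toBCF ⟨⟨f, hf⟩, h0⟩

theorem feller_ouTransition (hQ : Q.PosSemidef) (hν : IsLevyMeasure ν) {t : ℝ} (ht : 0 ≤ t)
    (f : Vec d → ℂ) (hf : Continuous f) (h0 : Tendsto f (cocompact _) (𝓝 0)) :
    Continuous (kernelOp (ouTransition Q B ν t) f) ∧
      Tendsto (kernelOp (ouTransition Q B ν t) f) (cocompact _) (𝓝 0) := by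
  have := isProbabilityMeasure_ouNoise (B := B) hQ hν ht
  have hbd : ∀ x, ‖f x‖ ≤ ‖bcfOfTendstoZero f hf h0‖ := fun x =>
    BoundedContinuousFunction.norm_coe_le_norm (bcfOfTendstoZero f hf h0) x
  rw [ouTransition_eq_shiftKernel hQ hν ht, funext (kernelOp_shiftKernel _ _ f hf)]
  constructor
  · exact continuous_of_dominated (fun x => (by fun_prop)) (fun x => ae_of_all _ fun y => hbd _)
      (integrable_const _) (ae_of_all _ fun y => by fun_prop)
  · have hcg : (cocompact (Vec d)).IsCountablyGenerated := by
      rw [← Metric.cobounded_eq_cocompact, ← comap_norm_atTop]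
      infer_instance
    rw [show (0 : ℂ) = ∫ _, (0 : ℂ) ∂(ouNoise Q B ν t) by simp]
    refine tendsto_integral_filter_of_dominated_convergence _
      (Eventually.of_forall fun x => (by fun_prop))
      (Eventually.of_forall fun x => ae_of_all _ fun y => hbd _)
      (integrable_const _) (ae_of_all _ fun y => ?_)
    exact h0.comp ((Homeomorph.addRight y).isClosedEmbedding.tendsto_cocompact.comp
      (flowHomeomorph B t).isClosedEmbedding.tendsto_cocompact)

theorem continuous_exponentAt (Q B : Matrix (Fin d) (Fin d) ℝ) (hν : IsLevyMeasure ν) (ξ : Vec d) :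
    Continuous fun t => exponentAt Q B ν t ξ := by
  have hc : Continuous fun r => levyExponent Q ν (flow B.transpose r ξ) :=
    (continuous_levyExponent_flow Q B.transpose hν).uncurry_right ξ
  simp_rw [exponentAt_eq Q B hν]
  exact intervalIntegral.continuous_primitive (fun a b => hc.intervalIntegrable a b) 0

/-- As `t ↓ 0`, the characteristic functions of `P_t(x, ·)` converge to that of `δ_x`, so the measures
converge weakly. -/
theorem tendsto_kernelOp_ouTransition (hQ : Q.PosSemidef) (hν : IsLevyMeasure ν)
    (f : Vec d → ℂ) (hf : Continuous f) (h0 : Tendsto f (cocompact _) (𝓝 0)) (x : Vec d) :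
    Tendsto (fun t => kernelOp (ouTransition Q B ν t) f x) (𝓝[>] 0) (𝓝 (f x)) := by
  -- `|t|` makes the time nonnegative, so that two-sided limits along sequences can be used
  have key : Tendsto (fun t => kernelOp (ouTransition Q B ν |t|) f x) (𝓝 0) (𝓝 (f x)) := by
    rw [tendsto_iff_seq_tendsto]
    intro u hu
    let P : ℕ → ProbabilityMeasure (Vec d) := fun n => ⟨ouTransition Q B ν |u n| x,
      isProbabilityMeasure_ouTransition hQ hν (abs_nonneg _) x⟩
    let P₀ : ProbabilityMeasure (Vec d) := ⟨Measure.dirac x, inferInstance⟩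
    have hP : Tendsto P atTop (𝓝 P₀) := by
      rw [ProbabilityMeasure.tendsto_iff_tendsto_charFun]
      intro ξ
      have h1 (n : ℕ) : charFun (P n : Measure (Vec d)) ξ = Complex.exp (exponentAt Q B ν |u n| ξ
          + (inner ℝ ξ (flow B |u n| x) : ℝ) * Complex.I) :=
        charFun_ouTransition hQ hν (abs_nonneg _) x ξ
      have hcont : Continuous fun t : ℝ => Complex.exp (exponentAt Q B ν |t| ξ
          + (inner ℝ ξ (flow B |t| x) : ℝ) * Complex.I) := by
        have h2 := (continuous_exponentAt Q B hν ξ).comp continuous_abs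
        have h3 := (continuous_flow_apply B x).comp continuous_abs
        simp only [Function.comp_def] at h2 h3
        fun_prop
      have h4 := (hcont.tendsto 0).comp hu
      simp_rw [h1]
      convert! h4 using 2
      show charFun (Measure.dirac x) ξ = _
      simp [exponentAt_zero hν, flow_zero, real_inner_comm]
    rw [ProbabilityMeasure.tendsto_iff_forall_integral_rclike_tendsto ℂ] at hP
    have h5 := hP (bcfOfTendstoZero f hf h0)
    have h6 : ∫ y, bcfOfTendstoZero f hf h0 y ∂(Measure.dirac x) = f x := integral_dirac _ _
    rw [← h6]
    exact h5
  refine (key.mono_left nhdsWithin_le_nhds).congr' ?_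
  filter_upwards [self_mem_nhdsWithin] with t ht
  rw [abs_of_pos ht]

end Semigroup

/-! ### The generator on test functions -/

section Generator

open SchwartzMap FourierTransform LineDeriv

variable {d : ℕ}

theorem schwartz_eq_integral_fourier (f : 𝓢(Vec d, ℂ)) (x : Vec d) :
    f x = ∫ η, Complex.exp ((inner ℝ ((2 * Real.pi) • η) x : ℝ) * Complex.I) * 𝓕 f η := by
  have h : 𝓕⁻ (𝓕 f) = f := FourierTransform.fourierInv_fourier_eq f
  conv_lhs => rw [← h]
  rw [SchwartzMap.fourierInv_coe, Real.fourierInv_eq']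
  refine integral_congr_ae (ae_of_all _ fun η => ?_)
  simp only [smul_eq_mul, real_inner_smul_left]

theorem fourier_lineDerivOp_apply (f : 𝓢(Vec d, ℂ)) (m η : Vec d) :
    𝓕 (∂_{m} f) η = ((inner ℝ ((2 * Real.pi) • η) m : ℝ) * Complex.I) * 𝓕 f η := by
  have : (fun y : Vec d => (inner ℝ y m : ℝ)).HasTemperateGrowth := by fun_prop
  rw [SchwartzMap.fourier_lineDerivOp_eq, smul_apply,
    SchwartzMap.smulLeftCLM_apply_apply this, real_inner_smul_left]
  simp
  ring

theorem fderiv_eq_integral_fourier (f : 𝓢(Vec d, ℂ)) (x m : Vec d) :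
    fderiv ℝ f x m = ∫ η, Complex.exp ((inner ℝ ((2 * Real.pi) • η) x : ℝ) * Complex.I) *
      (((inner ℝ ((2 * Real.pi) • η) m : ℝ) * Complex.I) * 𝓕 f η) := by
  rw [← SchwartzMap.lineDerivOp_apply_eq_fderiv, schwartz_eq_integral_fourier]
  simp_rw [fourier_lineDerivOp_apply]

theorem iteratedFDeriv_two_eq_integral_fourier (f : 𝓢(Vec d, ℂ)) (x v w : Vec d) :
    iteratedFDeriv ℝ 2 f x ![v, w] =
      ∫ η, Complex.exp ((inner ℝ ((2 * Real.pi) • η) x : ℝ) * Complex.I) *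
      (-((inner ℝ ((2 * Real.pi) • η) v * inner ℝ ((2 * Real.pi) • η) w : ℝ) : ℂ) * 𝓕 f η) := by
  rw [← SchwartzMap.iteratedLineDerivOp_eq_iteratedFDeriv, LineDeriv.iteratedLineDerivOp_succ_left,
    LineDeriv.iteratedLineDerivOp_one, schwartz_eq_integral_fourier]
  simp_rw [fourier_lineDerivOp_apply]
  refine integral_congr_ae (ae_of_all _ fun η => ?_)
  simp only [Matrix.cons_val_zero, Fin.tail, Matrix.cons_val_succ, Complex.ofReal_mul]
  linear_combination (Complex.exp ((inner ℝ ((2 * Real.pi) • η) x : ℝ) * Complex.I) *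
    ((inner ℝ ((2 * Real.pi) • η) v : ℝ) : ℂ) * ((inner ℝ ((2 * Real.pi) • η) w : ℝ) : ℂ) *
      𝓕 f η) * Complex.I_mul_I

theorem integrable_sq_mul_schwartz (φ : 𝓢(Vec d, ℂ)) (a : ℝ) :
    Integrable fun η : Vec d => (1 + ‖a • η‖ ^ 2) * ‖φ η‖ := by
  have h0 := φ.integrable_pow_mul volume 0
  have h2 := φ.integrable_pow_mul volume 2
  convert! h0.add (h2.const_mul (a ^ 2)) using 2 with η
  simp only [Pi.add_apply, pow_zero, norm_smul, mul_pow, Real.norm_eq_abs, sq_abs]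
  ring

/-- A function of `η` bounded by `C (1 + |aη|²) |φ(η)|` with `φ` a Schwartz function is
integrable. -/
theorem integrable_of_norm_le_sq_mul_schwartz (φ : 𝓢(Vec d, ℂ)) (a C : ℝ) {g : Vec d → ℂ}
    (hg : AEStronglyMeasurable g) (h : ∀ η, ‖g η‖ ≤ C * (1 + ‖a • η‖ ^ 2)) :
    Integrable fun η => g η * φ η := by
  refine ((integrable_sq_mul_schwartz φ a).const_mul C).mono'
    (hg.mul φ.continuous.aestronglyMeasurable) (ae_of_all _ fun η => ?_)
  rw [norm_mul, ← mul_assoc]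
  gcongr
  exact h η

theorem norm_le_one_add_sq (ξ : Vec d) : ‖ξ‖ ≤ 1 + ‖ξ‖ ^ 2 := by
  nlinarith [sq_nonneg (‖ξ‖ - 1)]

variable {Q B : Matrix (Fin d) (Fin d) ℝ} {ν : Measure (Vec d)}

theorem kernelOp_schwartz (P : Vec d → Measure (Vec d)) (x : Vec d) [IsProbabilityMeasure (P x)]
    (f : 𝓢(Vec d, ℂ)) :
    kernelOp P f x = ∫ η, charFun (P x) ((2 * Real.pi) • η) * 𝓕 f η := by
  rw [kernelOp]
  conv_lhs => enter [2, y]; rw [schwartz_eq_integral_fourier]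
  rw [integral_integral_swap]
  · refine integral_congr_ae (ae_of_all _ fun η => ?_)
    simp only
    rw [integral_mul_const, charFun_apply]
    simp_rw [real_inner_comm]
  · have h1 : Integrable (fun p : Vec d × Vec d => (1 : ℝ) * ‖𝓕 f p.2‖) ((P x).prod volume) :=
      (integrable_const (1 : ℝ)).mul_prod (𝓕 f).integrable.norm
    refine h1.mono' ?_ (ae_of_all _ fun p => ?_)
    · have := (𝓕 f).continuous
      exact Continuous.aestronglyMeasurable (by unfold Function.uncurry; fun_prop)
    · simp only [Function.uncurry, norm_mul, Complex.norm_exp_ofReal_mul_I, le_refl]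

/-- The symbol `g` of a second order operator is integrable against the Fourier transform of a
Schwartz function. -/
theorem integrable_exp_mul_mul_fourier (f : 𝓢(Vec d, ℂ)) (x : Vec d) {g : Vec d → ℂ} (C : ℝ)
    (hg : AEStronglyMeasurable g) (h : ∀ η, ‖g η‖ ≤ C * (1 + ‖(2 * Real.pi) • η‖ ^ 2)) :
    Integrable fun η => Complex.exp ((inner ℝ ((2 * Real.pi) • η) x : ℝ) * Complex.I) *
      (g η * 𝓕 f η) := by
  have hE : Continuous fun η : Vec d =>
    Complex.exp ((inner ℝ ((2 * Real.pi) • η) x : ℝ) * Complex.I) := by fun_prop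
  have := integrable_of_norm_le_sq_mul_schwartz (𝓕 f) (2 * Real.pi) C
    (hE.aestronglyMeasurable.mul hg)
    fun η => by
      rw [Pi.mul_apply, norm_mul, Complex.norm_exp_ofReal_mul_I, one_mul]; exact h η
  simpa only [Pi.mul_apply, mul_assoc] using this

/-- The characteristic function `e^{Ψ_t(ξ) + i⟨ξ, e^{tB} x⟩}` of `P_t(x, ·)`. -/
noncomputable def ouChar (Q B : Matrix (Fin d) (Fin d) ℝ) (ν : Measure (Vec d)) (x : Vec d) (t : ℝ)
    (ξ : Vec d) : ℂ :=
  Complex.exp (exponentAt Q B ν t ξ + (inner ℝ ξ (flow B t x) : ℝ) * Complex.I)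

theorem ouChar_zero (hν : IsLevyMeasure ν) (x ξ : Vec d) :
    ouChar Q B ν x 0 ξ = Complex.exp ((inner ℝ ξ x : ℝ) * Complex.I) := by
  rw [ouChar, exponentAt_zero hν, flow_zero, zero_add]; rfl

theorem norm_ouChar_le_one (hQ : Q.PosSemidef) (hν : IsLevyMeasure ν) (x : Vec d) {t : ℝ}
    (ht : 0 ≤ t) (ξ : Vec d) : ‖ouChar Q B ν x t ξ‖ ≤ 1 := by
  have := isProbabilityMeasure_ouTransition (B := B) hQ hν ht x
  rw [ouChar, ← charFun_ouTransition hQ hν ht]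
  exact norm_charFun_le_one ξ

theorem continuous_ouChar (hQ : Q.PosSemidef) (hν : IsLevyMeasure ν) (x : Vec d) {t : ℝ}
    (ht : 0 ≤ t) : Continuous (ouChar Q B ν x t) := by
  have := isProbabilityMeasure_ouTransition (B := B) hQ hν ht x
  have h : ouChar Q B ν x t = charFun (ouTransition Q B ν t x) :=
    funext fun ξ => (charFun_ouTransition hQ hν ht x ξ).symm
  rw [h]
  exact continuous_charFun

theorem hasDerivAt_ouChar (hν : IsLevyMeasure ν) (x : Vec d) (t : ℝ) (ξ : Vec d) :
    HasDerivAt (fun t => ouChar Q B ν x t ξ)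
      (ouChar Q B ν x t ξ * (levyExponent Q ν (flow B.transpose t ξ) +
        (inner ℝ ξ (flow B t (mulVecL B x)) : ℝ) * Complex.I)) t := by
  have hc : Continuous fun r => levyExponent Q ν (flow B.transpose r ξ) :=
    (continuous_levyExponent_flow Q B.transpose hν).uncurry_right ξ
  have h1 : HasDerivAt (fun t => exponentAt Q B ν t ξ)
      (levyExponent Q ν (flow B.transpose t ξ)) t := by
    simp_rw [exponentAt_eq Q B hν]
    exact intervalIntegral.integral_hasDerivAt_right (hc.intervalIntegrable _ _)
      (hc.stronglyMeasurableAtFilter _ _) hc.continuousAt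
  have h2 : HasDerivAt (fun t => flow B t x) (flow B t (mulVecL B x)) t :=
    (ContinuousLinearMap.apply ℝ (Vec d) x).hasFDerivAt.comp_hasDerivAt t (hasDerivAt_flow B t)
  have h3 : HasDerivAt (fun t => (inner ℝ ξ (flow B t x) : ℝ))
      (inner ℝ ξ (flow B t (mulVecL B x))) t :=
    (innerSL ℝ ξ).hasFDerivAt.comp_hasDerivAt t h2
  exact (h1.add (h3.ofReal_comp.mul_const Complex.I)).cexp

theorem exists_norm_ouChar_sub_le (hQ : Q.PosSemidef) (hν : IsLevyMeasure ν) (x : Vec d) :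
    ∃ C : ℝ, 0 ≤ C ∧ ∀ t ∈ Set.Icc (0 : ℝ) 1, ∀ ξ,
      ‖ouChar Q B ν x t ξ - ouChar Q B ν x 0 ξ‖ ≤ C * (1 + ‖ξ‖ ^ 2) * t := by
  obtain ⟨K, hK0, hK⟩ := exists_norm_levyExponent_le Q hν
  obtain ⟨M, hM0, hM⟩ := exists_flow_norm_le B 1
  set C : ℝ := K * (1 + M ^ 2) + M * ‖mulVecL B x‖ with hC
  have hbound (t : ℝ) (ht : t ∈ Set.Icc (0 : ℝ) 1) (ξ : Vec d) :
      ‖ouChar Q B ν x t ξ * (levyExponent Q ν (flow B.transpose t ξ) +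
        (inner ℝ ξ (flow B t (mulVecL B x)) : ℝ) * Complex.I)‖ ≤ C * (1 + ‖ξ‖ ^ 2) := by
    have h1 : ‖flow B.transpose t ξ‖ ≤ M * ‖ξ‖ :=
      (ContinuousLinearMap.le_opNorm _ _).trans
        (by gcongr; exact (norm_flow_transpose_le B t).trans (hM t ht))
    have h2 : ‖flow B t (mulVecL B x)‖ ≤ M * ‖mulVecL B x‖ :=
      (ContinuousLinearMap.le_opNorm _ _).trans (by gcongr; exact hM t ht)
    have h3 : ‖levyExponent Q ν (flow B.transpose t ξ)‖ ≤ K * (1 + M ^ 2) * (1 + ‖ξ‖ ^ 2) := by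
      refine (hK _).trans ?_
      rw [mul_assoc]
      gcongr
      have : ‖flow B.transpose t ξ‖ ^ 2 ≤ M ^ 2 * ‖ξ‖ ^ 2 := by
        rw [← mul_pow]; gcongr
      nlinarith [sq_nonneg M, sq_nonneg ‖ξ‖]
    have h4 : ‖((inner ℝ ξ (flow B t (mulVecL B x)) : ℝ) : ℂ) * Complex.I‖ ≤
        M * ‖mulVecL B x‖ * (1 + ‖ξ‖ ^ 2) := by
      rw [norm_mul, Complex.norm_I, mul_one, Complex.norm_real]
      refine (norm_inner_le_norm _ _).trans ?_
      rw [mul_comm]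
      gcongr
      exact norm_le_one_add_sq ξ
    rw [norm_mul]
    calc _ ≤ 1 * (K * (1 + M ^ 2) * (1 + ‖ξ‖ ^ 2) + M * ‖mulVecL B x‖ * (1 + ‖ξ‖ ^ 2)) :=
          mul_le_mul (norm_ouChar_le_one hQ hν x ht.1 ξ)
            ((norm_add_le _ _).trans (add_le_add h3 h4)) (norm_nonneg _) zero_le_one
      _ = _ := by rw [hC]; ring
  refine ⟨C, by positivity, fun t ht ξ => ?_⟩
  have := norm_image_sub_le_of_norm_deriv_le_segment' (f := fun t => ouChar Q B ν x t ξ)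
    (a := 0) (b := 1) (fun s _ => (hasDerivAt_ouChar hν x s ξ).hasDerivWithinAt)
    (fun s hs => hbound s ⟨hs.1, hs.2.le⟩ ξ) t ht
  simpa using this

theorem difference_quotient_eq (hQ : Q.PosSemidef) (hν : IsLevyMeasure ν) (f : 𝓢(Vec d, ℂ))
    (x : Vec d) {t : ℝ} (ht : 0 ≤ t) :
    (t : ℂ)⁻¹ * (kernelOp (ouTransition Q B ν t) f x - f x) =
      ∫ η, ((t : ℂ)⁻¹ * (ouChar Q B ν x t ((2 * Real.pi) • η) -
        ouChar Q B ν x 0 ((2 * Real.pi) • η))) * 𝓕 f η := by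
  have := isProbabilityMeasure_ouTransition (B := B) hQ hν ht x
  have hi (s : ℝ) (hs : 0 ≤ s) :
      Integrable fun η => ouChar Q B ν x s ((2 * Real.pi) • η) * 𝓕 f η :=
    integrable_of_norm_le_sq_mul_schwartz _ (2 * Real.pi) 1
      ((continuous_ouChar hQ hν x hs).comp (continuous_const_smul _)).aestronglyMeasurable
      fun η => (norm_ouChar_le_one hQ hν x hs _).trans
        (by nlinarith [sq_nonneg ‖(2 * Real.pi) • η‖])
  have h1 : kernelOp (ouTransition Q B ν t) f x =
      ∫ η, ouChar Q B ν x t ((2 * Real.pi) • η) * 𝓕 f η := by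
    rw [kernelOp_schwartz]
    simp_rw [charFun_ouTransition hQ hν ht]
    rfl
  have h2 : f x = ∫ η, ouChar Q B ν x 0 ((2 * Real.pi) • η) * 𝓕 f η := by
    rw [schwartz_eq_integral_fourier f x]
    simp_rw [ouChar_zero hν]
  rw [h1, h2, ← integral_sub (hi t ht) (hi 0 le_rfl), ← integral_const_mul]
  refine integral_congr_ae (ae_of_all _ fun η => ?_)
  simp only
  ring

/-- The limit of the difference quotients of the semigroup at `0`, on the Fourier side. -/
theorem tendsto_difference_quotient (hQ : Q.PosSemidef) (hν : IsLevyMeasure ν)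
    (f : 𝓢(Vec d, ℂ)) (x : Vec d) :
    Tendsto (fun t : ℝ => (t : ℂ)⁻¹ * (kernelOp (ouTransition Q B ν t) f x - f x)) (𝓝[>] 0)
      (𝓝 (∫ η, Complex.exp ((inner ℝ ((2 * Real.pi) • η) x : ℝ) * Complex.I) *
        ((levyExponent Q ν ((2 * Real.pi) • η) +
          (inner ℝ ((2 * Real.pi) • η) (mulVecL B x) : ℝ) * Complex.I) * 𝓕 f η))) := by
  obtain ⟨C, hC0, hlip⟩ := exists_norm_ouChar_sub_le (B := B) hQ hν x
  refine Tendsto.congr' (f₁ := fun t : ℝ => ∫ η, ((t : ℂ)⁻¹ *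
    (ouChar Q B ν x t ((2 * Real.pi) • η) - ouChar Q B ν x 0 ((2 * Real.pi) • η))) * 𝓕 f η) ?_ ?_
  · filter_upwards [self_mem_nhdsWithin] with t ht
    exact (difference_quotient_eq hQ hν f x (le_of_lt ht)).symm
  refine tendsto_integral_filter_of_dominated_convergence
    (fun η => C * ((1 + ‖(2 * Real.pi) • η‖ ^ 2) * ‖𝓕 f η‖)) ?_ ?_
    ((integrable_sq_mul_schwartz _ _).const_mul C) (ae_of_all _ fun η => ?_)
  · filter_upwards [self_mem_nhdsWithin] with t ht
    have h1 := (continuous_ouChar (B := B) hQ hν x (le_of_lt ht)).comp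
      (continuous_const_smul (2 * Real.pi))
    have h2 := (continuous_ouChar (B := B) hQ hν x le_rfl).comp
      (continuous_const_smul (2 * Real.pi))
    exact ((continuous_const.mul (h1.sub h2)).mul (𝓕 f).continuous).aestronglyMeasurable
  · filter_upwards [Ioc_mem_nhdsGT (zero_lt_one' ℝ)] with t ht
    refine ae_of_all _ fun η => ?_
    rw [norm_mul, norm_mul, norm_inv, Complex.norm_real, Real.norm_of_nonneg ht.1.le, ← mul_assoc]
    refine mul_le_mul_of_nonneg_right ?_ (norm_nonneg _)
    rw [inv_mul_le_iff₀ ht.1, mul_comm t]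
    exact hlip t ⟨ht.1.le, ht.2⟩ _
  · have h1 := (hasDerivAt_ouChar (Q := Q) (B := B) hν x 0
      ((2 * Real.pi) • η)).tendsto_slope_zero_right
    have h2 := h1.mul_const (𝓕 f η)
    rw [flow_zero, flow_zero, mul_assoc] at h2
    simp only [zero_add, Complex.real_smul, Complex.ofReal_inv, ContinuousLinearMap.id_apply] at h2
    rwa [← ouChar_zero (Q := Q) (B := B) hν]

theorem norm_inner_mul_I_le (v ξ : Vec d) :
    ‖((inner ℝ ξ v : ℝ) : ℂ) * Complex.I‖ ≤ ‖v‖ * (1 + ‖ξ‖ ^ 2) := by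
  rw [norm_mul, Complex.norm_I, mul_one, Complex.norm_real, mul_comm ‖v‖]
  refine (norm_inner_le_norm _ _).trans ?_
  gcongr
  exact norm_le_one_add_sq _

theorem secondOrder_eq_integral_fourier (Q : Matrix (Fin d) (Fin d) ℝ) (f : 𝓢(Vec d, ℂ))
    (x : Vec d) : (1 / 2 : ℂ) * (∑ i, ∑ j, (Q i j : ℂ) *
      iteratedFDeriv ℝ 2 f x ![EuclideanSpace.single i 1, EuclideanSpace.single j 1]) =
    ∫ η, Complex.exp ((inner ℝ ((2 * Real.pi) • η) x : ℝ) * Complex.I) *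
      (((-(1 / 2) * inner ℝ (mulVecL Q ((2 * Real.pi) • η)) ((2 * Real.pi) • η) : ℝ) : ℂ)
        * 𝓕 f η) := by
  have hij (i j : Fin d) : Integrable fun η => (Q i j : ℂ) *
      (Complex.exp ((inner ℝ ((2 * Real.pi) • η) x : ℝ) * Complex.I) *
      (-((inner ℝ ((2 * Real.pi) • η) (EuclideanSpace.single i 1) *
        inner ℝ ((2 * Real.pi) • η) (EuclideanSpace.single j 1) : ℝ) : ℂ) * 𝓕 f η)) := by
    refine (integrable_exp_mul_mul_fourier f x 1 (by fun_prop) fun η => ?_).const_mul _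
    rw [norm_neg, Complex.norm_real, norm_mul]
    have hk (k : Fin d) : ‖inner ℝ ((2 * Real.pi) • η) (EuclideanSpace.single k (1 : ℝ))‖ ≤
        ‖(2 * Real.pi) • η‖ := by
      refine (norm_inner_le_norm _ _).trans ?_
      simp
    have := mul_le_mul (hk i) (hk j) (norm_nonneg _) (norm_nonneg _)
    nlinarith
  have hsum : (∑ i, ∑ j, (Q i j : ℂ) *
      iteratedFDeriv ℝ 2 f x ![EuclideanSpace.single i 1, EuclideanSpace.single j 1]) =
      ∫ η, ∑ i, ∑ j, (Q i j : ℂ) *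
      (Complex.exp ((inner ℝ ((2 * Real.pi) • η) x : ℝ) * Complex.I) *
      (-((inner ℝ ((2 * Real.pi) • η) (EuclideanSpace.single i 1) *
        inner ℝ ((2 * Real.pi) • η) (EuclideanSpace.single j 1) : ℝ) : ℂ) * 𝓕 f η)) := by
    rw [integral_finsetSum _ fun i _ => integrable_finsetSum _ fun j _ => hij i j]
    refine Finset.sum_congr rfl fun i _ => ?_
    rw [integral_finsetSum _ fun j _ => hij i j]
    refine Finset.sum_congr rfl fun j _ => ?_
    rw [integral_const_mul, iteratedFDeriv_two_eq_integral_fourier]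
  rw [hsum, ← integral_const_mul]
  refine integral_congr_ae (ae_of_all _ fun η => ?_)
  simp only [inner_mulVecL, EuclideanSpace.inner_single_right, Complex.ofReal_mul,
    Complex.ofReal_sum, Finset.mul_sum, Finset.sum_mul]
  refine Finset.sum_congr rfl fun i _ => Finset.sum_congr rfl fun j _ => ?_
  simp
  ring

theorem jump_increment_eq_integral_fourier (f : 𝓢(Vec d, ℂ)) (x y : Vec d) :
    f (x + y) - f x - (Metric.closedBall (0 : Vec d) 1).indicator (fun z => fderiv ℝ f x z) y =
      ∫ η, Complex.exp ((inner ℝ ((2 * Real.pi) • η) x : ℝ) * Complex.I) *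
        (jumpIntegrand ((2 * Real.pi) • η) y * 𝓕 f η) := by
  have h1 (η : Vec d) : (1 : ℝ) ≤ 1 * (1 + ‖(2 * Real.pi) • η‖ ^ 2) := by
    nlinarith [sq_nonneg ‖(2 * Real.pi) • η‖]
  have i1 := integrable_exp_mul_mul_fourier f x (g := fun η => Complex.exp
      ((inner ℝ ((2 * Real.pi) • η) y : ℝ) * Complex.I)) 1 (by fun_prop) fun η => by
    rw [Complex.norm_exp_ofReal_mul_I]
    exact h1 η
  have i2 := integrable_exp_mul_mul_fourier f x (g := fun η => 1) 1 (by fun_prop) fun η => by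
    rw [norm_one]
    exact h1 η
  have i3 : Integrable fun η => Complex.exp ((inner ℝ ((2 * Real.pi) • η) x : ℝ) * Complex.I) *
      (((Metric.closedBall (0 : Vec d) 1).indicator
      (fun z => ((inner ℝ ((2 * Real.pi) • η) z : ℝ) : ℂ) * Complex.I) y) * 𝓕 f η) := by
    by_cases h : y ∈ Metric.closedBall (0 : Vec d) 1
    · simp only [Set.indicator_of_mem h]
      exact integrable_exp_mul_mul_fourier f x _ (by fun_prop) fun η => norm_inner_mul_I_le y _
    · simp only [Set.indicator_of_notMem h, zero_mul, mul_zero]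
      exact integrable_zero _ _ _
  have j1 : f (x + y) = ∫ η, Complex.exp ((inner ℝ ((2 * Real.pi) • η) x : ℝ) * Complex.I) *
      (Complex.exp ((inner ℝ ((2 * Real.pi) • η) y : ℝ) * Complex.I) * 𝓕 f η) := by
    rw [schwartz_eq_integral_fourier]
    refine integral_congr_ae (ae_of_all _ fun η => ?_)
    simp only
    rw [inner_add_right, Complex.ofReal_add, add_mul, Complex.exp_add, mul_assoc]
  have j2 : f x = ∫ η, Complex.exp ((inner ℝ ((2 * Real.pi) • η) x : ℝ) * Complex.I) *
      ((1 : ℂ) * 𝓕 f η) := by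
    simp only [one_mul]
    exact schwartz_eq_integral_fourier f x
  have j3 : (Metric.closedBall (0 : Vec d) 1).indicator (fun z => fderiv ℝ f x z) y =
      ∫ η, Complex.exp ((inner ℝ ((2 * Real.pi) • η) x : ℝ) * Complex.I) *
      (((Metric.closedBall (0 : Vec d) 1).indicator
      (fun z => ((inner ℝ ((2 * Real.pi) • η) z : ℝ) : ℂ) * Complex.I) y) * 𝓕 f η) := by
    by_cases h : y ∈ Metric.closedBall (0 : Vec d) 1
    · simp only [Set.indicator_of_mem h]
      exact fderiv_eq_integral_fourier f x y
    · simp only [Set.indicator_of_notMem h, zero_mul, mul_zero, integral_zero]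
  rw [j1, j2, j3, ← integral_sub i1 i2]
  refine (integral_sub (i1.sub i2) i3).symm.trans ?_
  refine integral_congr_ae (ae_of_all _ fun η => ?_)
  simp only [jumpIntegrand, Pi.sub_apply]
  ring

theorem integrable_exp_mul_jumpIntegrand_mul (hν : IsLevyMeasure ν) (φ : 𝓢(Vec d, ℂ)) (x : Vec d) :
    Integrable (fun p : Vec d × Vec d =>
      Complex.exp ((inner ℝ ((2 * Real.pi) • p.2) x : ℝ) * Complex.I) *
        (jumpIntegrand ((2 * Real.pi) • p.2) p.1 * φ p.2)) (ν.prod volume) := by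
  have hσ := hν.sigmaFinite
  have h1 : Integrable (fun p : Vec d × Vec d => (2 * min 1 (‖p.1‖ ^ 2)) *
      ((1 + ‖(2 * Real.pi) • p.2‖ ^ 2) * ‖φ p.2‖)) (ν.prod volume) :=
    (hν.integrable_min.const_mul 2).mul_prod (integrable_sq_mul_schwartz φ (2 * Real.pi))
  have m1 : Measurable fun p : Vec d × Vec d => jumpIntegrand ((2 * Real.pi) • p.2) p.1 :=
    measurable_jumpIntegrand_comp (measurable_snd.const_smul (2 * Real.pi)) measurable_fst
  have m2 : Measurable fun p : Vec d × Vec d => φ p.2 :=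
    φ.continuous.measurable.comp measurable_snd
  have m3 : Measurable fun p : Vec d × Vec d =>
      Complex.exp ((inner ℝ ((2 * Real.pi) • p.2) x : ℝ) * Complex.I) := by fun_prop
  refine h1.mono' (m3.mul (m1.mul m2)).aestronglyMeasurable (ae_of_all _ fun p => ?_)
  rw [norm_mul, norm_mul, Complex.norm_exp_ofReal_mul_I, one_mul, ← mul_assoc]
  refine mul_le_mul_of_nonneg_right ?_ (norm_nonneg _)
  refine (norm_jumpIntegrand_le ((2 * Real.pi) • p.2) p.1).trans_eq (by ring)

theorem integral_jump_increment (hν : IsLevyMeasure ν) (f : 𝓢(Vec d, ℂ)) (x : Vec d) :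
    ∫ y, (f (x + y) - f x - (Metric.closedBall (0 : Vec d) 1).indicator
      (fun z => fderiv ℝ f x z) y) ∂ν =
      ∫ η, Complex.exp ((inner ℝ ((2 * Real.pi) • η) x : ℝ) * Complex.I) *
        (jumpExponent ν ((2 * Real.pi) • η) * 𝓕 f η) := by
  have hσ := hν.sigmaFinite
  rw [integral_congr_ae (ae_of_all _ (jump_increment_eq_integral_fourier f x)),
    integral_integral_swap (integrable_exp_mul_jumpIntegrand_mul hν (𝓕 f) x)]
  refine integral_congr_ae (ae_of_all _ fun η => ?_)
  simp only
  rw [integral_const_mul, integral_mul_const, jumpExponent_eq]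

/-- The generator on the Fourier side. -/
theorem ouGenerator_schwartz (Q B : Matrix (Fin d) (Fin d) ℝ) (hν : IsLevyMeasure ν)
    (f : 𝓢(Vec d, ℂ)) (x : Vec d) :
    ouGenerator Q B ν f x =
      ∫ η, Complex.exp ((inner ℝ ((2 * Real.pi) • η) x : ℝ) * Complex.I) *
        ((levyExponent Q ν ((2 * Real.pi) • η) +
          (inner ℝ ((2 * Real.pi) • η) (mulVecL B x) : ℝ) * Complex.I) * 𝓕 f η) := by
  have hdrift := integrable_exp_mul_mul_fourier f x (g := fun η =>
    ((inner ℝ ((2 * Real.pi) • η) (mulVecL B x) : ℝ) * Complex.I)) _ (by fun_prop)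
    fun η => norm_inner_mul_I_le (mulVecL B x) _
  obtain ⟨K, hK0, hK⟩ := exists_norm_levyExponent_le (ν := 0) Q IsLevyMeasure.zero_measure
  have hgauss := integrable_exp_mul_mul_fourier f x (g := fun η =>
      ((-(1 / 2) * inner ℝ (mulVecL Q ((2 * Real.pi) • η)) ((2 * Real.pi) • η) : ℝ) : ℂ))
      K (by fun_prop) fun η => by
    have := hK ((2 * Real.pi) • η)
    rwa [levyExponent, jumpExponent, integral_zero_measure, add_zero] at this
  have hjump := integrable_exp_mul_mul_fourier f x (g := fun η =>
      jumpExponent ν ((2 * Real.pi) • η)) (2 * ∫ y, min 1 (‖y‖ ^ 2) ∂ν)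
      (hν.continuous_jumpExponent.comp (continuous_const_smul _)).aestronglyMeasurable fun η => by
    refine (hν.norm_jumpExponent_le _).trans_eq ?_
    ring
  rw [ouGenerator, secondOrder_eq_integral_fourier, integral_jump_increment hν,
    fderiv_eq_integral_fourier, ← integral_add hgauss hdrift]
  refine (integral_add (hgauss.add hdrift) hjump).symm.trans ?_
  refine integral_congr_ae (ae_of_all _ fun η => ?_)
  simp only [levyExponent, Pi.add_apply]
  ring

theorem isFellerWithGenerator_ouTransition (hQ : Q.PosSemidef) (hν : IsLevyMeasure ν) :
    IsFellerWithGenerator (ouTransition Q B ν) (ouGenerator Q B ν) where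
  isProbabilityMeasure t ht x := isProbabilityMeasure_ouTransition hQ hν ht x
  measurable t ht := measurable_ouTransition hQ hν ht
  zero := ouTransition_zero hQ hν
  add s t hs ht x S hS := by
    rw [← ouTransition_bind hQ hν hs ht,
      Measure.bind_apply hS (measurable_ouTransition hQ hν ht).aemeasurable]
  feller t ht f hf h0 := feller_ouTransition hQ hν ht f hf h0
  tendsto_zero f hf h0 x := tendsto_kernelOp_ouTransition hQ hν f hf h0 x
  generator f hf hs x := by
    have h := tendsto_difference_quotient (B := B) hQ hν (hs.toSchwartzMap hf) x
    rw [← ouGenerator_schwartz Q B hν] at h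
    exact h

end Generator

/-! ### The exponent of the invariant distribution -/

section ExponentInfty

variable {d : ℕ} {Q B : Matrix (Fin d) (Fin d) ℝ} {ν : Measure (Vec d)}

/-- Jumps of size at most `1`, between `1` and `r`, and larger than `r` are bounded quadratically,
linearly and by a constant. With `r = e^{cs/2}` along the flow this is integrable in `s`. -/
theorem norm_jumpExponent_le_of_one_le (hν : IsLevyMeasure ν) (ξ : Vec d) {r : ℝ} (hr : 1 ≤ r) :
    ‖jumpExponent ν ξ‖ ≤ 2 * ‖ξ‖ ^ 2 * ∫ y, min 1 (‖y‖ ^ 2) ∂ν +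
      2 * ν.real {y | r < ‖y‖} + ‖ξ‖ * r * ν.real {y | 1 < ‖y‖} := by
  have hm (a : ℝ) : MeasurableSet {y : Vec d | a < ‖y‖} :=
    (isOpen_lt continuous_const continuous_norm).measurableSet
  have hi (a b : ℝ) (ha : 0 < a) : Integrable ({y : Vec d | a < ‖y‖}.indicator fun _ => b) ν :=
    (integrable_indicator_iff (hm a)).2 (integrableOn_const (hν.measure_lt_norm ha).ne)
  have i1 := hν.integrable_min.const_mul (2 * ‖ξ‖ ^ 2)
  have i2 := hi r 2 (by linarith)
  have i3 := hi 1 (‖ξ‖ * r) one_pos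
  have h : ∀ y, ‖jumpIntegrand ξ y‖ ≤ 2 * ‖ξ‖ ^ 2 * min 1 (‖y‖ ^ 2) +
      {y : Vec d | r < ‖y‖}.indicator (fun _ => (2 : ℝ)) y +
      {y : Vec d | 1 < ‖y‖}.indicator (fun _ => ‖ξ‖ * r) y := by
    intro y
    have p2 : 0 ≤ {y : Vec d | r < ‖y‖}.indicator (fun _ => (2 : ℝ)) y :=
      Set.indicator_nonneg (fun _ _ => by norm_num) y
    have p3 : 0 ≤ {y : Vec d | 1 < ‖y‖}.indicator (fun _ => ‖ξ‖ * r) y :=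
      Set.indicator_nonneg (fun _ _ => by positivity) y
    have p1 : 0 ≤ 2 * ‖ξ‖ ^ 2 * min 1 (‖y‖ ^ 2) := by positivity
    rcases le_or_gt ‖y‖ 1 with hy | hy
    · have := norm_jumpIntegrand_le_of_le (ξ := ξ) hy
      rw [min_eq_right (pow_le_one₀ (norm_nonneg _) hy)] at p1 ⊢
      linarith
    · rcases le_or_gt ‖y‖ r with hyr | hyr
      · have h1 := norm_jumpIntegrand_le_mul (ξ := ξ) hy
        have h2 : ‖ξ‖ * ‖y‖ ≤ ‖ξ‖ * r := by gcongr
        have h3 : {y : Vec d | 1 < ‖y‖}.indicator (fun _ => ‖ξ‖ * r) y = ‖ξ‖ * r :=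
          Set.indicator_of_mem (by exact hy) _
        linarith
      · have h1 := norm_jumpIntegrand_le_two (ξ := ξ) hy
        have h3 : {y : Vec d | r < ‖y‖}.indicator (fun _ => (2 : ℝ)) y = 2 :=
          Set.indicator_of_mem (by exact hyr) _
        linarith
  rw [jumpExponent_eq]
  refine (norm_integral_le_of_norm_le ((i1.add i2).add i3) (ae_of_all _ h)).trans_eq ?_
  have e1 : ∫ y, (2 * ‖ξ‖ ^ 2 * min 1 (‖y‖ ^ 2) +
      {y : Vec d | r < ‖y‖}.indicator (fun _ => (2 : ℝ)) y +
      {y : Vec d | 1 < ‖y‖}.indicator (fun _ => ‖ξ‖ * r) y) ∂ν =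
      ∫ y, 2 * ‖ξ‖ ^ 2 * min 1 (‖y‖ ^ 2) ∂ν +
      ∫ y, {y : Vec d | r < ‖y‖}.indicator (fun _ => (2 : ℝ)) y ∂ν +
      ∫ y, {y : Vec d | 1 < ‖y‖}.indicator (fun _ => ‖ξ‖ * r) y ∂ν := by
    rw [← integral_add i1 i2]
    exact integral_add (i1.add i2) i3
  refine e1.trans ?_
  rw [integral_const_mul, integral_indicator (hm _), integral_indicator (hm _),
    setIntegral_const, setIntegral_const]
  simp only [smul_eq_mul]
  ring

/-- The logarithmic moment condition makes `s ↦ ν(|y| > e^{as})` integrable at infinity. -/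
theorem integrableOn_measure_exp_lt_norm (hν : IsLevyMeasure ν)
    (hlog : ∫⁻ y in {y : Vec d | 1 ≤ ‖y‖}, ENNReal.ofReal (Real.log ‖y‖) ∂ν < ∞) {a : ℝ}
    (ha : 0 < a) :
    IntegrableOn (fun s : ℝ => ν.real {y | Real.exp (a * s) < ‖y‖}) (Set.Ioi 0) := by
  have hσ := hν.sigmaFinite
  set S : Set (ℝ × Vec d) := {p | 0 < p.1 ∧ Real.exp (a * p.1) < ‖p.2‖} with hS
  have hSm : MeasurableSet S := by
    refine IsOpen.measurableSet (IsOpen.inter (isOpen_lt continuous_const continuous_fst)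
      (isOpen_lt (show Continuous fun p : ℝ × Vec d => Real.exp (a * p.1) by fun_prop)
        (show Continuous fun p : ℝ × Vec d => ‖p.2‖ by fun_prop)))
  have hT : MeasurableSet {p : ℝ × Vec d | Real.exp (a * p.1) < ‖p.2‖} :=
    (isOpen_lt (by fun_prop) (by fun_prop)).measurableSet
  -- by Tonelli the integral over `s` is `∫ (log |y|)⁺ / a ν(dy)`
  have h1 : ∫⁻ s in Set.Ioi (0 : ℝ), ν {y | Real.exp (a * s) < ‖y‖} =
      ∫⁻ y, volume {s : ℝ | (s, y) ∈ S} ∂ν := by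
    have e1 := Measure.prod_apply (μ := (volume : Measure ℝ)) (ν := ν) hSm
    have e2 := Measure.prod_apply_symm (μ := (volume : Measure ℝ)) (ν := ν) hSm
    rw [← lintegral_indicator measurableSet_Ioi]
    refine Eq.trans ?_ (e1.symm.trans e2)
    refine lintegral_congr fun s => ?_
    by_cases hs : 0 < s
    · rw [Set.indicator_of_mem (by exact hs)]
      congr 1; ext y; simp [hS, hs]
    · rw [Set.indicator_of_notMem (by exact hs)]
      have : Prod.mk s ⁻¹' S = ∅ := by ext y; simp [hS, hs]
      rw [this, measure_empty]
  have h2 : ∫⁻ y, volume {s : ℝ | (s, y) ∈ S} ∂ν < ∞ := by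
    have hle : ∀ y, volume {s : ℝ | (s, y) ∈ S} ≤ {y : Vec d | 1 ≤ ‖y‖}.indicator
        (fun y => ENNReal.ofReal a⁻¹ * ENNReal.ofReal (Real.log ‖y‖)) y := by
      intro y
      by_cases hy : 1 ≤ ‖y‖
      · rw [Set.indicator_of_mem (by exact hy), ← ENNReal.ofReal_mul (by positivity)]
        have hsub : {s : ℝ | (s, y) ∈ S} ⊆ Set.Ioo 0 (a⁻¹ * Real.log ‖y‖) := by
          rintro s ⟨h0, hs⟩
          refine ⟨h0, ?_⟩
          rw [lt_inv_mul_iff₀ ha, Real.lt_log_iff_exp_lt (by linarith)]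
          exact hs
        refine (measure_mono hsub).trans_eq ?_
        rw [Real.volume_Ioo, sub_zero]
      · rw [Set.indicator_of_notMem (by exact hy)]
        have : {s : ℝ | (s, y) ∈ S} = ∅ := by
          ext s
          simp only [hS, Set.mem_ofPred_eq, Set.mem_empty_iff_false, iff_false, not_and, not_lt]
          intro hs
          have := Real.one_lt_exp_iff.2 (mul_pos ha hs)
          linarith
        rw [this, measure_empty]
    refine (lintegral_mono hle).trans_lt ?_
    rw [lintegral_indicator (isClosed_le continuous_const continuous_norm).measurableSet,
      lintegral_const_mul' _ _ ENNReal.ofReal_ne_top]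
    exact ENNReal.mul_lt_top ENNReal.ofReal_lt_top hlog
  refine integrable_toReal_of_lintegral_ne_top (measurable_measure_prodMk_left hT).aemeasurable ?_
  rw [← h1] at h2
  exact h2.ne

/-- The integrand of `Ψ_∞` is dominated, locally uniformly in `ξ`, by an integrable function. -/
theorem exists_integrableOn_bound_levyExponent_flow (Q : Matrix (Fin d) (Fin d) ℝ)
    (hν : IsLevyMeasure ν) (hB : ∀ z ∈ spectrum ℂ (B.map (algebraMap ℝ ℂ)), z.re < 0)
    (hlog : ∫⁻ y in {y : Vec d | 1 ≤ ‖y‖}, ENNReal.ofReal (Real.log ‖y‖) ∂ν < ∞) (R : ℝ) :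
    ∃ G : ℝ → ℝ, IntegrableOn G (Set.Ioi 0) ∧ ∀ s, 0 < s → ∀ ξ : Vec d, ‖ξ‖ ≤ R →
      ‖levyExponent Q ν (flow B.transpose s ξ)‖ ≤ G s := by
  obtain ⟨C, c, hC, hc, hdec⟩ := exists_flow_decay B hB
  set I := ∫ y, min 1 (‖y‖ ^ 2) ∂ν
  have hI : 0 ≤ I := integral_nonneg fun y => by positivity
  refine ⟨fun s => (‖mulVecL Q‖ + 2 * I) * (C * R) ^ 2 * Real.exp (-(2 * c) * s) +
    2 * ν.real {y | Real.exp (c / 2 * s) < ‖y‖} +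
    C * R * ν.real {y | 1 < ‖y‖} * Real.exp (-(c / 2) * s), ?_, fun s hs ξ hξ => ?_⟩
  · refine Integrable.add (Integrable.add ?_ ?_) ?_
    · exact (exp_neg_integrableOn_Ioi 0 (by positivity)).const_mul _
    · exact (integrableOn_measure_exp_lt_norm hν hlog (by positivity)).const_mul _
    · exact (exp_neg_integrableOn_Ioi 0 (by positivity)).const_mul _
  · have hR : 0 ≤ R := (norm_nonneg _).trans hξ
    have h1 : ‖flow B.transpose s ξ‖ ≤ C * R * Real.exp (-(c * s)) := by
      refine (ContinuousLinearMap.le_opNorm _ _).trans ?_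
      calc _ ≤ (C * Real.exp (-(c * s))) * R := by
            gcongr; exact (norm_flow_transpose_le B s).trans (hdec s hs.le)
        _ = _ := by ring
    set η := flow B.transpose s ξ
    have hsq : ‖η‖ ^ 2 ≤ (C * R) ^ 2 * Real.exp (-(2 * c) * s) := by
      calc ‖η‖ ^ 2 ≤ (C * R * Real.exp (-(c * s))) ^ 2 := by gcongr
        _ = _ := by rw [mul_pow, ← Real.exp_nat_mul]; congr 2; push_cast; ring
    have hlin : ‖η‖ * Real.exp (c / 2 * s) ≤ C * R * Real.exp (-(c / 2) * s) := by
      calc _ ≤ C * R * Real.exp (-(c * s)) * Real.exp (c / 2 * s) := by gcongr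
        _ = _ := by rw [mul_assoc, ← Real.exp_add]; congr 2; ring
    have hg := norm_gaussianExponent_le Q η
    have hj := norm_jumpExponent_le_of_one_le hν η
      (r := Real.exp (c / 2 * s)) (Real.one_le_exp (by positivity))
    have hν1 : 0 ≤ ν.real {y : Vec d | 1 < ‖y‖} := measureReal_nonneg
    refine (norm_add_le _ _).trans ?_
    calc _ ≤ ‖mulVecL Q‖ * ‖η‖ ^ 2 + (2 * ‖η‖ ^ 2 * I +
          2 * ν.real {y | Real.exp (c / 2 * s) < ‖y‖} +
          ‖η‖ * Real.exp (c / 2 * s) * ν.real {y | 1 < ‖y‖}) := add_le_add hg hj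
      _ = (‖mulVecL Q‖ + 2 * I) * ‖η‖ ^ 2 + 2 * ν.real {y | Real.exp (c / 2 * s) < ‖y‖} +
          ‖η‖ * Real.exp (c / 2 * s) * ν.real {y | 1 < ‖y‖} := by ring
      _ ≤ (‖mulVecL Q‖ + 2 * I) * ((C * R) ^ 2 * Real.exp (-(2 * c) * s)) +
          2 * ν.real {y | Real.exp (c / 2 * s) < ‖y‖} +
          C * R * Real.exp (-(c / 2) * s) * ν.real {y | 1 < ‖y‖} := by gcongr
      _ = _ := by ring

/-- The exponent `Ψ_∞(ξ) = ∫_0^∞ ψ(e^{sB*} ξ) ds` of the invariant distribution. -/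
noncomputable def exponentInfty (Q B : Matrix (Fin d) (Fin d) ℝ) (ν : Measure (Vec d))
    (ξ : Vec d) : ℂ :=
  ∫ s in Set.Ioi (0 : ℝ), levyExponent Q ν (flow B.transpose s ξ)

theorem integrableOn_levyExponent_flow (Q : Matrix (Fin d) (Fin d) ℝ) (hν : IsLevyMeasure ν)
    (hB : ∀ z ∈ spectrum ℂ (B.map (algebraMap ℝ ℂ)), z.re < 0)
    (hlog : ∫⁻ y in {y : Vec d | 1 ≤ ‖y‖}, ENNReal.ofReal (Real.log ‖y‖) ∂ν < ∞)
    (ξ : Vec d) :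
    IntegrableOn (fun s => levyExponent Q ν (flow B.transpose s ξ)) (Set.Ioi 0) := by
  obtain ⟨G, hG, h⟩ := exists_integrableOn_bound_levyExponent_flow Q hν hB hlog ‖ξ‖
  refine hG.mono' ?_ ((ae_restrict_iff' measurableSet_Ioi).2 (ae_of_all _ fun s hs =>
    h s hs ξ le_rfl))
  exact ((continuous_levyExponent_flow Q B.transpose hν).uncurry_right ξ).aestronglyMeasurable

theorem continuous_exponentInfty (Q : Matrix (Fin d) (Fin d) ℝ) (hν : IsLevyMeasure ν)
    (hB : ∀ z ∈ spectrum ℂ (B.map (algebraMap ℝ ℂ)), z.re < 0)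
    (hlog : ∫⁻ y in {y : Vec d | 1 ≤ ‖y‖}, ENNReal.ofReal (Real.log ‖y‖) ∂ν < ∞) :
    Continuous (exponentInfty Q B ν) := by
  rw [continuous_iff_continuousAt]
  intro ξ₀
  obtain ⟨G, hG, h⟩ := exists_integrableOn_bound_levyExponent_flow Q hν hB hlog (‖ξ₀‖ + 1)
  have hc := continuous_levyExponent_flow Q B.transpose hν
  refine continuousAt_of_dominated (bound := G)
    (Eventually.of_forall fun ξ => (hc.uncurry_right ξ).aestronglyMeasurable) ?_ hG
    (ae_of_all _ fun s => (hc.uncurry_left s).continuousAt)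
  filter_upwards [Metric.ball_mem_nhds ξ₀ one_pos] with ξ hξ
  refine (ae_restrict_iff' measurableSet_Ioi).2 (ae_of_all _ fun s hs => h s hs ξ ?_)
  have h1 := norm_le_norm_add_norm_sub' ξ ξ₀
  have h2 := mem_ball_iff_norm.1 hξ
  linarith

theorem isLevyExponent_exponentInfty (Q : Matrix (Fin d) (Fin d) ℝ) (hν : IsLevyMeasure ν)
    (hB : ∀ z ∈ spectrum ℂ (B.map (algebraMap ℝ ℂ)), z.re < 0)
    (hlog : ∫⁻ y in {y : Vec d | 1 ≤ ‖y‖}, ENNReal.ofReal (Real.log ‖y‖) ∂ν < ∞)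
    (hQ : Q.PosSemidef) :
    IsLevyExponent (exponentInfty Q B ν) :=
  IsLevyExponent.integral_Ioi (continuous_levyExponent_flow Q _ hν)
    (fun _ => (isLevyExponent_levyExponent hQ hν).comp_clm _)
    (integrableOn_levyExponent_flow Q hν hB hlog) (continuous_exponentInfty Q hν hB hlog)

theorem tendsto_exponentAt (Q : Matrix (Fin d) (Fin d) ℝ) (hν : IsLevyMeasure ν)
    (hB : ∀ z ∈ spectrum ℂ (B.map (algebraMap ℝ ℂ)), z.re < 0)
    (hlog : ∫⁻ y in {y : Vec d | 1 ≤ ‖y‖}, ENNReal.ofReal (Real.log ‖y‖) ∂ν < ∞)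
    (ξ : Vec d) :
    Tendsto (fun t => exponentAt Q B ν t ξ) atTop (𝓝 (exponentInfty Q B ν ξ)) := by
  simp_rw [exponentAt_eq Q B hν]
  exact intervalIntegral_tendsto_integral_Ioi 0 (integrableOn_levyExponent_flow Q hν hB hlog ξ)
    tendsto_id

/-- The exponent form of invariance: the invariant law has exponent `Ψ_∞ = Ψ_t + Ψ_∞ ∘ e^{tB*}`. -/
theorem exponentInfty_eq_add (Q : Matrix (Fin d) (Fin d) ℝ) (hν : IsLevyMeasure ν)
    (hB : ∀ z ∈ spectrum ℂ (B.map (algebraMap ℝ ℂ)), z.re < 0)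
    (hlog : ∫⁻ y in {y : Vec d | 1 ≤ ‖y‖}, ENNReal.ofReal (Real.log ‖y‖) ∂ν < ∞)
    (t : ℝ) (ξ : Vec d) : exponentInfty Q B ν ξ =
    exponentAt Q B ν t ξ + exponentInfty Q B ν (flow B.transpose t ξ) := by
  have h1 := (tendsto_exponentAt Q hν hB hlog ξ).comp (tendsto_atTop_add_const_right atTop t
    tendsto_id)
  have h2 := (tendsto_exponentAt Q hν hB hlog (flow B.transpose t ξ)).const_add
    (exponentAt Q B ν t ξ)
  refine tendsto_nhds_unique h1 (h2.congr fun s => ?_)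
  exact (exponentAt_add Q B hν s t ξ).symm

theorem integrableOn_inner_flow (Q : Matrix (Fin d) (Fin d) ℝ) 
    (hB : ∀ z ∈ spectrum ℂ (B.map (algebraMap ℝ ℂ)), z.re < 0)
    (ξ η : Vec d) : IntegrableOn (fun s =>
    inner ℝ (mulVecL Q (flow B.transpose s ξ)) (flow B.transpose s η)) (Set.Ioi 0) := by
  obtain ⟨C, c, hC, hc, hdec⟩ := exists_flow_decay B hB
  have hexp : IntegrableOn (fun s => ‖mulVecL Q‖ * C ^ 2 * ‖ξ‖ * ‖η‖ * Real.exp (-(2 * c) * s))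
    (Set.Ioi 0) := (exp_neg_integrableOn_Ioi 0 (by positivity)).const_mul _
  have h1 := continuous_flow_apply B.transpose ξ
  have h2 := continuous_flow_apply B.transpose η
  refine hexp.mono' (Continuous.aestronglyMeasurable (by fun_prop)) ?_
  refine (ae_restrict_iff' measurableSet_Ioi).2 (ae_of_all _ fun s hs => ?_)
  have hb (ξ : Vec d) : ‖flow B.transpose s ξ‖ ≤ C * Real.exp (-(c * s)) * ‖ξ‖ :=
    (ContinuousLinearMap.le_opNorm _ _).trans
      (by gcongr; exact (norm_flow_transpose_le B s).trans (hdec s (le_of_lt hs)))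
  calc _ ≤ ‖mulVecL Q (flow B.transpose s ξ)‖ * ‖flow B.transpose s η‖ := norm_inner_le_norm _ _
    _ ≤ ‖mulVecL Q‖ * (C * Real.exp (-(c * s)) * ‖ξ‖) * (C * Real.exp (-(c * s)) * ‖η‖) := by
        gcongr
        · exact (ContinuousLinearMap.le_opNorm _ _).trans (by gcongr; exact hb ξ)
        · exact hb η
    _ = ‖mulVecL Q‖ * C ^ 2 * ‖ξ‖ * ‖η‖ * (Real.exp (-(c * s)) * Real.exp (-(c * s))) := by ring
    _ = _ := by rw [← Real.exp_add]; congr 2; ring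

theorem inner_mulVecL_covInfty (Q : Matrix (Fin d) (Fin d) ℝ) 
    (hB : ∀ z ∈ spectrum ℂ (B.map (algebraMap ℝ ℂ)), z.re < 0)
    (ξ η : Vec d) :
    inner ℝ (mulVecL (covInfty Q B) ξ) η = ∫ s in Set.Ioi (0 : ℝ),
      inner ℝ (mulVecL Q (flow B.transpose s ξ)) (flow B.transpose s η) := by
  have hij (i j : Fin d) : IntegrableOn (fun s => covIntegrand Q B s i j) (Set.Ioi 0) := by
    have h := integrableOn_inner_flow Q hB (EuclideanSpace.single j 1) (EuclideanSpace.single i 1)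
    simp_rw [← inner_covIntegrand] at h
    refine h.congr_fun (fun s _ => ?_) measurableSet_Ioi
    simp [EuclideanSpace.inner_single_right, mulVecL_apply]
  simp_rw [← inner_covIntegrand, inner_mulVecL]
  rw [integral_finsetSum]
  · refine Finset.sum_congr rfl fun i _ => ?_
    rw [integral_finsetSum]
    · refine Finset.sum_congr rfl fun j _ => ?_
      rw [integral_mul_const]; rfl
    · exact fun j _ => (hij i j).mul_const _
  · exact fun i _ => integrable_finsetSum _ fun j _ => (hij i j).mul_const _

theorem exponentInfty_eq (Q : Matrix (Fin d) (Fin d) ℝ) (hν : IsLevyMeasure ν)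
    (hB : ∀ z ∈ spectrum ℂ (B.map (algebraMap ℝ ℂ)), z.re < 0)
    (hlog : ∫⁻ y in {y : Vec d | 1 ≤ ‖y‖}, ENNReal.ofReal (Real.log ‖y‖) ∂ν < ∞)
    (ξ : Vec d) : exponentInfty Q B ν ξ =
    ((-(1 / 2) * inner ℝ (mulVecL (covInfty Q B) ξ) ξ : ℝ) : ℂ) + jumpExponentInfty B ν ξ := by
  have h1 : Integrable (fun s => ((-(1 / 2) *
      inner ℝ (mulVecL Q (flow B.transpose s ξ)) (flow B.transpose s ξ) : ℝ) : ℂ))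
      (volume.restrict (Set.Ioi 0)) := ((integrableOn_inner_flow Q hB ξ ξ).const_mul _).ofReal
  have h2 : Integrable (fun s => jumpExponent ν (flow B.transpose s ξ))
      (volume.restrict (Set.Ioi 0)) := by
    refine ((integrableOn_levyExponent_flow Q hν hB hlog ξ).sub h1).congr (ae_of_all _ fun s => ?_)
    simp [levyExponent]
  rw [exponentInfty, inner_mulVecL_covInfty Q hB, jumpExponentInfty, ← integral_const_mul,
    ← integral_complex_ofReal, ← integral_add h1 h2]
  rfl

end ExponentInfty

/-! ### The invariant distribution -/

section Invariant

variable {d : ℕ} {Q B : Matrix (Fin d) (Fin d) ℝ} {ν : Measure (Vec d)}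

/-- The law with exponent `Ψ_∞` is that of `e^{tB} X + Y` with `X` of the same law and `Y` an
independent noise of exponent `Ψ_t`. -/
theorem map_flow_conv_ouNoise (hQ : Q.PosSemidef) (hν : IsLevyMeasure ν)
    (hB : ∀ z ∈ spectrum ℂ (B.map (algebraMap ℝ ℂ)), z.re < 0)
    (hlog : ∫⁻ y in {y : Vec d | 1 ≤ ‖y‖}, ENNReal.ofReal (Real.log ‖y‖) ∂ν < ∞)
    {μ : Measure (Vec d)} [IsProbabilityMeasure μ]
    (hμ : ∀ ξ, charFun μ ξ = Complex.exp (exponentInfty Q B ν ξ)) {t : ℝ} (ht : 0 ≤ t) :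
    (μ.map (flow B t)).conv (ouNoise Q B ν t) = μ := by
  have := isProbabilityMeasure_ouNoise (B := B) hQ hν ht
  have : IsProbabilityMeasure (μ.map (flow B t)) :=
    Measure.isProbabilityMeasure_map (by fun_prop)
  refine Measure.ext_of_charFun (funext fun ξ => ?_)
  rw [charFun_conv, charFun_map_flow, hμ, hμ, charFun_ouNoise hQ hν ht, ← Complex.exp_add,
    exponentInfty_eq_add Q hν hB hlog t ξ, add_comm]

theorem lintegral_ouTransition_eq (hQ : Q.PosSemidef) (hν : IsLevyMeasure ν) {t : ℝ} (ht : 0 ≤ t)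
    (m : Measure (Vec d)) [IsProbabilityMeasure m] {S : Set (Vec d)} (hS : MeasurableSet S) :
    ∫⁻ x, ouTransition Q B ν t x S ∂m = (m.map (flow B t)).conv (ouNoise Q B ν t) S := by
  have := isProbabilityMeasure_ouNoise (B := B) hQ hν ht
  rw [← bind_shiftKernel, ← ouTransition_eq_shiftKernel hQ hν ht,
    Measure.bind_apply hS (measurable_ouTransition hQ hν ht).aemeasurable]

theorem isInvariantDistribution_of_charFun (hQ : Q.PosSemidef) (hν : IsLevyMeasure ν)
    (hB : ∀ z ∈ spectrum ℂ (B.map (algebraMap ℝ ℂ)), z.re < 0)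
    (hlog : ∫⁻ y in {y : Vec d | 1 ≤ ‖y‖}, ENNReal.ofReal (Real.log ‖y‖) ∂ν < ∞)
    {μ : Measure (Vec d)} [IsProbabilityMeasure μ]
    (hμ : ∀ ξ, charFun μ ξ = Complex.exp (exponentInfty Q B ν ξ)) :
    IsInvariantDistribution (ouTransition Q B ν) μ where
  isProbabilityMeasure := inferInstance
  invariant t ht S hS := by
    rw [lintegral_ouTransition_eq hQ hν ht μ hS, map_flow_conv_ouNoise hQ hν hB hlog hμ ht]

/-- Letting `t → ∞` in `φ(ξ) = φ(e^{tB*} ξ) e^{Ψ_t(ξ)}` identifies the characteristic function `φ` of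
any invariant distribution. -/
theorem charFun_of_isInvariantDistribution (hQ : Q.PosSemidef) (hν : IsLevyMeasure ν)
    (hB : ∀ z ∈ spectrum ℂ (B.map (algebraMap ℝ ℂ)), z.re < 0)
    (hlog : ∫⁻ y in {y : Vec d | 1 ≤ ‖y‖}, ENNReal.ofReal (Real.log ‖y‖) ∂ν < ∞)
    {m : Measure (Vec d)} (hm : IsInvariantDistribution (ouTransition Q B ν) m) (ξ : Vec d) :
    charFun m ξ = Complex.exp (exponentInfty Q B ν ξ) := by
  have := hm.isProbabilityMeasure
  have h1 (t : ℝ) (ht : 0 ≤ t) : charFun m ξ =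
      charFun m (flow B.transpose t ξ) * Complex.exp (exponentAt Q B ν t ξ) := by
    have := isProbabilityMeasure_ouNoise (B := B) hQ hν ht
    have : IsProbabilityMeasure (m.map (flow B t)) :=
      Measure.isProbabilityMeasure_map (by fun_prop)
    have h2 : (m.map (flow B t)).conv (ouNoise Q B ν t) = m := by
      ext S hS
      rw [← lintegral_ouTransition_eq hQ hν ht m hS, hm.invariant t ht S hS]
    conv_lhs => rw [← h2]
    rw [charFun_conv, charFun_map_flow, charFun_ouNoise hQ hν ht]
  have hflow : Tendsto (fun t => flow B.transpose t ξ) atTop (𝓝 0) := by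
    have h0 := (tendsto_flow_atTop_zero B hB).norm
    rw [norm_zero] at h0
    have h3 : Tendsto (fun t => ‖flow B t‖ * ‖ξ‖) atTop (𝓝 0) := by simpa using h0.mul_const ‖ξ‖
    refine squeeze_zero_norm (fun t => ?_) h3
    exact (ContinuousLinearMap.le_opNorm _ _).trans
      (by gcongr; exact norm_flow_transpose_le B t)
  have h4 := ((continuous_charFun (μ := m)).tendsto 0).comp hflow
  rw [charFun_zero, probReal_univ, Complex.ofReal_one] at h4
  have h5 := (Complex.continuous_exp.tendsto _).comp (tendsto_exponentAt Q hν hB hlog ξ)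
  have h6 := h4.mul h5
  rw [one_mul] at h6
  refine tendsto_nhds_unique (tendsto_const_nhds.congr' ?_) h6
  filter_upwards [eventually_ge_atTop 0] with t ht
  exact h1 t ht

theorem isInvariantDistribution_unique (hQ : Q.PosSemidef) (hν : IsLevyMeasure ν)
    (hB : ∀ z ∈ spectrum ℂ (B.map (algebraMap ℝ ℂ)), z.re < 0)
    (hlog : ∫⁻ y in {y : Vec d | 1 ≤ ‖y‖}, ENNReal.ofReal (Real.log ‖y‖) ∂ν < ∞)
    {m m' : Measure (Vec d)} (hm : IsInvariantDistribution (ouTransition Q B ν) m)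
    (hm' : IsInvariantDistribution (ouTransition Q B ν) m') : m = m' := by
  have := hm.isProbabilityMeasure
  have := hm'.isProbabilityMeasure
  refine Measure.ext_of_charFun (funext fun ξ => ?_)
  rw [charFun_of_isInvariantDistribution hQ hν hB hlog hm,
    charFun_of_isInvariantDistribution hQ hν hB hlog hm']

end Invariant

/-! ### Markov kernels as operators between `L^p` spaces -/

section LpOperators

open ProbabilityTheory

variable {d : ℕ} {p : ℝ≥0∞} {m m' : Measure (Vec d)}

/-- A condition on a Markov kernel `K` under which `f ↦ ∫ f(y) K(·, dy)` is a contraction from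
`L^p(m)` to `L^p(m')`: either `K` transports `m'` to `m`, or `p = ∞` and `K` transports `m'` to a
measure that is absolutely continuous with respect to `m`. -/
def LpCompatible (p : ℝ≥0∞) (m m' : Measure (Vec d)) (K : Vec d → Measure (Vec d)) : Prop :=
  m'.bind K = m ∨ p = ∞ ∧ m'.bind K ≪ m

variable {K : Kernel (Vec d) (Vec d)}

theorem LpCompatible.absolutelyContinuous (h : LpCompatible p m m' K) : m'.bind K ≪ m :=
  h.elim (fun h => h ▸ Measure.AbsolutelyContinuous.rfl) And.right

theorem LpCompatible.eLpNorm_le (h : LpCompatible p m m' K) (f : Vec d → ℂ) :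
    eLpNorm f p (m'.bind K) ≤ eLpNorm f p m := by
  rcases h with h | ⟨rfl, h⟩
  · rw [h]
  · simpa only [eLpNorm_exponent_top] using eLpNormEssSup_mono_measure f h

theorem LpCompatible.memLp (h : LpCompatible p m m' K) {f : Vec d → ℂ} (hf : MemLp f p m) :
    MemLp f p (m'.bind K) :=
  ⟨hf.1.mono_ac h.absolutelyContinuous, (h.eLpNorm_le f).trans_lt hf.2⟩

theorem LpCompatible.comp {m'' : Measure (Vec d)} {K' : Kernel (Vec d) (Vec d)}
    (h : LpCompatible p m m' K) (h' : LpCompatible p m' m'' K') :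
    LpCompatible p m m'' (K ∘ₖ K') := by
  have e : m''.bind (K ∘ₖ K') = (m''.bind K').bind K := Measure.comp_assoc.symm
  have hac : m' ≪ m' := Measure.AbsolutelyContinuous.rfl
  rcases h with h | ⟨rfl, h⟩
  · rcases h' with h' | ⟨rfl, h'⟩
    · exact Or.inl (by rw [e, h', h])
    · exact Or.inr ⟨rfl, by rw [e, ← h]; exact h'.comp_right K⟩
  · refine Or.inr ⟨rfl, ?_⟩
    rw [e]
    rcases h' with h' | ⟨-, h'⟩
    · rwa [h']
    · exact (h'.comp_right K).trans h

/-- Jensen's inequality for the operator of a Markov kernel. -/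
theorem eLpNorm_kernelOp_le [IsMarkovKernel K] (hp : 1 ≤ p) {f : Vec d → ℂ}
    (hf : AEStronglyMeasurable f (m'.bind K)) :
    eLpNorm (kernelOp K f) p m' ≤ eLpNorm f p (m'.bind K) := by
  have hp0 : p ≠ 0 := (zero_lt_one.trans_le hp).ne'
  have hmeas : ∀ᵐ x ∂m', AEStronglyMeasurable f (K x) := by
    filter_upwards [Measure.ae_ae_of_ae_comp hf.ae_eq_mk] with x hx
    exact ⟨_, hf.stronglyMeasurable_mk, hx⟩
  have hle : ∀ᵐ x ∂m', ‖kernelOp K f x‖ₑ ≤ eLpNorm f p (K x) := by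
    filter_upwards [hmeas] with x hx
    calc ‖kernelOp K f x‖ₑ ≤ ∫⁻ y, ‖f y‖ₑ ∂(K x) := enorm_integral_le_lintegral_enorm _
      _ = eLpNorm f 1 (K x) := eLpNorm_one_eq_lintegral_enorm.symm
      _ ≤ eLpNorm f p (K x) := eLpNorm_le_eLpNorm_of_exponent_le hp hx
  by_cases hpt : p = ∞
  · subst hpt
    simp only [eLpNorm_exponent_top] at hle ⊢
    have h1 : ∀ᵐ y ∂(m'.bind K), ‖f y‖ₑ ≤ eLpNormEssSup f (m'.bind K) :=
      enorm_ae_le_eLpNormEssSup f _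
    refine essSup_le_of_ae_le _ ?_
    filter_upwards [hle, Measure.ae_ae_of_ae_comp h1] with x hx hx1
    exact hx.trans (essSup_le_of_ae_le _ hx1)
  · have hp1 : 0 < p.toReal := ENNReal.toReal_pos hp0 hpt
    rw [eLpNorm_eq_lintegral_rpow_enorm_toReal hp0 hpt,
      eLpNorm_eq_lintegral_rpow_enorm_toReal hp0 hpt,
      Measure.lintegral_bind K.aemeasurable (hf.enorm.pow_const _)]
    gcongr ?_ ^ _
    refine lintegral_mono_ae ?_
    filter_upwards [hle] with x hx
    calc ‖kernelOp K f x‖ₑ ^ p.toReal ≤ eLpNorm f p (K x) ^ p.toReal := by gcongr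
      _ = ∫⁻ y, ‖f y‖ₑ ^ p.toReal ∂(K x) := by
        rw [eLpNorm_eq_lintegral_rpow_enorm_toReal hp0 hpt, ← ENNReal.rpow_mul,
          one_div_mul_cancel hp1.ne', ENNReal.rpow_one]

theorem LpCompatible.ae_integrable [IsMarkovKernel K] [IsProbabilityMeasure m'] (hp : 1 ≤ p)
    (h : LpCompatible p m m' K) {f : Vec d → ℂ} (hf : MemLp f p m) :
    ∀ᵐ x ∂m', Integrable f (K x) :=
  Measure.ae_integrable_of_integrable_comp ((h.memLp hf).integrable hp)

theorem LpCompatible.memLp_kernelOp [IsMarkovKernel K] [IsProbabilityMeasure m'] (hp : 1 ≤ p)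
    (h : LpCompatible p m m' K) {f : Vec d → ℂ} (hf : MemLp f p m) :
    MemLp (kernelOp K f) p m' := by
  refine ⟨?_, (eLpNorm_kernelOp_le hp (h.memLp hf).1).trans_lt (h.memLp hf).2⟩
  have h1 := (h.memLp hf).1
  have h2 : AEStronglyMeasurable (kernelOp K (h1.mk f)) m' :=
    (h1.stronglyMeasurable_mk.integral_kernel (κ := K)).aestronglyMeasurable
  refine h2.congr ?_
  filter_upwards [Measure.ae_ae_of_ae_comp h1.ae_eq_mk] with x hx
  exact integral_congr_ae (EventuallyEq.symm hx)

theorem LpCompatible.kernelOp_congr (h : LpCompatible p m m' K) {f g : Vec d → ℂ}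
    (hfg : f =ᵐ[m] g) : kernelOp K f =ᵐ[m'] kernelOp K g := by
  filter_upwards [Measure.ae_ae_of_ae_comp (h.absolutelyContinuous.ae_le hfg)] with x hx
  exact integral_congr_ae hx

/-- The contraction `L^p(m) → L^p(m')` given by a compatible Markov kernel. -/
theorem LpCompatible.exists_isKernelOpOnLp [Fact (1 ≤ p)] [IsMarkovKernel K]
    [IsProbabilityMeasure m'] (h : LpCompatible p m m' K) :
    ∃ T : Lp ℂ p m →L[ℂ] Lp ℂ p m', IsKernelOpOnLp T K := by
  have hp : 1 ≤ p := Fact.out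
  let T₀ : Lp ℂ p m →ₗ[ℂ] Lp ℂ p m' :=
    { toFun := fun f => (h.memLp_kernelOp hp (Lp.memLp f)).toLp _
      map_add' := fun f g => by
        refine Lp.ext ?_
        filter_upwards [MemLp.coeFn_toLp (h.memLp_kernelOp hp (Lp.memLp (f + g))),
          Lp.coeFn_add ((h.memLp_kernelOp hp (Lp.memLp f)).toLp _)
            ((h.memLp_kernelOp hp (Lp.memLp g)).toLp _),
          MemLp.coeFn_toLp (h.memLp_kernelOp hp (Lp.memLp f)),
          MemLp.coeFn_toLp (h.memLp_kernelOp hp (Lp.memLp g)),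
          h.kernelOp_congr (Lp.coeFn_add f g), h.ae_integrable hp (Lp.memLp f),
          h.ae_integrable hp (Lp.memLp g)] with x h1 h2 h3 h4 h5 h6 h7
        rw [h1, h2, Pi.add_apply, h3, h4, h5]
        exact integral_add h6 h7
      map_smul' := fun c f => by
        refine Lp.ext ?_
        filter_upwards [MemLp.coeFn_toLp (h.memLp_kernelOp hp (Lp.memLp (c • f))),
          Lp.coeFn_smul c ((h.memLp_kernelOp hp (Lp.memLp f)).toLp _),
          MemLp.coeFn_toLp (h.memLp_kernelOp hp (Lp.memLp f)),
          h.kernelOp_congr (Lp.coeFn_smul c f)] with x h1 h2 h3 h4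
        rw [h1, RingHom.id_apply, h2, Pi.smul_apply, h3, h4]
        exact integral_smul c _ }
  refine ⟨T₀.mkContinuous 1 fun f => ?_, fun f hf => ⟨h.ae_integrable hp hf, ?_⟩⟩
  · rw [one_mul]
    refine (Lp.norm_toLp _ (h.memLp_kernelOp hp (Lp.memLp f))).trans_le ?_
    rw [Lp.norm_def]
    refine ENNReal.toReal_mono (Lp.eLpNorm_ne_top f) ?_
    exact (eLpNorm_kernelOp_le hp (h.memLp (Lp.memLp f)).1).trans (h.eLpNorm_le f)
  · refine (MemLp.coeFn_toLp (h.memLp_kernelOp hp (Lp.memLp (hf.toLp f)))).trans ?_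
    exact h.kernelOp_congr hf.coeFn_toLp

/-- The composition of the operators of two compatible kernels is the operator of the composed
kernel. -/
theorem IsKernelOpOnLp.comp_apply [Fact (1 ≤ p)] {m'' : Measure (Vec d)}
    {K' : Kernel (Vec d) (Vec d)} [IsMarkovKernel K] [IsMarkovKernel K'] [IsProbabilityMeasure m']
    [IsProbabilityMeasure m''] {T : Lp ℂ p m →L[ℂ] Lp ℂ p m'} {T' : Lp ℂ p m' →L[ℂ] Lp ℂ p m''}
    (h : LpCompatible p m m' K) (h' : LpCompatible p m' m'' K') (hT : IsKernelOpOnLp T K)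
    (hT' : IsKernelOpOnLp T' K') (f : Lp ℂ p m) :
    T' (T f) =ᵐ[m''] kernelOp (K ∘ₖ K') f := by
  have hp : 1 ≤ p := Fact.out
  have h1 : T f =ᵐ[m'] kernelOp K f := by
    have := (hT f (Lp.memLp f)).2
    rwa [Lp.toLp_coeFn] at this
  have h2 : T' (T f) =ᵐ[m''] kernelOp K' (T f) := by
    have := (hT' (T f) (Lp.memLp (T f))).2
    rwa [Lp.toLp_coeFn] at this
  filter_upwards [h2, h'.kernelOp_congr h1, (h.comp h').ae_integrable hp (Lp.memLp f)]
    with x hx1 hx2 hx3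
  rw [hx1, hx2]
  exact (Kernel.integral_comp hx3).symm

/-- Two compositions of kernel operators agree as soon as the composed kernels agree. -/
theorem comp_eq_comp_of_kernel_comp_eq [Fact (1 ≤ p)] {m₁ m₂ m₂' m₃ : Measure (Vec d)}
    [IsProbabilityMeasure m₂] [IsProbabilityMeasure m₂'] [IsProbabilityMeasure m₃]
    {K₁ K₂ K₁' K₂' : Kernel (Vec d) (Vec d)} [IsMarkovKernel K₁] [IsMarkovKernel K₂]
    [IsMarkovKernel K₁'] [IsMarkovKernel K₂']
    {T₁ : Lp ℂ p m₁ →L[ℂ] Lp ℂ p m₂} {T₂ : Lp ℂ p m₂ →L[ℂ] Lp ℂ p m₃}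
    {T₁' : Lp ℂ p m₁ →L[ℂ] Lp ℂ p m₂'} {T₂' : Lp ℂ p m₂' →L[ℂ] Lp ℂ p m₃}
    (c₁ : LpCompatible p m₁ m₂ K₁) (c₂ : LpCompatible p m₂ m₃ K₂)
    (c₁' : LpCompatible p m₁ m₂' K₁') (c₂' : LpCompatible p m₂' m₃ K₂')
    (h₁ : IsKernelOpOnLp T₁ K₁) (h₂ : IsKernelOpOnLp T₂ K₂)
    (h₁' : IsKernelOpOnLp T₁' K₁') (h₂' : IsKernelOpOnLp T₂' K₂')
    (hK : K₁ ∘ₖ K₂ = K₁' ∘ₖ K₂') : T₂.comp T₁ = T₂'.comp T₁' := by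
  ext1 f
  refine Lp.ext ?_
  refine (IsKernelOpOnLp.comp_apply c₁ c₂ h₁ h₂ f).trans ?_
  rw [hK]
  exact (IsKernelOpOnLp.comp_apply c₁' c₂' h₁' h₂' f).symm

end LpOperators

/-! ### Intertwining with the diffusion semigroups -/

section Intertwining

open ProbabilityTheory

variable {d : ℕ}

/-- `shiftKernel` as a bundled kernel. -/
noncomputable def shiftMarkovKernel (A : Vec d →L[ℝ] Vec d) (h : Measure (Vec d)) [SFinite h] :
    Kernel (Vec d) (Vec d) :=
  ⟨shiftKernel A h, measurable_shiftKernel A h⟩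

theorem coe_shiftMarkovKernel (A : Vec d →L[ℝ] Vec d) (h : Measure (Vec d)) [SFinite h] :
    ⇑(shiftMarkovKernel A h) = shiftKernel A h := rfl

instance (A : Vec d →L[ℝ] Vec d) (h : Measure (Vec d)) [IsProbabilityMeasure h] :
    IsMarkovKernel (shiftMarkovKernel A h) :=
  ⟨fun x => inferInstanceAs (IsProbabilityMeasure (shiftKernel A h x))⟩

theorem shiftMarkovKernel_comp (A A' : Vec d →L[ℝ] Vec d) (h h' : Measure (Vec d))
    [IsProbabilityMeasure h] [IsProbabilityMeasure h'] (x : Vec d) :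
    (shiftMarkovKernel A' h' ∘ₖ shiftMarkovKernel A h) x =
      shiftKernel (A'.comp A) ((h.map A').conv h') x := by
  rw [Kernel.comp_apply]
  exact shiftKernel_bind_shiftKernel A A' h h' x

/-- Intertwining of shift kernels: it only requires an identity between the linear maps and one
between the noise laws. -/
theorem exists_intertwining {p : ℝ≥0∞} [Fact (1 ≤ p)] {m m' h : Measure (Vec d)}
    [IsProbabilityMeasure m] [IsProbabilityMeasure m'] [IsProbabilityMeasure h]
    (A : ℝ → Vec d →L[ℝ] Vec d) (n n' : ℝ → Measure (Vec d))
    (hn : ∀ t, 0 ≤ t → IsProbabilityMeasure (n t)) (hn' : ∀ t, 0 ≤ t → IsProbabilityMeasure (n' t))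
    (cΛ : LpCompatible p m m' (convKernel h))
    (cP : ∀ t, 0 ≤ t → LpCompatible p m m (shiftKernel (A t) (n t)))
    (cP' : ∀ t, 0 ≤ t → LpCompatible p m' m' (shiftKernel (A t) (n' t)))
    (hnoise : ∀ t, 0 ≤ t → (n' t).conv h = (h.map (A t)).conv (n t)) :
    ∃ (Λ : Lp ℂ p m →L[ℂ] Lp ℂ p m') (P : ℝ → Lp ℂ p m →L[ℂ] Lp ℂ p m)
      (P' : ℝ → Lp ℂ p m' →L[ℂ] Lp ℂ p m'),
      IsKernelOpOnLp Λ (convKernel h) ∧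
      ∀ t : ℝ, 0 ≤ t →
        IsKernelOpOnLp (P t) (shiftKernel (A t) (n t)) ∧
        IsKernelOpOnLp (P' t) (shiftKernel (A t) (n' t)) ∧
        (P' t).comp Λ = Λ.comp (P t) := by
  let I := ContinuousLinearMap.id ℝ (Vec d)
  obtain ⟨Λ, hΛ⟩ := LpCompatible.exists_isKernelOpOnLp (K := shiftMarkovKernel I h) cΛ
  have hP (t : ℝ) : ∃ T : Lp ℂ p m →L[ℂ] Lp ℂ p m, 0 ≤ t →
      IsKernelOpOnLp T (shiftKernel (A t) (n t)) := by
    by_cases ht : 0 ≤ t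
    · have := hn t ht
      obtain ⟨T, hT⟩ := LpCompatible.exists_isKernelOpOnLp
        (K := shiftMarkovKernel (A t) (n t)) (cP t ht)
      exact ⟨T, fun _ => hT⟩
    · exact ⟨0, fun h => absurd h ht⟩
  have hP' (t : ℝ) : ∃ T : Lp ℂ p m' →L[ℂ] Lp ℂ p m', 0 ≤ t →
      IsKernelOpOnLp T (shiftKernel (A t) (n' t)) := by
    by_cases ht : 0 ≤ t
    · have := hn' t ht
      obtain ⟨T, hT⟩ := LpCompatible.exists_isKernelOpOnLp
        (K := shiftMarkovKernel (A t) (n' t)) (cP' t ht)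
      exact ⟨T, fun _ => hT⟩
    · exact ⟨0, fun h => absurd h ht⟩
  choose P hP using hP
  choose P' hP' using hP'
  refine ⟨Λ, P, P', hΛ, fun t ht => ⟨hP t ht, hP' t ht, ?_⟩⟩
  have := hn t ht
  have := hn' t ht
  refine comp_eq_comp_of_kernel_comp_eq (K₁ := shiftMarkovKernel I h)
    (K₂ := shiftMarkovKernel (A t) (n' t)) (K₁' := shiftMarkovKernel (A t) (n t))
    (K₂' := shiftMarkovKernel I h) cΛ (cP' t ht) (cP t ht) cΛ hΛ (hP' t ht) (hP t ht) hΛ ?_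
  ext1 x
  have e : (n' t).map I = n' t := Measure.map_id
  rw [shiftMarkovKernel_comp, shiftMarkovKernel_comp, e, hnoise t ht]
  rfl

theorem bind_convKernel (m h : Measure (Vec d)) [IsProbabilityMeasure h]
    [IsProbabilityMeasure m] : m.bind (convKernel h) = m.conv h := by
  rw [convKernel_eq_shiftKernel, bind_shiftKernel]
  congr 1
  exact Measure.map_id

variable {Q Q' B : Matrix (Fin d) (Fin d) ℝ} {ν : Measure (Vec d)}

theorem mulVecL_sub (A A' : Matrix (Fin d) (Fin d) ℝ) : mulVecL (A - A') = mulVecL A - mulVecL A' :=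
  map_sub _ _ _

theorem jumpExponent_zero_measure (ξ : Vec d) : jumpExponent (0 : Measure (Vec d)) ξ = 0 := by
  simp [jumpExponent]

theorem jumpExponentInfty_zero_measure (ξ : Vec d) :
    jumpExponentInfty B (0 : Measure (Vec d)) ξ = 0 := by
  simp [jumpExponentInfty, jumpExponent_zero_measure]

/-- The exponent of `h_Λ`, as the difference of the exponents of the two invariant
distributions. -/
theorem intertwiningExponent_eq (hν : IsLevyMeasure ν)
    (hB : ∀ z ∈ spectrum ℂ (B.map (algebraMap ℝ ℂ)), z.re < 0)
    (hlog : ∫⁻ y in {y : Vec d | 1 ≤ ‖y‖}, ENNReal.ofReal (Real.log ‖y‖) ∂ν < ∞) (ξ : Vec d) :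
    ((-(1 / 2) * inner ℝ (mulVecL (covInfty Q B - covInfty Q' B) ξ) ξ : ℝ) : ℂ)
        + jumpExponentInfty B ν ξ + exponentInfty Q' B 0 ξ = exponentInfty Q B ν ξ := by
  rw [exponentInfty_eq Q hν hB hlog, exponentInfty_eq Q' IsLevyMeasure.zero_measure hB (by simp),
    jumpExponentInfty_zero_measure, mulVecL_sub, sub_apply, inner_sub_left]
  push_cast
  ring

/-- This is the case `Q = 0` of `isLevyExponent_exponentInfty`. -/
theorem isLevyExponent_jumpExponentInfty (hν : IsLevyMeasure ν)
    (hB : ∀ z ∈ spectrum ℂ (B.map (algebraMap ℝ ℂ)), z.re < 0)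
    (hlog : ∫⁻ y in {y : Vec d | 1 ≤ ‖y‖}, ENNReal.ofReal (Real.log ‖y‖) ∂ν < ∞) :
    IsLevyExponent (jumpExponentInfty B ν) := by
  have h := isLevyExponent_exponentInfty (0 : Matrix (Fin d) (Fin d) ℝ) hν hB hlog .zero
  convert! h using 1
  ext1 ξ
  have h0 : covInfty (0 : Matrix (Fin d) (Fin d) ℝ) B = 0 := by
    ext i j; simp [covInfty, covIntegrand]
  have h1 : mulVecL (0 : Matrix (Fin d) (Fin d) ℝ) = 0 := map_zero _
  rw [exponentInfty_eq 0 hν hB hlog, h0, h1]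
  simp

theorem isLevyExponent_intertwiningExponent (hν : IsLevyMeasure ν)
    (hB : ∀ z ∈ spectrum ℂ (B.map (algebraMap ℝ ℂ)), z.re < 0)
    (hlog : ∫⁻ y in {y : Vec d | 1 ≤ ‖y‖}, ENNReal.ofReal (Real.log ‖y‖) ∂ν < ∞)
    (hQQ' : (covInfty Q B - covInfty Q' B).PosSemidef) :
    IsLevyExponent fun ξ =>
      ((-(1 / 2) * inner ℝ (mulVecL (covInfty Q B - covInfty Q' B) ξ) ξ : ℝ) : ℂ)
        + jumpExponentInfty B ν ξ :=
  (IsLevyExponent.gaussian hQQ').add (isLevyExponent_jumpExponentInfty hν hB hlog)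

/-- Both `Λ P_t` and `P'_t Λ` add to `e^{tB} x` a noise with exponent `Ψ_{Λ} + Ψ'_t`. -/
theorem ouNoise_conv_eq {h : Measure (Vec d)} [IsProbabilityMeasure h]
    (hQ : Q.PosSemidef) (hQ' : Q'.PosSemidef) (hν : IsLevyMeasure ν)
    (hB : ∀ z ∈ spectrum ℂ (B.map (algebraMap ℝ ℂ)), z.re < 0)
    (hlog : ∫⁻ y in {y : Vec d | 1 ≤ ‖y‖}, ENNReal.ofReal (Real.log ‖y‖) ∂ν < ∞)
    (hh : ∀ ξ : Vec d, charFun h ξ = Complex.exp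
      (((-(1 / 2) * inner ℝ (mulVecL (covInfty Q B - covInfty Q' B) ξ) ξ : ℝ) : ℂ)
        + jumpExponentInfty B ν ξ)) {t : ℝ} (ht : 0 ≤ t) :
    (ouNoise Q' B 0 t).conv h = (h.map (flow B t)).conv (ouNoise Q B ν t) := by
  have := isProbabilityMeasure_ouNoise (B := B) hQ hν ht
  have := isProbabilityMeasure_ouNoise (B := B) hQ' IsLevyMeasure.zero_measure ht
  have : IsProbabilityMeasure (h.map (flow B t)) := Measure.isProbabilityMeasure_map (by fun_prop)
  refine Measure.ext_of_charFun (funext fun ξ => ?_)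
  rw [charFun_conv, charFun_conv, charFun_map_flow, hh, hh, charFun_ouNoise hQ hν ht,
    charFun_ouNoise hQ' IsLevyMeasure.zero_measure ht, ← Complex.exp_add, ← Complex.exp_add]
  congr 1
  have e1 := intertwiningExponent_eq (Q := Q) (Q' := Q') hν hB hlog ξ
  have e2 := intertwiningExponent_eq (Q := Q) (Q' := Q') hν hB hlog (flow B.transpose t ξ)
  have e3 := exponentInfty_eq_add Q hν hB hlog t ξ
  have e4 := exponentInfty_eq_add Q' (IsLevyMeasure.zero_measure (d := d)) hB (by simp) t ξ
  linear_combination e1 - e2 + e3 - e4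

theorem conv_intertwining_eq {h μ μ' : Measure (Vec d)} [IsProbabilityMeasure h]
    [IsProbabilityMeasure μ] [IsProbabilityMeasure μ'] (hν : IsLevyMeasure ν)
    (hB : ∀ z ∈ spectrum ℂ (B.map (algebraMap ℝ ℂ)), z.re < 0)
    (hlog : ∫⁻ y in {y : Vec d | 1 ≤ ‖y‖}, ENNReal.ofReal (Real.log ‖y‖) ∂ν < ∞)
    (hh : ∀ ξ : Vec d, charFun h ξ = Complex.exp
      (((-(1 / 2) * inner ℝ (mulVecL (covInfty Q B - covInfty Q' B) ξ) ξ : ℝ) : ℂ)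
        + jumpExponentInfty B ν ξ))
    (hμ : ∀ ξ, charFun μ ξ = Complex.exp (exponentInfty Q B ν ξ))
    (hμ' : ∀ ξ, charFun μ' ξ = Complex.exp (exponentInfty Q' B 0 ξ)) :
    μ'.conv h = μ := by
  refine Measure.ext_of_charFun (funext fun ξ => ?_)
  rw [charFun_conv, hμ, hμ', hh, ← Complex.exp_add, ← intertwiningExponent_eq (Q' := Q') hν hB hlog,
    add_comm]

/-- The intertwining of the Lévy and the diffusion semigroup. All operators are contractions since
their kernels transport the reference measures onto each other. -/
theorem exists_intertwining_diffusion {p : ℝ≥0∞} [Fact (1 ≤ p)] {h μ μ' : Measure (Vec d)}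
    [IsProbabilityMeasure h] [IsProbabilityMeasure μ] [IsProbabilityMeasure μ']
    (hQ : Q.PosSemidef) (hQ' : Q'.PosSemidef) (hν : IsLevyMeasure ν)
    (hB : ∀ z ∈ spectrum ℂ (B.map (algebraMap ℝ ℂ)), z.re < 0)
    (hlog : ∫⁻ y in {y : Vec d | 1 ≤ ‖y‖}, ENNReal.ofReal (Real.log ‖y‖) ∂ν < ∞)
    (hh : ∀ ξ : Vec d, charFun h ξ = Complex.exp
      (((-(1 / 2) * inner ℝ (mulVecL (covInfty Q B - covInfty Q' B) ξ) ξ : ℝ) : ℂ)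
        + jumpExponentInfty B ν ξ))
    (hμ : ∀ ξ, charFun μ ξ = Complex.exp (exponentInfty Q B ν ξ))
    (hμ' : ∀ ξ, charFun μ' ξ = Complex.exp (exponentInfty Q' B 0 ξ)) :
    ∃ (Λ : Lp ℂ p μ →L[ℂ] Lp ℂ p μ') (P : ℝ → Lp ℂ p μ →L[ℂ] Lp ℂ p μ)
      (P' : ℝ → Lp ℂ p μ' →L[ℂ] Lp ℂ p μ'),
      IsKernelOpOnLp Λ (convKernel h) ∧
      ∀ t : ℝ, 0 ≤ t →
        IsKernelOpOnLp (P t) (ouTransition Q B ν t) ∧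
        IsKernelOpOnLp (P' t) (ouTransition Q' B 0 t) ∧
        (P' t).comp Λ = Λ.comp (P t) := by
  have h0 := IsLevyMeasure.zero_measure (d := d)
  obtain ⟨Λ, P, P', hΛ, hP⟩ := exists_intertwining (p := p) (m := μ) (m' := μ') (h := h) (flow B)
    (ouNoise Q B ν) (ouNoise Q' B 0) (fun t ht => isProbabilityMeasure_ouNoise hQ hν ht)
    (fun t ht => isProbabilityMeasure_ouNoise hQ' h0 ht)
    (Or.inl (by rw [bind_convKernel, conv_intertwining_eq hν hB hlog hh hμ hμ']))
    (fun t ht => Or.inl (by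
      have := isProbabilityMeasure_ouNoise (B := B) hQ hν ht
      rw [bind_shiftKernel, map_flow_conv_ouNoise hQ hν hB hlog hμ ht]))
    (fun t ht => Or.inl (by
      have := isProbabilityMeasure_ouNoise (B := B) hQ' h0 ht
      rw [bind_shiftKernel, map_flow_conv_ouNoise hQ' h0 hB (by simp) hμ' ht]))
    (fun t ht => ouNoise_conv_eq hQ hQ' hν hB hlog hh ht)
  refine ⟨Λ, P, P', hΛ, fun t ht => ?_⟩
  rw [ouTransition_eq_shiftKernel hQ hν ht, ouTransition_eq_shiftKernel hQ' h0 ht]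
  exact hP t ht

end Intertwining

/-! ### The invariant distribution is equivalent to Lebesgue measure -/

section Equivalence

variable {d : ℕ} {Q B : Matrix (Fin d) (Fin d) ℝ} {ν : Measure (Vec d)}

theorem posSemidef_of_inner_mulVecL {A : Matrix (Fin d) (Fin d) ℝ}
    (hsymm : ∀ ξ η, inner ℝ (mulVecL A ξ) η = inner ℝ (mulVecL A η) ξ)
    (hnonneg : ∀ ξ, 0 ≤ inner ℝ (mulVecL A ξ) ξ) : A.PosSemidef := by
  rw [Matrix.posSemidef_iff_dotProduct_mulVec]
  refine ⟨?_, fun x => ?_⟩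
  · ext i j
    have h := hsymm (EuclideanSpace.single i 1) (EuclideanSpace.single j 1)
    simpa [EuclideanSpace.inner_single_right, mulVecL_apply] using h
  · have h := hnonneg (WithLp.toLp 2 x)
    rwa [inner_mulVecL_eq_dotProduct] at h

theorem Matrix.PosSemidef.inner_mulVecL_nonneg (hQ : Q.PosSemidef) (ξ : Vec d) :
    0 ≤ inner ℝ (mulVecL Q ξ) ξ := by
  rw [inner_mulVecL_eq_dotProduct]
  exact hQ.dotProduct_mulVec_nonneg ξ.ofLp

theorem Matrix.PosSemidef.inner_mulVecL_comm (hQ : Q.PosSemidef) (ξ η : Vec d) :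
    inner ℝ (mulVecL Q ξ) η = inner ℝ (mulVecL Q η) ξ := by
  have h : Q.transpose = Q := by simpa using hQ.isHermitian.eq
  conv_lhs => rw [← h]
  rw [inner_mulVecL_transpose, real_inner_comm]

theorem posSemidef_cov (hQ : Q.PosSemidef) {t : ℝ} (ht : 0 ≤ t) : (cov Q B t).PosSemidef := by
  refine posSemidef_of_inner_mulVecL (fun ξ η => ?_) fun ξ => ?_
  · rw [inner_mulVecL_cov, inner_mulVecL_cov]
    simp_rw [hQ.inner_mulVecL_comm (flow B.transpose _ ξ)]
  · rw [inner_mulVecL_cov]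
    exact intervalIntegral.integral_nonneg ht fun s _ => hQ.inner_mulVecL_nonneg _

/-- `Q_∞` dominates `Q_1`, which is positive definite. -/
theorem inner_mulVecL_covInfty_pos (hQ : Q.PosSemidef)
    (hB : ∀ z ∈ spectrum ℂ (B.map (algebraMap ℝ ℂ)), z.re < 0)
    (hdet : 0 < (cov Q B 1).det) {ξ : Vec d} (hξ : ξ ≠ 0) :
    0 < inner ℝ (mulVecL (covInfty Q B) ξ) ξ := by
  have hpd : (cov Q B 1).PosDef :=
    (posSemidef_cov hQ zero_le_one).posDef_iff_det_ne_zero.2 hdet.ne'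
  have h1 : 0 < inner ℝ (mulVecL (cov Q B 1) ξ) ξ := by
    rw [inner_mulVecL_eq_dotProduct]
    exact hpd.dotProduct_mulVec_pos (fun h => hξ (by ext i; exact congrFun h i))
  refine h1.trans_le ?_
  rw [inner_mulVecL_cov, inner_mulVecL_covInfty Q hB,
    intervalIntegral.integral_of_le zero_le_one]
  exact setIntegral_mono_set (integrableOn_inner_flow Q hB ξ ξ)
    (ae_of_all _ fun s => hQ.inner_mulVecL_nonneg _) (Set.Ioc_subset_Ioi_self).eventuallyLE

/-- `Q_∞` dominates a multiple of the identity. -/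
theorem exists_posSemidef_covInfty_sub (hQ : Q.PosSemidef)
    (hB : ∀ z ∈ spectrum ℂ (B.map (algebraMap ℝ ℂ)), z.re < 0)
    (hdet : 0 < (cov Q B 1).det) :
    ∃ ε : ℝ, 0 < ε ∧ (covInfty Q B - ε • (1 : Matrix (Fin d) (Fin d) ℝ)).PosSemidef := by
  have hlow : ∃ ε : ℝ, 0 < ε ∧ ∀ ξ : Vec d, ε * ‖ξ‖ ^ 2 ≤
      inner ℝ (mulVecL (covInfty Q B) ξ) ξ := by
    -- the unit sphere is empty in dimension `0`
    rcases (Metric.sphere (0 : Vec d) 1).eq_empty_or_nonempty with he | hne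
    · refine ⟨1, one_pos, fun ξ => ?_⟩
      have hξ : ξ = 0 := by
        by_contra h
        have : ‖ξ‖⁻¹ • ξ ∈ Metric.sphere (0 : Vec d) 1 := by
          simp [norm_smul, h]
        rw [he] at this
        exact this
      simp [hξ]
    · obtain ⟨ξ₀, hξ₀, hmin⟩ := (isCompact_sphere (0 : Vec d) 1).exists_isMinOn hne
        (f := fun ξ => inner ℝ (mulVecL (covInfty Q B) ξ) ξ)
        (Continuous.continuousOn (by fun_prop))
      have h0 : ξ₀ ≠ 0 := by rintro rfl; simp at hξ₀
      refine ⟨_, inner_mulVecL_covInfty_pos hQ hB hdet h0, fun ξ => ?_⟩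
      by_cases hξ : ξ = 0
      · simp [hξ]
      have h1 := hmin (show ‖ξ‖⁻¹ • ξ ∈ Metric.sphere (0 : Vec d) 1 by simp [norm_smul, hξ])
      simp only [Set.mem_ofPred_eq, map_smul, real_inner_smul_left, real_inner_smul_right] at h1
      have h2 : 0 < ‖ξ‖ := norm_pos_iff.2 hξ
      calc _ ≤ ‖ξ‖⁻¹ * (‖ξ‖⁻¹ * inner ℝ (mulVecL (covInfty Q B) ξ) ξ) * ‖ξ‖ ^ 2 := by gcongr
        _ = _ := by field_simp
  obtain ⟨ε, hε, h⟩ := hlow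
  have hform (ξ η : Vec d) :
      inner ℝ (mulVecL (covInfty Q B - ε • (1 : Matrix (Fin d) (Fin d) ℝ)) ξ) η =
        inner ℝ (mulVecL (covInfty Q B) ξ) η - ε * inner ℝ ξ η := by
    have h1 : mulVecL (ε • (1 : Matrix (Fin d) (Fin d) ℝ)) ξ = ε • ξ := by
      simp [mulVecL]
    rw [mulVecL_sub, sub_apply, h1, inner_sub_left, real_inner_smul_left]
  refine ⟨ε, hε, posSemidef_of_inner_mulVecL (fun ξ η => ?_) fun ξ => ?_⟩
  · rw [hform, hform, real_inner_comm η ξ, inner_mulVecL_covInfty Q hB,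
      inner_mulVecL_covInfty Q hB]
    simp_rw [hQ.inner_mulVecL_comm (flow B.transpose _ ξ)]
  · rw [hform, real_inner_self_eq_norm_sq]
    exact sub_nonneg.2 (h ξ)

/-- The isotropic Gaussian law has a positive Lebesgue density. -/
theorem exists_gaussian_equivalent_volume {ε : ℝ} (hε : 0 < ε) :
    ∃ γ : Measure (Vec d), IsProbabilityMeasure γ ∧ γ ≪ volume ∧ volume ≪ γ ∧
      ∀ ξ, charFun γ ξ = Complex.exp ((-(ε / 2 * ‖ξ‖ ^ 2) : ℝ) : ℂ) := by
  set b : ℝ := (2 * ε)⁻¹ with hb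
  have hb0 : 0 < b := by positivity
  set c : ℝ := (Real.pi / b) ^ ((Module.finrank ℝ (Vec d) : ℝ) / 2) with hc
  have hc0 : 0 < c := by positivity
  set f : Vec d → ℝ := fun v => c⁻¹ * Real.exp (-b * ‖v‖ ^ 2) with hf
  have hf0 : ∀ v, 0 < f v := fun v => by positivity
  have hfm : Continuous f := by fun_prop
  have hint : ∫ v, f v = 1 := by
    rw [hf, integral_const_mul, GaussianFourier.integral_rexp_neg_mul_sq_norm hb0]
    exact inv_mul_cancel₀ hc0.ne'
  have hfi : Integrable f := by
    by_contra h
    rw [integral_undef h] at hint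
    exact zero_ne_one hint
  have hdm : Measurable fun v => ENNReal.ofReal (f v) := by fun_prop
  refine ⟨volume.withDensity fun v => ENNReal.ofReal (f v), ⟨?_⟩,
    withDensity_absolutelyContinuous _ _,
    withDensity_absolutelyContinuous' hdm.aemeasurable
      (ae_of_all _ fun v => (ENNReal.ofReal_pos.2 (hf0 v)).ne'), fun ξ => ?_⟩
  · rw [withDensity_apply _ MeasurableSet.univ, Measure.restrict_univ,
      ← ofReal_integral_eq_lintegral_ofReal hfi (ae_of_all _ fun v => (hf0 v).le), hint,
      ENNReal.ofReal_one]
  · rw [charFun_apply, integral_withDensity_eq_integral_toReal_smul hdm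
      (ae_of_all _ fun _ => ENNReal.ofReal_lt_top)]
    have h1 := GaussianFourier.integral_cexp_neg_mul_sq_norm_add (V := Vec d) (b := (b : ℂ))
      (by simpa using hb0) Complex.I ξ
    have h2 : ((Real.pi : ℂ) / b) ^ ((Module.finrank ℝ (Vec d) : ℂ) / 2) = (c : ℂ) := by
      rw [hc, Complex.ofReal_cpow (by positivity)]
      push_cast
      rfl
    rw [h2] at h1
    calc _ = ∫ v : Vec d, (c : ℂ)⁻¹ *
          Complex.exp (-(b : ℂ) * ‖v‖ ^ 2 + Complex.I * (inner ℝ ξ v : ℝ)) := by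
          refine integral_congr_ae (ae_of_all _ fun v => ?_)
          have hfv : f v = c⁻¹ * Real.exp (-b * ‖v‖ ^ 2) := rfl
          simp only
          rw [ENNReal.toReal_ofReal (hf0 v).le, Complex.real_smul, Complex.exp_add,
            real_inner_comm, mul_comm Complex.I, hfv]
          push_cast
          ring
      _ = _ := by
          rw [integral_const_mul, h1, ← mul_assoc,
            inv_mul_cancel₀ (Complex.ofReal_ne_zero.2 hc0.ne'), one_mul]
          congr 1
          rw [hb, Complex.I_sq]
          push_cast
          have : (ε : ℂ) ≠ 0 := Complex.ofReal_ne_zero.2 hε.ne'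
          field_simp
          norm_num

theorem volume_absolutelyContinuous_conv {γ r : Measure (Vec d)}
    [IsProbabilityMeasure γ] [IsProbabilityMeasure r] (h : volume ≪ γ) : volume ≪ r.conv γ := by
  refine Measure.AbsolutelyContinuous.mk fun S hS h0 => ?_
  rw [Measure.conv, Measure.map_apply (by fun_prop) hS,
    Measure.measure_prod_null (measurable_add hS)] at h0
  obtain ⟨x, hx⟩ := h0.exists
  have h1 : volume (Prod.mk x ⁻¹' ((fun p : Vec d × Vec d => p.1 + p.2) ⁻¹' S)) = 0 := h hx
  rw [← measure_preimage_add volume x S]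
  exact h1

/-- The flow is an invertible linear map, so it preserves Lebesgue null sets. -/
theorem map_flow_absolutelyContinuous_volume {m : Measure (Vec d)} (hm : m ≪ volume)
    (B : Matrix (Fin d) (Fin d) ℝ) (t : ℝ) : m.map (flow B t) ≪ volume := by
  refine Measure.AbsolutelyContinuous.mk fun S hS h0 => ?_
  rw [Measure.map_apply (by fun_prop) hS]
  refine hm ?_
  have h1 : flow B t ⁻¹' S ⊆ flow B (-t) '' S := fun x hx => ⟨flow B t x, hx, flow_neg_apply B t x⟩
  refine measure_mono_null h1 ?_
  rw [Measure.addHaar_image_continuousLinearMap, h0, mul_zero]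

/-- The invariant distribution has an isotropic Gaussian convolution factor, because `Q_∞` is
positive definite. -/
theorem equivalent_volume_of_charFun (hQ : Q.PosSemidef) (hν : IsLevyMeasure ν)
    (hB : ∀ z ∈ spectrum ℂ (B.map (algebraMap ℝ ℂ)), z.re < 0)
    (hlog : ∫⁻ y in {y : Vec d | 1 ≤ ‖y‖}, ENNReal.ofReal (Real.log ‖y‖) ∂ν < ∞)
    (hdet : 0 < (cov Q B 1).det) {μ : Measure (Vec d)} [IsProbabilityMeasure μ]
    (hμ : ∀ ξ, charFun μ ξ = Complex.exp (exponentInfty Q B ν ξ)) :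
    μ ≪ volume ∧ volume ≪ μ := by
  obtain ⟨ε, hε, hpsd⟩ := exists_posSemidef_covInfty_sub hQ hB hdet
  obtain ⟨γ, hγ, h1, h2, hγc⟩ := exists_gaussian_equivalent_volume (d := d) hε
  have hexp := (IsLevyExponent.gaussian hpsd).add
    (isLevyExponent_jumpExponentInfty hν hB hlog)
  obtain ⟨r, hr, hrc⟩ := hexp.exists_charFun
  have he : r.conv γ = μ := by
    refine Measure.ext_of_charFun (funext fun ξ => ?_)
    rw [charFun_conv, hμ, hrc, hγc, ← Complex.exp_add, exponentInfty_eq Q hν hB hlog]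
    have h3 : mulVecL (ε • (1 : Matrix (Fin d) (Fin d) ℝ)) ξ = ε • ξ := by
      simp [mulVecL]
    rw [mulVecL_sub, sub_apply, h3, inner_sub_left, real_inner_smul_left,
      real_inner_self_eq_norm_sq]
    congr 1
    push_cast
    ring
  rw [← he]
  exact ⟨Measure.conv_absolutelyContinuous h1,
    volume_absolutelyContinuous_conv h2⟩

/-- The intertwining with the drift semigroup. Since `e^{tL}` and `Λ₁` do not preserve
`μ`, the absolute continuity of `μ` is what makes them act on `L^∞(μ)`. -/
theorem exists_intertwining_drift (hQ : Q.PosSemidef) (hν : IsLevyMeasure ν)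
    (hB : ∀ z ∈ spectrum ℂ (B.map (algebraMap ℝ ℂ)), z.re < 0)
    (hlog : ∫⁻ y in {y : Vec d | 1 ≤ ‖y‖}, ENNReal.ofReal (Real.log ‖y‖) ∂ν < ∞)
    (hdet : 0 < (cov Q B 1).det) {μ : Measure (Vec d)} [IsProbabilityMeasure μ]
    (hμ : ∀ ξ, charFun μ ξ = Complex.exp (exponentInfty Q B ν ξ)) :
    ∃ (Λ₁ : Lp ℂ ∞ μ →L[ℂ] Lp ℂ ∞ μ) (P D : ℝ → Lp ℂ ∞ μ →L[ℂ] Lp ℂ ∞ μ),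
      IsKernelOpOnLp Λ₁ (convKernel μ) ∧
      ∀ t : ℝ, 0 ≤ t →
        IsKernelOpOnLp (P t) (ouTransition Q B ν t) ∧
        IsKernelOpOnLp (D t) (driftKernel B t) ∧
        (D t).comp Λ₁ = Λ₁.comp (P t) := by
  obtain ⟨hμv, hvμ⟩ := equivalent_volume_of_charFun hQ hν hB hlog hdet hμ
  obtain ⟨Λ, P, D, hΛ, hP⟩ := exists_intertwining (p := ∞) (m := μ) (m' := μ) (h := μ) (flow B)
    (ouNoise Q B ν) (fun _ => Measure.dirac 0) (fun t ht => isProbabilityMeasure_ouNoise hQ hν ht)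
    (fun t _ => inferInstance)
    (Or.inr ⟨rfl, by
      rw [bind_convKernel]
      exact (Measure.conv_absolutelyContinuous hμv).trans hvμ⟩)
    (fun t ht => Or.inl (by
      have := isProbabilityMeasure_ouNoise (B := B) hQ hν ht
      rw [bind_shiftKernel, map_flow_conv_ouNoise hQ hν hB hlog hμ ht]))
    (fun t ht => Or.inr ⟨rfl, by
      rw [bind_shiftKernel, Measure.conv_dirac_zero]
      exact (map_flow_absolutelyContinuous_volume hμv B t).trans hvμ⟩)
    (fun t ht => by rw [Measure.dirac_zero_conv, map_flow_conv_ouNoise hQ hν hB hlog hμ ht])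
  refine ⟨Λ, P, D, hΛ, fun t ht => ?_⟩
  rw [ouTransition_eq_shiftKernel hQ hν ht, driftKernel_eq_shiftKernel]
  exact hP t ht

end Equivalence

/-! ### Moments from the smoothness of the characteristic function -/

section Moments

/-- A finite measure on the line whose characteristic function is `C²` has a second moment. -/
theorem lintegral_sq_lt_top_of_contDiff_charFun {m : Measure ℝ} [IsFiniteMeasure m]
    (hm : ContDiff ℝ 2 (charFun m)) : ∫⁻ x, ENNReal.ofReal (x ^ 2) ∂m < ∞ := by
  set g : ℝ → ℂ := fun h => charFun m h + charFun m (-h) with hg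
  have hgc : ContDiff ℝ 2 g := hm.add (hm.comp contDiff_neg)
  obtain ⟨C, hC⟩ := exists_taylor_mean_remainder_bound (n := 1) (zero_le_one' ℝ)
    (f := g) (hgc.of_le (by norm_num)).contDiffOn
  have hdiff : Differentiable ℝ (charFun m) := hm.differentiable (by norm_num)
  have hder : derivWithin g (Set.Icc 0 1) 0 = 0 := by
    have h1 : HasDerivAt g (deriv (charFun m) 0 + -deriv (charFun m) 0) 0 := by
      refine (hdiff 0).hasDerivAt.add ?_
      have h2 : HasDerivAt (charFun m) (deriv (charFun m) 0) (-0) := by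
        rw [neg_zero]; exact (hdiff 0).hasDerivAt
      convert! h2.scomp (0 : ℝ) (hasDerivAt_neg (0 : ℝ)) using 1
      simp
    rw [add_neg_cancel] at h1
    exact h1.hasDerivWithinAt.derivWithin (uniqueDiffOn_Icc_zero_one _ (by simp))
  -- the symmetric second difference of the characteristic function
  have hre (h : ℝ) : ∫ x, (2 - 2 * Real.cos (h * x)) ∂m = (g 0 - g h).re := by
    have hi (t : ℝ) : Integrable (fun x : ℝ => Complex.exp (t * x * Complex.I)) m := by
      refine (integrable_const (1 : ℝ)).mono' (by fun_prop) (ae_of_all _ fun x => ?_)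
      rw [← Complex.ofReal_mul, Complex.norm_exp_ofReal_mul_I]
    have e1 : g 0 - g h = ∫ x, (Complex.exp ((0 : ℝ) * x * Complex.I) +
        Complex.exp ((-0 : ℝ) * x * Complex.I) - (Complex.exp (h * x * Complex.I) +
        Complex.exp ((-h : ℝ) * x * Complex.I))) ∂m := by
      simp only [hg, charFun_apply_real]
      rw [← integral_add (hi 0) (hi (-0)), ← integral_add (hi h) (hi (-h))]
      exact (integral_sub ((hi 0).add (hi (-0))) ((hi h).add (hi (-h)))).symm
    rw [e1]
    have e2 := integral_re (𝕜 := ℂ) (((hi 0).add (hi (-0))).sub ((hi h).add (hi (-h))))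
    refine Eq.trans ?_ e2
    refine integral_congr_ae (ae_of_all _ fun x => ?_)
    simp only [Pi.sub_apply, Pi.add_apply, RCLike.re_to_complex, Complex.sub_re, Complex.add_re]
    simp_rw [← Complex.ofReal_mul, Complex.exp_ofReal_mul_I_re]
    simp
    ring
  have hbound (h : ℝ) (h0 : 0 < h) (h1 : h ≤ 1) :
      ∫ x, (2 - 2 * Real.cos (h * x)) ∂m ≤ C * h ^ 2 := by
    rw [hre]
    have h2 := hC h ⟨h0.le, h1⟩
    rw [taylorWithinEval_succ, taylor_within_zero_eval] at h2
    simp only [zero_add, iteratedDerivWithin_one, hder, smul_zero, add_zero, sub_zero] at h2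
    refine (Complex.re_le_norm _).trans ?_
    rw [norm_sub_rev]
    exact h2
  set u : ℕ → ℝ := fun n => 1 / ((n : ℝ) + 1) with hu
  have hu0 : ∀ n, 0 < u n := fun n => Nat.one_div_pos_of_nat
  have hu1 : ∀ n, u n ≤ 1 := fun n => by
    rw [hu]; simp only
    rw [div_le_one (by positivity)]
    have : (0 : ℝ) ≤ n := n.cast_nonneg
    linarith
  have hulim : Tendsto u atTop (𝓝 0) := tendsto_one_div_add_atTop_nhds_zero_nat
  set F : ℕ → ℝ → ℝ≥0∞ := fun n x => ENNReal.ofReal ((2 - 2 * Real.cos (u n * x)) / u n ^ 2)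
  have hFm : ∀ n, Measurable (F n) := fun n => by fun_prop
  have hFint (n : ℕ) : ∫⁻ x, F n x ∂m ≤ ENNReal.ofReal C := by
    have hi : Integrable (fun x => (2 - 2 * Real.cos (u n * x)) / u n ^ 2) m := by
      refine Integrable.div_const ?_ _
      refine (integrable_const (4 : ℝ)).mono' (by fun_prop) (ae_of_all _ fun x => ?_)
      rw [Real.norm_eq_abs, abs_le]
      constructor <;> linarith [Real.cos_le_one (u n * x), Real.neg_one_le_cos (u n * x)]
    have hn : ∀ x, 0 ≤ (2 - 2 * Real.cos (u n * x)) / u n ^ 2 := fun x =>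
      div_nonneg (by linarith [Real.cos_le_one (u n * x)]) (by positivity)
    rw [← ofReal_integral_eq_lintegral_ofReal hi (ae_of_all _ hn), integral_div]
    refine ENNReal.ofReal_le_ofReal ?_
    rw [div_le_iff₀ (pow_pos (hu0 n) 2)]
    exact hbound _ (hu0 n) (hu1 n)
  have hlim (x : ℝ) : Tendsto (fun n => F n x) atTop (𝓝 (ENNReal.ofReal (x ^ 2))) := by
    refine ENNReal.tendsto_ofReal ?_
    have e (n : ℕ) : (2 - 2 * Real.cos (u n * x)) / u n ^ 2 =
        x ^ 2 * Real.sinc (u n * x / 2) ^ 2 := by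
      have h1 : Real.cos (u n * x) = 1 - 2 * Real.sin (u n * x / 2) ^ 2 := by
        have h2 := Real.cos_sq' (u n * x / 2)
        have h3 := Real.cos_two_mul (u n * x / 2)
        rw [show 2 * (u n * x / 2) = u n * x by ring] at h3
        rw [h3, h2]; ring
      have h0 := (hu0 n).ne'
      rcases eq_or_ne x 0 with rfl | hx
      · simp
      rw [h1, Real.sinc_of_ne_zero (by positivity)]
      field_simp
      ring
    simp_rw [e]
    have h4 : Tendsto (fun n => u n * x / 2) atTop (𝓝 0) := by
      simpa using (hulim.mul_const x).div_const 2
    have h5 := ((Real.continuous_sinc.tendsto 0).comp h4).pow 2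
    rw [Real.sinc_zero] at h5
    simpa using h5.const_mul (x ^ 2)
  -- Fatou's lemma along `(2 - 2 cos (hx)) / h² → x²`
  calc ∫⁻ x, ENNReal.ofReal (x ^ 2) ∂m = ∫⁻ x, liminf (fun n => F n x) atTop ∂m :=
        lintegral_congr fun x => (hlim x).liminf_eq.symm
    _ ≤ liminf (fun n => ∫⁻ x, F n x ∂m) atTop := lintegral_liminf_le hFm
    _ ≤ ENNReal.ofReal C := liminf_le_of_le (by isBoundedDefault) fun b hb => by
        obtain ⟨n, hn⟩ := hb.exists
        exact hn.trans (hFint n)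
    _ < ∞ := ENNReal.ofReal_lt_top

/-- A finite measure on the line whose characteristic function is smooth has all moments: if `m`
has a smooth characteristic function, then so has `x² m`. -/
theorem lintegral_pow_lt_top_of_contDiff_charFun (k : ℕ) : ∀ {m : Measure ℝ} [IsFiniteMeasure m],
    ContDiff ℝ ((⊤ : ℕ∞) : WithTop ℕ∞) (charFun m) → ∫⁻ x, ENNReal.ofReal (x ^ (2 * k)) ∂m < ∞ := by
  induction k with
  | zero => intro m _ _; simp
  | succ k ih =>
    intro m _ hm
    have h2 := lintegral_sq_lt_top_of_contDiff_charFun (by exact_mod_cast contDiff_infty.1 hm 2)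
    have hdm : Measurable fun x : ℝ => ENNReal.ofReal (x ^ 2) := by fun_prop
    set m' := m.withDensity fun x => ENNReal.ofReal (x ^ 2)
    have : IsFiniteMeasure m' := isFiniteMeasure_withDensity h2.ne
    have hL2 : MemLp id 2 m := by
      rw [memLp_two_iff_integrable_sq (by fun_prop)]
      refine ⟨by fun_prop, ?_⟩
      rw [hasFiniteIntegral_iff_ofReal (ae_of_all _ fun x => sq_nonneg _)]
      exact h2
    have hchar : charFun m' = fun t => -iteratedDeriv 2 (charFun m) t := by
      ext1 t
      rw [iteratedDeriv_charFun (by exact_mod_cast hL2), charFun_apply_real,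
        integral_withDensity_eq_integral_toReal_smul hdm
        (ae_of_all _ fun _ => ENNReal.ofReal_lt_top), Complex.I_sq, neg_one_mul, neg_neg]
      refine integral_congr_ae (ae_of_all _ fun x => ?_)
      simp only
      rw [ENNReal.toReal_ofReal (sq_nonneg x), Complex.real_smul]
      push_cast
      ring
    have hsm : ContDiff ℝ ((⊤ : ℕ∞) : WithTop ℕ∞) (charFun m') := by
      rw [hchar]
      rw [iteratedDeriv_eq_iterate]
      exact (hm.iterate_deriv 2).neg
    have h3 := ih hsm
    rw [lintegral_withDensity_eq_lintegral_mul _ hdm (by fun_prop)] at h3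
    refine lt_of_eq_of_lt (lintegral_congr fun x => ?_) h3
    rw [Pi.mul_apply, ← ENNReal.ofReal_mul (sq_nonneg x)]
    congr 1
    ring

/-- Smoothness of a compensated exponent under moment conditions on the jumps. -/
theorem integrable_and_contDiff_integral_exp_sub {Ω : Type*} [MeasurableSpace Ω] {M : Measure Ω} {a : Ω → ℝ}
    (ha : Measurable a) {A : Set Ω} (hA : MeasurableSet A)
    (hpow : ∀ n : ℕ, 2 ≤ n → Integrable (fun w => |a w| ^ n) M)
    (hcompl : IntegrableOn (fun w => |a w|) Aᶜ M) :
    (∀ s : ℝ, Integrable (fun w => Complex.exp ((s * a w : ℝ) * Complex.I)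
      - 1 - A.indicator (fun w => ((s * a w : ℝ) : ℂ) * Complex.I) w) M) ∧
    ContDiff ℝ ((⊤ : ℕ∞) : WithTop ℕ∞) fun s : ℝ => ∫ w, (Complex.exp ((s * a w : ℝ) * Complex.I)
      - 1 - A.indicator (fun w => ((s * a w : ℝ) : ℂ) * Complex.I) w) ∂M := by
  set k : Ω → ℝ := A.indicator a with hk
  have hkm : Measurable k := ha.indicator hA
  have hka (w : Ω) (hw : w ∈ A) : k w = a w := Set.indicator_of_mem hw _
  have hkc (w : Ω) (hw : w ∉ A) : k w = 0 := Set.indicator_of_notMem hw _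
  set c : Ω → ℝ := Aᶜ.indicator fun w => |a w| with hc
  have hci : Integrable c M := (integrable_indicator_iff hA.compl).2 hcompl
  have hca (w : Ω) (hw : w ∈ A) : c w = 0 := Set.indicator_of_notMem (by simpa using hw) _
  have hcc (w : Ω) (hw : w ∉ A) : c w = |a w| := Set.indicator_of_mem (by simpa using hw) _
  have hsq : Integrable (fun w => a w ^ 2) M := by simpa using hpow 2 le_rfl
  set f : ℝ → Ω → ℂ := fun s w => Complex.exp ((s * a w : ℝ) * Complex.I) - 1 -
    ((s * k w : ℝ) : ℂ) * Complex.I with hf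
  set f₁ : ℝ → Ω → ℂ := fun s w =>
    (a w : ℂ) * Complex.I * Complex.exp ((s * a w : ℝ) * Complex.I) - k w * Complex.I with hf₁
  set f₂ : ℝ → Ω → ℂ := fun s w =>
    -((a w : ℂ) ^ 2 * Complex.exp ((s * a w : ℝ) * Complex.I)) with hf₂
  have e0 (s : ℝ) : (fun w => Complex.exp ((s * a w : ℝ) * Complex.I)
      - 1 - A.indicator (fun w => ((s * a w : ℝ) : ℂ) * Complex.I) w) = f s := by
    ext1 w
    by_cases hw : w ∈ A
    · simp only [hf, Set.indicator_of_mem hw, hka w hw]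
    · simp only [hf, Set.indicator_of_notMem hw, hkc w hw]; simp
  have hexp (s : ℝ) (w : Ω) : HasDerivAt (fun s : ℝ => Complex.exp ((s * a w : ℝ) * Complex.I))
      ((a w : ℂ) * Complex.I * Complex.exp ((s * a w : ℝ) * Complex.I)) s := by
    have h1 : HasDerivAt (fun s : ℝ => ((s * a w : ℝ) : ℂ) * Complex.I) ((a w : ℂ) * Complex.I) s := by
      refine HasDerivAt.mul_const ?_ _
      simpa using ((hasDerivAt_id s).mul_const (a w)).ofReal_comp
    simpa [mul_comm] using h1.cexp
  have hd₁ (s : ℝ) (w : Ω) : HasDerivAt (fun s => f s w) (f₁ s w) s := by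
    refine ((hexp s w).sub_const 1).sub ?_
    refine HasDerivAt.mul_const ?_ _
    simpa using ((hasDerivAt_id s).mul_const (k w)).ofReal_comp
  have hd₂ (s : ℝ) (w : Ω) : HasDerivAt (fun s => f₁ s w) (f₂ s w) s := by
    have h1 := ((hexp s w).const_mul ((a w : ℂ) * Complex.I)).sub_const ((k w : ℂ) * Complex.I)
    convert! h1 using 1
    simp only [hf₂]
    linear_combination (-(a w : ℂ) ^ 2 * Complex.exp ((s * a w : ℝ) * Complex.I)) * Complex.I_sq
  have hb₀ (s : ℝ) (w : Ω) : ‖f s w‖ ≤ 2 * s ^ 2 * a w ^ 2 + |s| * c w := by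
    by_cases hw : w ∈ A
    · simp only [hf, hka w hw, hca w hw]
      refine (norm_exp_mul_I_sub_one_sub_le _).trans_eq ?_
      ring
    · simp only [hf, hkc w hw, hcc w hw]
      have h1 := norm_exp_mul_I_sub_one_le (s * a w)
      rw [abs_mul] at h1
      have : 0 ≤ 2 * s ^ 2 * a w ^ 2 := by positivity
      simp only [mul_zero, Complex.ofReal_zero, zero_mul, sub_zero]
      linarith
  have hb₁ (R s : ℝ) (hs : |s| ≤ R) (w : Ω) : ‖f₁ s w‖ ≤ R * a w ^ 2 + c w := by
    have hR : 0 ≤ R := (abs_nonneg _).trans hs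
    by_cases hw : w ∈ A
    · have e : f₁ s w = (a w : ℂ) * Complex.I * (Complex.exp ((s * a w : ℝ) * Complex.I) - 1) := by
        simp only [hf₁, hka w hw]; ring
      rw [e, norm_mul, norm_mul, Complex.norm_I, mul_one, Complex.norm_real, Real.norm_eq_abs,
        hca w hw]
      have h1 := norm_exp_mul_I_sub_one_le (s * a w)
      rw [abs_mul] at h1
      calc _ ≤ |a w| * (R * |a w|) := by gcongr; exact h1.trans (by gcongr)
        _ = _ := by rw [← sq_abs (a w)]; ring
    · simp only [hf₁, hkc w hw, hcc w hw]
      have : 0 ≤ R * a w ^ 2 := by positivity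
      simp only [Complex.ofReal_zero, zero_mul, sub_zero]
      rw [norm_mul, norm_mul, Complex.norm_I, Complex.norm_exp_ofReal_mul_I, Complex.norm_real,
        Real.norm_eq_abs]
      linarith
  have hb₂ (s : ℝ) (w : Ω) : ‖f₂ s w‖ ≤ a w ^ 2 := by
    simp only [hf₂]
    rw [norm_neg, norm_mul, Complex.norm_exp_ofReal_mul_I, norm_pow, Complex.norm_real,
      Real.norm_eq_abs, sq_abs, mul_one]
  have hm₀ (s : ℝ) : AEStronglyMeasurable (f s) M := by
    refine Measurable.aestronglyMeasurable ?_; fun_prop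
  have hm₁ (s : ℝ) : AEStronglyMeasurable (f₁ s) M := by
    refine Measurable.aestronglyMeasurable ?_; fun_prop
  have hm₂ (s : ℝ) : AEStronglyMeasurable (f₂ s) M := by
    refine Measurable.aestronglyMeasurable ?_; fun_prop
  have hball (s t : ℝ) (ht : t ∈ Metric.ball s 1) : |t| ≤ |s| + 1 := by
    have h1 := (mem_ball_iff_norm.1 ht).le
    have h2 := norm_le_norm_add_norm_sub' t s
    simp only [Real.norm_eq_abs] at h1 h2
    linarith
  have hi₀ (s : ℝ) : Integrable (f s) M :=
    (Integrable.add (hsq.const_mul (2 * s ^ 2)) (hci.const_mul |s|)).mono' (hm₀ s)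
      (ae_of_all _ (hb₀ s))
  have D₁ (s : ℝ) := hasDerivAt_integral_of_dominated_loc_of_deriv_le (μ := M) (F := f) (F' := f₁)
    (bound := fun w => (|s| + 1) * a w ^ 2 + c w) (Metric.ball_mem_nhds s one_pos)
    (Eventually.of_forall hm₀)
    (hi₀ s) (hm₁ s)
    (ae_of_all _ fun w t ht => hb₁ _ t (hball s t ht) w) ((hsq.const_mul _).add hci)
    (ae_of_all _ fun w t _ => hd₁ t w)
  have D₂ (s : ℝ) := hasDerivAt_integral_of_dominated_loc_of_deriv_le (μ := M) (F := f₁) (F' := f₂)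
    (bound := fun w => a w ^ 2) (Metric.ball_mem_nhds s one_pos)
    (Eventually.of_forall hm₁) (D₁ s).1 (hm₂ s)
    (ae_of_all _ fun w t _ => hb₂ t w) hsq (ae_of_all _ fun w t _ => hd₂ t w)
  -- the second derivative is, up to the sign, the characteristic function of `a² M` mapped by `a`
  have hdm : Measurable fun w => ENNReal.ofReal (a w ^ 2) := by fun_prop
  set ρ₀ := M.withDensity fun w => ENNReal.ofReal (a w ^ 2) with hρ₀
  have hfin : IsFiniteMeasure ρ₀ := isFiniteMeasure_withDensity_ofReal hsq.2
  have hchar (s : ℝ) : charFun (ρ₀.map a) s = -∫ w, f₂ s w ∂M := by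
    rw [charFun_apply_real, integral_map ha.aemeasurable (by fun_prop), hρ₀,
      integral_withDensity_eq_integral_toReal_smul hdm (ae_of_all _ fun _ => ENNReal.ofReal_lt_top),
      ← integral_neg]
    refine integral_congr_ae (ae_of_all _ fun w => ?_)
    simp only [hf₂]
    rw [ENNReal.toReal_ofReal (sq_nonneg _), Complex.real_smul, neg_neg]
    push_cast
    ring
  have hmom (n : ℕ) : MemLp id n (ρ₀.map a) := by
    rw [memLp_map_measure_iff (by fun_prop) ha.aemeasurable, Function.id_comp]
    rcases Nat.eq_zero_or_pos n with rfl | hn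
    · rw [Nat.cast_zero, memLp_zero_iff_aestronglyMeasurable]
      exact ha.aestronglyMeasurable
    · rw [← integrable_norm_rpow_iff ha.aestronglyMeasurable (by simpa using hn.ne')
        (ENNReal.natCast_ne_top n), hρ₀,
        integrable_withDensity_iff_integrable_smul₀' hdm.aemeasurable
        (ae_of_all _ fun _ => ENNReal.ofReal_lt_top)]
      refine (hpow (n + 2) (by omega)).congr (ae_of_all _ fun w => ?_)
      simp only
      rw [ENNReal.toReal_ofReal (sq_nonneg _), ENNReal.toReal_natCast, Real.rpow_natCast,
        Real.norm_eq_abs, smul_eq_mul, pow_add, sq_abs, mul_comm]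
  have hs₂ : ContDiff ℝ ((⊤ : ℕ∞) : WithTop ℕ∞) fun s => ∫ w, f₂ s w ∂M := by
    have h1 : (fun s => ∫ w, f₂ s w ∂M) = fun s => -charFun (ρ₀.map a) s := by
      ext1 s; rw [hchar, neg_neg]
    rw [h1]
    exact (contDiff_charFun' hmom).neg
  have hs₁ : ContDiff ℝ ((⊤ : ℕ∞) : WithTop ℕ∞) fun s => ∫ w, f₁ s w ∂M := by
    rw [contDiff_infty_iff_deriv]
    refine ⟨fun s => (D₂ s).2.differentiableAt, ?_⟩
    rwa [funext fun s => (D₂ s).2.deriv]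
  simp_rw [e0]
  refine ⟨hi₀, ?_⟩
  rw [contDiff_infty_iff_deriv]
  refine ⟨fun s => (D₁ s).2.differentiableAt, ?_⟩
  rwa [funext fun s => (D₁ s).2.deriv]

end Moments

/-! ### Moments of the invariant distribution -/

section InvariantMoments

variable {d : ℕ} {Q B : Matrix (Fin d) (Fin d) ℝ} {ν : Measure (Vec d)}

theorem integrable_norm_pow_of_lintegral_lt_top (hν : IsLevyMeasure ν)
    (hmom : ∀ n : ℕ, 1 ≤ n →
      ∫⁻ y in {y : Vec d | 1 < ‖y‖}, ENNReal.ofReal (‖y‖ ^ n) ∂ν < ∞) {n : ℕ} (hn : 1 ≤ n) :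
    IntegrableOn (fun y : Vec d => ‖y‖ ^ n) {y | 1 < ‖y‖} ν ∧
      (2 ≤ n → Integrable (fun y : Vec d => ‖y‖ ^ n) ν) := by
  have hm : MeasurableSet {y : Vec d | 1 < ‖y‖} :=
    (isOpen_lt continuous_const continuous_norm).measurableSet
  have h1 : IntegrableOn (fun y : Vec d => ‖y‖ ^ n) {y | 1 < ‖y‖} ν := by
    refine ⟨by fun_prop, ?_⟩
    rw [hasFiniteIntegral_iff_ofReal (ae_of_all _ fun y => by positivity)]
    exact hmom n hn
  refine ⟨h1, fun h2 => ?_⟩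
  refine (hν.integrable_min.add ((integrable_indicator_iff hm).2 h1)).mono' (by fun_prop)
    (ae_of_all _ fun y => ?_)
  rw [Real.norm_of_nonneg (by positivity), Pi.add_apply]
  rcases le_or_gt ‖y‖ 1 with hy | hy
  · rw [Set.indicator_of_notMem (by simpa using hy), add_zero,
      min_eq_right (pow_le_one₀ (norm_nonneg _) hy)]
    exact pow_le_pow_of_le_one (norm_nonneg _) hy h2
  · rw [Set.indicator_of_mem (by exact hy)]
    have : 0 ≤ min 1 (‖y‖ ^ 2) := by positivity
    linarith

/-- Under polynomial moments of the Lévy measure, `Φ_∞` is smooth along every line: it is the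
compensated exponent of the jumps `⟨e^{sB*} ξ, y⟩` under the measure `ds ν(dy)`. -/
theorem contDiff_jumpExponentInfty_smul (hν : IsLevyMeasure ν)
    (hB : ∀ z ∈ spectrum ℂ (B.map (algebraMap ℝ ℂ)), z.re < 0)
    (hmom : ∀ n : ℕ, 1 ≤ n →
      ∫⁻ y in {y : Vec d | 1 < ‖y‖}, ENNReal.ofReal (‖y‖ ^ n) ∂ν < ∞) (ξ : Vec d) :
    ContDiff ℝ ((⊤ : ℕ∞) : WithTop ℕ∞) fun s : ℝ => jumpExponentInfty B ν (s • ξ) := by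
  have hσ := hν.sigmaFinite
  obtain ⟨C, c, hC, hc, hdec⟩ := exists_flow_decay B hB
  set M : Measure (ℝ × Vec d) := (volume.restrict (Set.Ioi (0 : ℝ))).prod ν with hM
  set a : ℝ × Vec d → ℝ := fun p => inner ℝ (flow B.transpose p.1 ξ) p.2 with ha
  set A : Set (ℝ × Vec d) := {p | ‖p.2‖ ≤ 1} with hA
  have hac : Continuous a := by
    have h1 : Continuous fun p : ℝ × Vec d => flow B.transpose p.1 ξ :=
      (continuous_flow_apply B.transpose ξ).comp continuous_fst
    fun_prop
  have hAm : MeasurableSet A :=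
    (isClosed_le (show Continuous fun p : ℝ × Vec d => ‖p.2‖ by fun_prop)
      continuous_const).measurableSet
  have hbound : ∀ᵐ p ∂M, |a p| ≤ (C * ‖ξ‖ * Real.exp (-c * p.1)) * ‖p.2‖ := by
    have h0 : ∀ᵐ p ∂M, p.1 ∈ Set.Ioi (0 : ℝ) :=
      Measure.quasiMeasurePreserving_fst.ae (ae_restrict_mem measurableSet_Ioi)
    filter_upwards [h0] with p hp
    refine (abs_real_inner_le_norm _ _).trans ?_
    gcongr
    calc _ ≤ ‖flow B.transpose p.1‖ * ‖ξ‖ := ContinuousLinearMap.le_opNorm _ _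
      _ ≤ (C * Real.exp (-(c * p.1))) * ‖ξ‖ := by
        gcongr; exact (norm_flow_transpose_le B _).trans (hdec _ (le_of_lt hp))
      _ = _ := by rw [neg_mul]; ring
  have hexp (n : ℕ) (hn : 1 ≤ n) : Integrable (fun r : ℝ => (C * ‖ξ‖ * Real.exp (-c * r)) ^ n)
      (volume.restrict (Set.Ioi (0 : ℝ))) := by
    have hn' : (0 : ℝ) < n := by exact_mod_cast hn
    have h1 : IntegrableOn (fun r : ℝ => (C * ‖ξ‖) ^ n * Real.exp (-(n * c) * r)) (Set.Ioi 0) :=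
      (exp_neg_integrableOn_Ioi 0 (by positivity)).const_mul _
    refine h1.congr (ae_of_all _ fun r => ?_)
    simp only
    rw [mul_pow _ (Real.exp _), ← Real.exp_nat_mul]
    congr 2; ring
  have hind : Integrable ({y : Vec d | 1 < ‖y‖}.indicator fun y => ‖y‖ ^ 1) ν :=
    (integrable_indicator_iff (isOpen_lt continuous_const continuous_norm).measurableSet).2
      (integrable_norm_pow_of_lintegral_lt_top hν hmom (n := 1) le_rfl).1
  obtain ⟨hint, hsm⟩ := integrable_and_contDiff_integral_exp_sub (M := M) (a := a) hac.measurable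
    hAm (fun n hn => by
      have h1 := (hexp n (by omega)).mul_prod
        ((integrable_norm_pow_of_lintegral_lt_top hν hmom (n := n) (by omega)).2 hn)
      refine h1.mono' (by fun_prop) ?_
      filter_upwards [hbound] with p hp
      rw [Real.norm_of_nonneg (by positivity), ← mul_pow]
      gcongr)
    (by
      have h1 : Integrable (fun p : ℝ × Vec d => (C * ‖ξ‖ * Real.exp (-c * p.1)) ^ 1 *
          {y : Vec d | 1 < ‖y‖}.indicator (fun y => ‖y‖ ^ 1) p.2) M := (hexp 1 le_rfl).mul_prod hind
      refine Integrable.mono' (h1.integrableOn (s := Aᶜ)) hac.abs.aestronglyMeasurable ?_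
      rw [ae_restrict_iff' hAm.compl]
      filter_upwards [hbound] with p hp hpA
      rw [Real.norm_of_nonneg (abs_nonneg _),
        Set.indicator_of_mem (show p.2 ∈ {y : Vec d | 1 < ‖y‖} from by
          have hp1 : ¬ ‖p.2‖ ≤ 1 := hpA
          exact not_le.1 hp1),
        pow_one, pow_one]
      exact hp)
  convert! hsm using 2 with s
  have e (p : ℝ × Vec d) : Complex.exp ((s * a p : ℝ) * Complex.I) - 1 -
      A.indicator (fun w => ((s * a w : ℝ) : ℂ) * Complex.I) p =
      jumpIntegrand (flow B.transpose p.1 (s • ξ)) p.2 := by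
    have h1 : inner ℝ (flow B.transpose p.1 (s • ξ)) p.2 = s * a p := by
      rw [map_smul, real_inner_smul_left]
    by_cases hp : ‖p.2‖ ≤ 1
    · rw [jumpIntegrand_of_le hp, Set.indicator_of_mem (by exact hp), h1]
    · rw [jumpIntegrand_of_lt (not_le.1 hp), Set.indicator_of_notMem (by exact hp), h1, sub_zero]
  have hint' := hint s
  simp_rw [e] at hint' ⊢
  rw [integral_prod _ hint']
  rfl

/-- All coordinates of a random vector of law `h` have moments of all orders. -/
def HasCoordMoments (h : Measure (Vec d)) : Prop :=
  ∀ (i : Fin d) (n : ℕ), MemLp (fun y : Vec d => ((y i : ℝ) : ℂ)) n h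

/-- The one-dimensional marginals of the invariant distribution have smooth characteristic functions. -/
theorem hasCoordMoments_of_charFun (hν : IsLevyMeasure ν)
    (hB : ∀ z ∈ spectrum ℂ (B.map (algebraMap ℝ ℂ)), z.re < 0)
    (hlog : ∫⁻ y in {y : Vec d | 1 ≤ ‖y‖}, ENNReal.ofReal (Real.log ‖y‖) ∂ν < ∞)
    (hmom : ∀ n : ℕ, 1 ≤ n →
      ∫⁻ y in {y : Vec d | 1 < ‖y‖}, ENNReal.ofReal (‖y‖ ^ n) ∂ν < ∞)
    {μ : Measure (Vec d)} [IsProbabilityMeasure μ]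
    (hμ : ∀ ξ, charFun μ ξ = Complex.exp (exponentInfty Q B ν ξ)) : HasCoordMoments μ := by
  intro i n
  set e : Vec d := EuclideanSpace.single i 1
  set m : Measure ℝ := μ.map fun y => y i with hm
  have hmeas : Measurable fun y : Vec d => y i := by fun_prop
  have hmp : IsProbabilityMeasure m := Measure.isProbabilityMeasure_map hmeas.aemeasurable
  have hchar : charFun m = fun s => Complex.exp (exponentInfty Q B ν (s • e)) := by
    ext1 s
    rw [← hμ, charFun_apply_real, charFun_apply, hm,
      integral_map hmeas.aemeasurable (by fun_prop)]
    refine integral_congr_ae (ae_of_all _ fun y => ?_)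
    simp [e, real_inner_smul_right, EuclideanSpace.inner_single_right]
  have hsm : ContDiff ℝ ((⊤ : ℕ∞) : WithTop ℕ∞) (charFun m) := by
    have h1 := contDiff_jumpExponentInfty_smul hν hB hmom e
    rw [hchar]
    refine Complex.contDiff_exp.comp ?_
    simp_rw [exponentInfty_eq Q hν hB hlog, map_smul, real_inner_smul_left, real_inner_smul_right]
    refine ContDiff.add ?_ h1
    exact Complex.ofRealCLM.contDiff.comp
      (contDiff_const.mul (contDiff_id.mul (contDiff_id.mul contDiff_const)))
  have h2 := lintegral_pow_lt_top_of_contDiff_charFun (n + 1) hsm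
  rw [hm, lintegral_map (by fun_prop) hmeas] at h2
  have h3 : MemLp (fun y : Vec d => ((y i : ℝ) : ℂ)) (2 * (n + 1) : ℕ) μ := by
    have hm2 : AEStronglyMeasurable (fun y : Vec d => ((y i : ℝ) : ℂ)) μ := by fun_prop
    rw [← integrable_norm_rpow_iff hm2 (by exact_mod_cast (by omega : 2 * (n + 1) ≠ 0))
      (ENNReal.natCast_ne_top _)]
    have e1 (y : Vec d) : ‖((y i : ℝ) : ℂ)‖ ^ ((2 * (n + 1) : ℕ) : ℝ≥0∞).toReal =
        y i ^ (2 * (n + 1)) := by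
      rw [ENNReal.toReal_natCast, Real.rpow_natCast, Complex.norm_real, Real.norm_eq_abs, pow_mul,
        sq_abs, ← pow_mul]
    simp_rw [e1]
    refine ⟨by fun_prop, ?_⟩
    rw [hasFiniteIntegral_iff_ofReal (ae_of_all _ fun y => by rw [pow_mul]; positivity)]
    exact h2
  exact h3.mono_exponent (by exact_mod_cast (by omega : n ≤ 2 * (n + 1)))

end InvariantMoments

/-! ### Polynomials -/

section Polynomials

open ProbabilityTheory

variable {d : ℕ} {Q B : Matrix (Fin d) (Fin d) ℝ} {ν : Measure (Vec d)}

theorem continuous_polyFun (q : MvPolynomial (Fin d) ℂ) : Continuous (polyFun (d := d) q) := by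
  unfold polyFun
  refine q.continuous_eval.comp (continuous_pi fun i => ?_)
  fun_prop

/-- The functions with moments of all orders form an algebra, so polynomials of such functions have
moments of all orders. -/
theorem memLp_eval_of_memLp {Ω : Type*} [MeasurableSpace Ω] {m : Measure Ω} [IsFiniteMeasure m]
    {X : Ω → Fin d → ℂ} (hX : ∀ (i : Fin d) (n : ℕ), MemLp (fun w => X w i) n m)
    (q : MvPolynomial (Fin d) ℂ) (n : ℕ) : MemLp (fun w => MvPolynomial.eval (X w) q) n m := by
  induction q using MvPolynomial.induction_on generalizing n with
  | C a => simpa using memLp_const a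
  | add p q hp hq => simp only [map_add]; exact (hp n).add (hq n)
  | mul_X p i hp =>
    simp only [map_mul, MvPolynomial.eval_X]
    have : ENNReal.HolderTriple ((2 * n : ℕ) : ℝ≥0∞) ((2 * n : ℕ) : ℝ≥0∞) n := by
      constructor
      push_cast
      rw [ENNReal.mul_inv (by simp) (by simp), ← add_mul, ENNReal.inv_two_add_inv_two, one_mul]
    exact MemLp.mul' (hX i (2 * n)) (hp (2 * n))

theorem HasCoordMoments.integrable_polyFun {h : Measure (Vec d)} [IsProbabilityMeasure h]
    (hh : HasCoordMoments h) (A : Vec d →L[ℝ] Vec d) (q : MvPolynomial (Fin d) ℂ) (x : Vec d) :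
    Integrable (polyFun q) (shiftKernel A h x) := by
  rw [shiftKernel, integrable_map_measure (continuous_polyFun q).aestronglyMeasurable
    (by fun_prop)]
  have h1 := memLp_eval_of_memLp (m := h) (X := fun y i => (((A x + y) i : ℝ) : ℂ))
    (fun i n => by
      have h2 : MemLp (fun y : Vec d => (((A x) i : ℝ) : ℂ) + ((y i : ℝ) : ℂ)) n h :=
        (memLp_const (((A x) i : ℝ) : ℂ)).add (hh i n)
      convert! h2 using 2 with y
      exact Complex.ofReal_add _ _) q 1
  exact memLp_one_iff_integrable.1 (by exact_mod_cast h1)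

/-- The noise at time `t` is a convolution factor of the invariant distribution, so it inherits its
moments. -/
theorem hasCoordMoments_ouNoise (hQ : Q.PosSemidef) (hν : IsLevyMeasure ν)
    (hB : ∀ z ∈ spectrum ℂ (B.map (algebraMap ℝ ℂ)), z.re < 0)
    (hlog : ∫⁻ y in {y : Vec d | 1 ≤ ‖y‖}, ENNReal.ofReal (Real.log ‖y‖) ∂ν < ∞)
    {μ : Measure (Vec d)} [IsProbabilityMeasure μ]
    (hμ : ∀ ξ, charFun μ ξ = Complex.exp (exponentInfty Q B ν ξ)) (hmom : HasCoordMoments μ)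
    {t : ℝ} (ht : 0 ≤ t) : HasCoordMoments (ouNoise Q B ν t) := by
  intro i n
  have hn := isProbabilityMeasure_ouNoise (B := B) hQ hν ht
  rcases Nat.eq_zero_or_pos n with rfl | hn0
  · rw [Nat.cast_zero, memLp_zero_iff_aestronglyMeasurable]
    fun_prop
  have hp : (n : ℝ≥0∞) ≠ 0 := by exact_mod_cast hn0.ne'
  set f : Vec d → ℝ := fun y => ‖((y i : ℝ) : ℂ)‖ ^ (n : ℝ≥0∞).toReal with hf
  have hfi : Integrable f (μ.bind (shiftMarkovKernel (flow B t) (ouNoise Q B ν t))) := by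
    rw [coe_shiftMarkovKernel, bind_shiftKernel, map_flow_conv_ouNoise hQ hν hB hlog hμ ht]
    exact (hmom i n).integrable_norm_rpow hp (ENNReal.natCast_ne_top n)
  obtain ⟨x, hx⟩ := (Measure.ae_integrable_of_integrable_comp hfi).exists
  have hx' : Integrable f ((ouNoise Q B ν t).map fun y => flow B t x + y) := hx
  rw [hf, integrable_norm_rpow_iff (by fun_prop) hp (ENNReal.natCast_ne_top n),
    memLp_map_measure_iff (by fun_prop) (by fun_prop)] at hx'
  have h1 := hx'.sub (memLp_const (((flow B t x) i : ℝ) : ℂ))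
  convert! h1 using 1
  ext1 y
  simp

/-- Both sides are the integral of the polynomial against the law of `e^{tB} x + X` with `X` invariant. -/
theorem polynomial_intertwining (hQ : Q.PosSemidef) (hν : IsLevyMeasure ν)
    (hB : ∀ z ∈ spectrum ℂ (B.map (algebraMap ℝ ℂ)), z.re < 0)
    (hlog : ∫⁻ y in {y : Vec d | 1 ≤ ‖y‖}, ENNReal.ofReal (Real.log ‖y‖) ∂ν < ∞)
    {μ : Measure (Vec d)} [IsProbabilityMeasure μ]
    (hμ : ∀ ξ, charFun μ ξ = Complex.exp (exponentInfty Q B ν ξ)) (hmom : HasCoordMoments μ)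
    (q : MvPolynomial (Fin d) ℂ) {t : ℝ} (ht : 0 ≤ t) :
    (∀ x, Integrable (polyFun q) (ouTransition Q B ν t x)) ∧
    (∀ x, Integrable (polyFun q) (convKernel μ x)) ∧
    (∀ x, Integrable (kernelOp (ouTransition Q B ν t) (polyFun q)) (convKernel μ x)) ∧
    kernelOp (driftKernel B t) (kernelOp (convKernel μ) (polyFun q)) =
      kernelOp (convKernel μ) (kernelOp (ouTransition Q B ν t) (polyFun q)) := by
  have hn := isProbabilityMeasure_ouNoise (B := B) hQ hν ht
  let I := ContinuousLinearMap.id ℝ (Vec d)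
  have hcomp (x : Vec d) : (shiftMarkovKernel (flow B t) (ouNoise Q B ν t) ∘ₖ
      shiftMarkovKernel I μ) x = shiftKernel (flow B t) μ x := by
    rw [shiftMarkovKernel_comp, map_flow_conv_ouNoise hQ hν hB hlog hμ ht]
    rfl
  have hint (x : Vec d) : Integrable (polyFun q) ((shiftMarkovKernel (flow B t) (ouNoise Q B ν t) ∘ₖ
      shiftMarkovKernel I μ) x) := by
    rw [hcomp]
    exact hmom.integrable_polyFun _ q x
  rw [ouTransition_eq_shiftKernel hQ hν ht]
  refine ⟨fun x => (hasCoordMoments_ouNoise hQ hν hB hlog hμ hmom ht).integrable_polyFun _ q x,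
    fun x => hmom.integrable_polyFun I q x, fun x => (hint x).integral_comp, ?_⟩
  ext1 x
  have h1 := Kernel.integral_comp (hint x)
  rw [hcomp] at h1
  rw [kernelOp_driftKernel]
  exact h1

end Polynomials

theorem proposition5p2 {d : ℕ} (Q B : Matrix (Fin d) (Fin d) ℝ) (ν : Measure (Vec d))
    (hQ : Q.PosSemidef) (hν : IsLevyMeasure ν)
    (hQt : ∀ t : ℝ, 0 < t → 0 < (cov Q B t).det)
    (hB : ∀ z ∈ spectrum ℂ (B.map (algebraMap ℝ ℂ)), z.re < 0)
    (hlog : ∫⁻ y in {y : Vec d | 1 ≤ ‖y‖}, ENNReal.ofReal (Real.log ‖y‖) ∂ν < ∞) :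
    -- the Lévy-OU semigroup `P` of the triple `(Q, B, ν)` and its invariant distribution `μ`
    IsFellerWithGenerator (ouTransition Q B ν) (ouGenerator Q B ν) ∧
    ∃ μ : Measure (Vec d), IsInvariantDistribution (ouTransition Q B ν) μ ∧
      (∀ m, IsInvariantDistribution (ouTransition Q B ν) m → m = μ) ∧
      -- intertwining with the diffusion OU semigroups
      (∀ Q' : Matrix (Fin d) (Fin d) ℝ, Q'.PosSemidef →
        (∀ t : ℝ, 0 < t → 0 < (cov Q' B t).det) →
        (covInfty Q B - covInfty Q' B).PosSemidef →
        IsFellerWithGenerator (ouTransition Q' B 0) (ouGenerator Q' B 0) ∧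
        ∃ μ' : Measure (Vec d), IsInvariantDistribution (ouTransition Q' B 0) μ' ∧
          (∀ m, IsInvariantDistribution (ouTransition Q' B 0) m → m = μ') ∧
          ∃ h : Measure (Vec d), IsProbabilityMeasure h ∧
            (∀ ξ : Vec d, charFun h ξ = Complex.exp
              (((-(1 / 2) * inner ℝ (mulVecL (covInfty Q B - covInfty Q' B) ξ) ξ : ℝ) : ℂ)
                + jumpExponentInfty B ν ξ)) ∧
            IsInfinitelyDivisible h ∧
            ∀ (p : ℝ≥0∞) [Fact (1 ≤ p)],
              ∃ (Λ : Lp ℂ p μ →L[ℂ] Lp ℂ p μ') (P : ℝ → Lp ℂ p μ →L[ℂ] Lp ℂ p μ)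
                (P' : ℝ → Lp ℂ p μ' →L[ℂ] Lp ℂ p μ'),
                IsKernelOpOnLp Λ (convKernel h) ∧
                ∀ t : ℝ, 0 ≤ t →
                  IsKernelOpOnLp (P t) (ouTransition Q B ν t) ∧
                  IsKernelOpOnLp (P' t) (ouTransition Q' B 0 t) ∧
                  (P' t).comp Λ = Λ.comp (P t)) ∧
      -- intertwining with the drift semigroup on `L^∞(μ)`
      (∃ (Λ₁ : Lp ℂ ∞ μ →L[ℂ] Lp ℂ ∞ μ) (P D : ℝ → Lp ℂ ∞ μ →L[ℂ] Lp ℂ ∞ μ),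
        IsKernelOpOnLp Λ₁ (convKernel μ) ∧
        ∀ t : ℝ, 0 ≤ t →
          IsKernelOpOnLp (P t) (ouTransition Q B ν t) ∧
          IsKernelOpOnLp (D t) (driftKernel B t) ∧
          (D t).comp Λ₁ = Λ₁.comp (P t)) ∧
      -- intertwining with the drift semigroup on polynomials, under polynomial moments
      ((∀ n : ℕ, 1 ≤ n → ∫⁻ y in {y : Vec d | 1 < ‖y‖}, ENNReal.ofReal (‖y‖ ^ n) ∂ν < ∞) →
        ∀ (q : MvPolynomial (Fin d) ℂ) (t : ℝ), 0 ≤ t →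
          (∀ x, Integrable (polyFun q) (ouTransition Q B ν t x)) ∧
          (∀ x, Integrable (polyFun q) (convKernel μ x)) ∧
          (∀ x, Integrable (kernelOp (ouTransition Q B ν t) (polyFun q)) (convKernel μ x)) ∧
          kernelOp (driftKernel B t) (kernelOp (convKernel μ) (polyFun q)) =
            kernelOp (convKernel μ) (kernelOp (ouTransition Q B ν t) (polyFun q))) := by
  obtain ⟨μ, hμp, hμ⟩ := (isLevyExponent_exponentInfty Q hν hB hlog hQ).exists_charFun
  have hdet := hQt 1 one_pos
  have h0 := IsLevyMeasure.zero_measure (d := d)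
  have hinv : IsInvariantDistribution (ouTransition Q B ν) μ :=
    isInvariantDistribution_of_charFun hQ hν hB hlog hμ
  refine ⟨isFellerWithGenerator_ouTransition hQ hν, μ, hinv,
    fun m hm => isInvariantDistribution_unique hQ hν hB hlog hm hinv,
    fun Q' hQ' _ hQQ' => ⟨isFellerWithGenerator_ouTransition hQ' h0, ?_⟩,
    exists_intertwining_drift hQ hν hB hlog hdet hμ,
    fun hmom q t ht => polynomial_intertwining hQ hν hB hlog hμ
      (hasCoordMoments_of_charFun hν hB hlog hmom hμ) q ht⟩
  have hlog0 : ∫⁻ y in {y : Vec d | 1 ≤ ‖y‖}, ENNReal.ofReal (Real.log ‖y‖)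
      ∂(0 : Measure (Vec d)) < ∞ := by simp
  obtain ⟨μ', hμp', hμ'⟩ := (isLevyExponent_exponentInfty Q' h0 hB hlog0 hQ').exists_charFun
  have hinv' : IsInvariantDistribution (ouTransition Q' B 0) μ' :=
    isInvariantDistribution_of_charFun hQ' h0 hB hlog0 hμ'
  have hexp := isLevyExponent_intertwiningExponent hν hB hlog hQQ'
  obtain ⟨h, hhp, hh⟩ := hexp.exists_charFun
  exact ⟨μ', hinv', fun m hm => isInvariantDistribution_unique hQ' h0 hB hlog0 hm hinv',
    h, hhp, hh, hexp.isInfinitelyDivisible hh,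
    fun p _ => exists_intertwining_diffusion hQ hQ' hν hB hlog hh hμ hμ'⟩
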